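/- Let $K$ be a field of characteristic $0$ and let $H$ be a Hopf $K$-algebra with antipode $S$ and with an ad-invariant integral $\lambda\in H^*$, i.e. $\lambda$ is a left and right integral in $H^*$ with $\lambda(1)=1$ and $\lambda(h_{(1)}xS(h_{(2)}))=\varepsilon(h)\lambda(x)=\lambda(S(h_{(1)})xh_{(2)})$ for all $h,x\in H$. Let $(A,H,\pi,\sigma)$ be a splitting datum: $A$ is a $K$-bialgebra, $\sigma:H\to A$ is a bialgebra homomorphism and $\pi:A\to H$ is a coalgebra homomorphism with $\pi\sigma=\mathrm{Id}_H$ and $\pi(\sigma(h)x\sigma(h'))=h\pi(x)h'$. Let $(R,\xi)$ be the associated pre-bialgebra with cocycle in the category ${}^H_H\mathcal{YD}$ of left-left Yetter–Drinfeld modules, that is, $R=\{a\in A: a_{(1)}\otimes\pi(a_{(2)})=a\otimes 1_H\}$ with, for $\tau(a)=a_{(1)}\sigma S\pi(a_{(2)})$, $$h\cdot r=\sigma(h_{(1)})\,r\,\sigma S(h_{(2)}),\quad \rho(r)=\pi(r_{(1)})\otimes r_{(2)},\quad \Delta_R(r)=\tau(r_{(1)})\otimes r_{(2)},\quad \varepsilon_R=\varepsilon_A|_R,$$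 $$m_R(r\otimes s)=\tau(rs),\qquad 1_R=1_A,\qquad \xi(r\otimes s)=\pi(rs)\in H .$$ The space $R\otimes R$ carries the braided tensor product coalgebra structure $\Delta(r\otimes s)=r^{(1)}\otimes r^{(2)}_{\langle-1\rangle}s^{(1)}\otimes r^{(2)}_{\langle0\rangle}\otimes s^{(2)}$. The map $r\otimes h\mapsto r\sigma(h)$ is an isomorphism $R\,\#_\xi H\to A$, by which $A$ is identified with $R\otimes H$. Suppose that $\sigma(H)=\mathrm{Corad}(A)$, the coradical of $A$ (the sum of its simple subcoalgebras). Then $\lambda\xi:R\otimes R\to K$ has a convolution inverse $v=(\lambda\xi)^{-1}$, the functional $v_A=\mho^2(v):A\otimes A\to K$, $$v_A\big((r\# h)\otimes(s\# k)\big)=v(r\otimes h s)\,\varepsilon_H(k),$$ is a gauge transformation of $A$ (a unital convolution invertible functional on $A\otimes A$), and there is a connected dual quasi-bialgebra $(Q,m,u,\Delta,\varepsilon,\alpha)$ in ${}^H_H\mathcal{YD}$ (connected: the coradical of $Q$ is $K1_Q$) such that $A^{v_A}\cong Q\# H$ as dual quasi-bialgebras. Here $A^{v_A}$ is the dual quasi-bialgebra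 with the coalgebra structure and unit of $A$, multiplication $v_A*m_A*v_A^{-1}$ and reassociator $(\varepsilon\otimes v_A)*v_A(A\otimes m_A)*v_A^{-1}(m_A\otimes A)*(v_A^{-1}\otimes\varepsilon)$, and $Q\# H$ is the bosonization of $Q$ by $H$: the dual quasi-bialgebra $Q\otimes H$ with unit $1\#1$, counit $\varepsilon\otimes\varepsilon_H$, $$\Delta(r\# h)=(r^{(1)}\# r^{(2)}_{\langle-1\rangle}h_{(1)})\otimes(r^{(2)}_{\langle0\rangle}\# h_{(2)}),\qquad (r\# h)(s\# l)=m(r\otimes h_{(1)}s)\# h_{(2)}l,$$ and reassociator $(r\# h)\otimes(s\# l)\otimes(t\# k)\mapsto\alpha(r\otimes h_{(1)}s\otimes h_{(2)}lt)\,\varepsilon_H(k)$. In particular, $A$ is quasi-isomorphic to $Q\# H$: for some gauge transformation $w$ of $Q\# H$, $A\cong(Q\# H)^{w}$ as dual quasi-bialgebras. -/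

import Mathlib

open TensorProduct

universe u v w

noncomputable section

/-! ### Coalgebra data, convolution, coradical -/

section Coalg

variable {K : Type u} [Field K]

/-- A comultiplication and a counit; the axioms are `CoalgData.IsCoalgebra`. -/
structure CoalgData (K : Type u) [Field K] (C : Type v) [AddCommGroup C] [Module K C] where
  comul : C →ₗ[K] C ⊗[K] C
  counit : C →ₗ[K] K

namespace CoalgData

variable {C : Type v} [AddCommGroup C] [Module K C] {D : Type w} [AddCommGroup D] [Module K D]

/-- The coalgebra data underlying a Mathlib coalgebra. -/
def ofCoalgebra (K : Type u) [Field K] (C : Type v) [AddCommGroup C] [Module K C]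
    [Coalgebra K C] : CoalgData K C where
  comul := Coalgebra.comul
  counit := Coalgebra.counit

/-- Coassociativity and counitality. -/
structure IsCoalgebra (X : CoalgData K C) : Prop where
  coassoc : ∀ c, TensorProduct.assoc K C C C (X.comul.rTensor C (X.comul c)) =
    X.comul.lTensor C (X.comul c)
  counit_left : ∀ c, X.counit.rTensor C (X.comul c) = (1 : K) ⊗ₜ[K] c
  counit_right : ∀ c, X.counit.lTensor C (X.comul c) = c ⊗ₜ[K] (1 : K)

/-- Coalgebra homomorphisms. -/
structure IsCoalgMap (X : CoalgData K C) (Y : CoalgData K D) (f : C →ₗ[K] D) : Prop where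
  map_comul : ∀ c, Y.comul (f c) = TensorProduct.map f f (X.comul c)
  map_counit : ∀ c, Y.counit (f c) = X.counit c

/-- The usual (unbraided) tensor product of two coalgebras over `K`. -/
def tensor (X : CoalgData K C) (Y : CoalgData K D) : CoalgData K (C ⊗[K] D) where
  comul := (TensorProduct.tensorTensorTensorComm K C C D D).toLinearMap ∘ₗ
    TensorProduct.map X.comul Y.comul
  counit := (TensorProduct.lid K K).toLinearMap ∘ₗ TensorProduct.map X.counit Y.counit

/-- Convolution `(f * g)(c) = f(c₁) g(c₂)` of a scalar valued `f` with a vector valued `g`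
(with `M = K` it is the usual convolution of functionals). -/
def convL {M : Type*} [AddCommGroup M] [Module K M] (X : CoalgData K C)
    (f : C →ₗ[K] K) (g : C →ₗ[K] M) : C →ₗ[K] M :=
  (TensorProduct.lid K M).toLinearMap ∘ₗ TensorProduct.map f g ∘ₗ X.comul

/-- Convolution `(g * f)(c) = g(c₁) f(c₂)` of a vector valued `g` with a scalar valued `f`. -/
def convR {M : Type*} [AddCommGroup M] [Module K M] (X : CoalgData K C)
    (g : C →ₗ[K] M) (f : C →ₗ[K] K) : C →ₗ[K] M :=
  (TensorProduct.rid K M).toLinearMap ∘ₗ TensorProduct.map g f ∘ₗ X.comul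

/-- `f` and `g` are mutually inverse functionals for the convolution product. -/
def IsConvInv (X : CoalgData K C) (f g : C →ₗ[K] K) : Prop :=
  X.convL f g = X.counit ∧ X.convL g f = X.counit

/-- `N` is a subcoalgebra: `Δ(N) ⊆ N ⊗ N`. -/
def IsSubcoalgebra (X : CoalgData K C) (N : Submodule K C) : Prop :=
  ∀ x ∈ N, X.comul x ∈ LinearMap.range (TensorProduct.map N.subtype N.subtype)

/-- `N` is a simple subcoalgebra. -/
def IsSimpleSubcoalgebra (X : CoalgData K C) (N : Submodule K C) : Prop :=
  X.IsSubcoalgebra N ∧ N ≠ ⊥ ∧ ∀ N' ≤ N, X.IsSubcoalgebra N' → N' = ⊥ ∨ N' = N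

/-- The coradical: the sum of all simple subcoalgebras. -/
def coradical (X : CoalgData K C) : Submodule K C :=
  sSup {N | X.IsSimpleSubcoalgebra N}

end CoalgData

end Coalg

/-! ### Maps on threefold and fourfold tensor powers -/

section Powers

variable (K : Type u) [Field K] {D : Type v} [AddCommGroup D] [Module K D]

/-- `x ⊗ y ↦ ε(y) x`. -/
def dropRight {W : Type*} [AddCommGroup W] [Module K W] (ε : D →ₗ[K] K) :
    W ⊗[K] D →ₗ[K] W :=
  (TensorProduct.rid K W).toLinearMap ∘ₗ ε.lTensor W

/-- `m ⊗ W : x ⊗ (y ⊗ z) ↦ m(x ⊗ y) ⊗ z`. -/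
def mulFirst {W : Type*} [AddCommGroup W] [Module K W] (m : D ⊗[K] D →ₗ[K] D) :
    D ⊗[K] (D ⊗[K] W) →ₗ[K] D ⊗[K] W :=
  m.rTensor W ∘ₗ (TensorProduct.assoc K D D W).symm.toLinearMap

/-- `ε ⊗ f`, for `f` a functional. -/
def epsTensor {W : Type*} [AddCommGroup W] [Module K W] (ε : D →ₗ[K] K) (f : W →ₗ[K] K) :
    D ⊗[K] W →ₗ[K] K :=
  (TensorProduct.lid K K).toLinearMap ∘ₗ TensorProduct.map ε f

/-- `v ⊗ ε : x ⊗ (y ⊗ z) ↦ v(x ⊗ y) ε(z)`. -/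
def tensorEps₂ (ε : D →ₗ[K] K) (v : D ⊗[K] D →ₗ[K] K) : D ⊗[K] (D ⊗[K] D) →ₗ[K] K :=
  v ∘ₗ (dropRight K ε).lTensor D

/-- `α ⊗ ε : x ⊗ (y ⊗ (z ⊗ t)) ↦ α(x ⊗ (y ⊗ z)) ε(t)`. -/
def tensorEps₃ (ε : D →ₗ[K] K) (α : D ⊗[K] (D ⊗[K] D) →ₗ[K] K) :
    D ⊗[K] (D ⊗[K] (D ⊗[K] D)) →ₗ[K] K :=
  α ∘ₗ ((dropRight K ε).lTensor D).lTensor D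

end Powers

/-- The identities relating the multiplication `m`, the unit element `e` and the reassociator `α`
of a dual quasi-bialgebra with underlying vector space `D`.  The coalgebra structures `X₃`, `X₄`
on the tensor powers `D^{⊗3}`, `D^{⊗4}` (which define the convolution products) and the counit `ε`
of `D` are parameters, so that the same identities can be used for vector spaces and for
Yetter-Drinfeld modules. -/
structure QuasiLaws {K : Type u} [Field K] {D : Type v} [AddCommGroup D] [Module K D]
    (ε : D →ₗ[K] K) (X₃ : CoalgData K (D ⊗[K] (D ⊗[K] D)))
    (X₄ : CoalgData K (D ⊗[K] (D ⊗[K] (D ⊗[K] D))))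
    (m : D ⊗[K] D →ₗ[K] D) (e : D) (α : D ⊗[K] (D ⊗[K] D) →ₗ[K] K) : Prop where
  one_mul : ∀ x, m (e ⊗ₜ x) = x
  mul_one : ∀ x, m (x ⊗ₜ e) = x
  invertible : ∃ β, X₃.IsConvInv α β
  -- `α(D⊗D⊗m) * α(m⊗D⊗D) = (ε⊗α) * α(D⊗m⊗D) * (α⊗ε)`
  cocycle : X₄.convL (α ∘ₗ (m.lTensor D).lTensor D) (α ∘ₗ mulFirst K m) =
    X₄.convL (X₄.convL (epsTensor K ε α) (α ∘ₗ (mulFirst K m).lTensor D)) (tensorEps₃ K ε α)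
  unital_left : ∀ x y, α (e ⊗ₜ (x ⊗ₜ y)) = ε x * ε y
  unital_mid : ∀ x y, α (x ⊗ₜ (e ⊗ₜ y)) = ε x * ε y
  unital_right : ∀ x y, α (x ⊗ₜ (y ⊗ₜ e)) = ε x * ε y
  -- `m(D⊗m) * α = α * m(m⊗D)`
  quasi_assoc : X₃.convR (m ∘ₗ m.lTensor D) α = X₃.convL α (m ∘ₗ mulFirst K m)

/-! ### Dual quasi-bialgebras over a field -/

/-- The data `(D, m, u, Δ, ε, α)` of a dual quasi-bialgebra; the axioms are
`DQBData.IsDualQuasiBialgebra`. -/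
structure DQBData (K : Type u) [Field K] (D : Type v) [AddCommGroup D] [Module K D]
    extends CoalgData K D where
  mul : D ⊗[K] D →ₗ[K] D
  one : D
  reassoc : D ⊗[K] (D ⊗[K] D) →ₗ[K] K

namespace DQBData

variable {K : Type u} [Field K] {D : Type v} [AddCommGroup D] [Module K D]
  {E : Type w} [AddCommGroup E] [Module K E]

/-- The coalgebra `D ⊗ D`. -/
def sq (X : DQBData K D) : CoalgData K (D ⊗[K] D) := X.toCoalgData.tensor X.toCoalgData

/-- The coalgebra `D ⊗ D ⊗ D`. -/
def cube (X : DQBData K D) : CoalgData K (D ⊗[K] (D ⊗[K] D)) := X.toCoalgData.tensor X.sq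

/-- `X` is a dual quasi-bialgebra. -/
structure IsDualQuasiBialgebra (X : DQBData K D) : Prop where
  coalgebra : X.IsCoalgebra
  mul_coalg : CoalgData.IsCoalgMap X.sq X.toCoalgData X.mul
  one_coalg : CoalgData.IsCoalgMap (CoalgData.ofCoalgebra K K) X.toCoalgData
    (LinearMap.toSpanSingleton K D X.one)
  laws : QuasiLaws X.counit X.cube (X.toCoalgData.tensor X.cube) X.mul X.one X.reassoc

/-- A bialgebra, with the trivial reassociator `ε ⊗ ε ⊗ ε`. -/
def ofBialgebra (K : Type u) [Field K] (A : Type v) [Ring A] [Bialgebra K A] : DQBData K A where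
  toCoalgData := CoalgData.ofCoalgebra K A
  mul := LinearMap.mul' K A
  one := 1
  reassoc := epsTensor K Coalgebra.counit (epsTensor K Coalgebra.counit Coalgebra.counit)

/-- Gauge transformations: unital convolution invertible functionals on `D ⊗ D`
(bundled with the convolution inverse, which is unique when `D` is a coalgebra). -/
structure Gauge (X : DQBData K D) where
  toFun : D ⊗[K] D →ₗ[K] K
  inv : D ⊗[K] D →ₗ[K] K
  isConvInv : X.sq.IsConvInv toFun inv
  one_left : ∀ x, toFun (X.one ⊗ₜ x) = X.counit x
  one_right : ∀ x, toFun (x ⊗ₜ X.one) = X.counit x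

/-- The twist `D^v`, with multiplication `v * m * v⁻¹` and reassociator
`(ε ⊗ v) * v(D ⊗ m) * α * v⁻¹(m ⊗ D) * (v⁻¹ ⊗ ε)`. -/
def twist (X : DQBData K D) (g : X.Gauge) : DQBData K D where
  toCoalgData := X.toCoalgData
  mul := X.sq.convR (X.sq.convL g.toFun X.mul) g.inv
  one := X.one
  reassoc :=
    X.cube.convL (epsTensor K X.counit g.toFun) <|
    X.cube.convL (g.toFun ∘ₗ X.mul.lTensor D) <|
    X.cube.convL X.reassoc <|
    X.cube.convL (g.inv ∘ₗ mulFirst K X.mul) (tensorEps₂ K X.counit g.inv)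

/-- Isomorphisms of dual quasi-bialgebras. -/
structure Iso (X : DQBData K D) (Y : DQBData K E) where
  equiv : D ≃ₗ[K] E
  coalg : CoalgData.IsCoalgMap X.toCoalgData Y.toCoalgData equiv.toLinearMap
  map_one : equiv X.one = Y.one
  map_mul : ∀ x y, equiv (X.mul (x ⊗ₜ y)) = Y.mul (equiv x ⊗ₜ equiv y)
  map_reassoc : ∀ x y z,
    Y.reassoc (equiv x ⊗ₜ (equiv y ⊗ₜ equiv z)) = X.reassoc (x ⊗ₜ (y ⊗ₜ z))

/-- Two dual quasi-bialgebras `X`, `Y` are quasi-isomorphic if `X ≅ Y^v` for some gauge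
transformation `v` of `Y`. -/
def QuasiIsomorphic (X : DQBData K D) (Y : DQBData K E) : Prop :=
  X.IsDualQuasiBialgebra ∧ Y.IsDualQuasiBialgebra ∧ ∃ g : Y.Gauge, Nonempty (X.Iso (Y.twist g))

end DQBData

/-! ### Yetter-Drinfeld modules and coalgebras in the Yetter-Drinfeld category -/

section YD

variable {K : Type u} [Field K] {H : Type v} [Ring H] [HopfAlgebra K H]

/-- The diagonal action `h(v ⊗ w) = h₁v ⊗ h₂w`. -/
def tensorAct {V W : Type*} [AddCommGroup V] [Module K V] [AddCommGroup W] [Module K W]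
    (aV : H ⊗[K] V →ₗ[K] V) (aW : H ⊗[K] W →ₗ[K] W) :
    H ⊗[K] (V ⊗[K] W) →ₗ[K] V ⊗[K] W :=
  TensorProduct.map aV aW ∘ₗ (TensorProduct.tensorTensorTensorComm K H H V W).toLinearMap ∘ₗ
    (Coalgebra.comul (R := K) (A := H)).rTensor (V ⊗[K] W)

/-- The codiagonal coaction `ρ(v ⊗ w) = v₋₁ w₋₁ ⊗ v₀ ⊗ w₀`. -/
def tensorCoact {V W : Type*} [AddCommGroup V] [Module K V] [AddCommGroup W] [Module K W]
    (cV : V →ₗ[K] H ⊗[K] V) (cW : W →ₗ[K] H ⊗[K] W) :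
    V ⊗[K] W →ₗ[K] H ⊗[K] (V ⊗[K] W) :=
  (LinearMap.mul' K H).rTensor (V ⊗[K] W) ∘ₗ
    (TensorProduct.tensorTensorTensorComm K H V H W).toLinearMap ∘ₗ TensorProduct.map cV cW

/-- The braiding `v ⊗ w ↦ v₋₁ w ⊗ v₀`. -/
def braid {V W : Type*} [AddCommGroup V] [Module K V] [AddCommGroup W] [Module K W]
    (cV : V →ₗ[K] H ⊗[K] V) (aW : H ⊗[K] W →ₗ[K] W) : V ⊗[K] W →ₗ[K] W ⊗[K] V :=
  aW.rTensor V ∘ₗ (TensorProduct.rightComm K H V W).toLinearMap ∘ₗ cV.rTensor W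

/-- The braided comultiplication
`Δ(v ⊗ w) = (v₁ ⊗ (v₂)₋₁ w₁) ⊗ ((v₂)₀ ⊗ w₂)` on `V ⊗ W`, for `V` a comodule coalgebra and `W` a
module coalgebra over `H`. -/
def braidedComul {V W : Type*} [AddCommGroup V] [Module K V] [AddCommGroup W] [Module K W]
    (ΔV : V →ₗ[K] V ⊗[K] V) (cV : V →ₗ[K] H ⊗[K] V)
    (ΔW : W →ₗ[K] W ⊗[K] W) (aW : H ⊗[K] W →ₗ[K] W) :
    V ⊗[K] W →ₗ[K] (V ⊗[K] W) ⊗[K] (V ⊗[K] W) :=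
  (TensorProduct.tensorTensorTensorAssoc K V W V W).symm.toLinearMap ∘ₗ
    ((braid cV aW).lTensor V).rTensor W ∘ₗ
    (TensorProduct.tensorTensorTensorAssoc K V V W W).toLinearMap ∘ₗ TensorProduct.map ΔV ΔW

/-- The data of a coalgebra in the category of left-left Yetter-Drinfeld modules over `H`: an action
and a coaction of `H`, a comultiplication and a counit.  The axioms are `YDData.IsYDCoalgebra`. -/
structure YDData (K : Type u) [Field K] (H : Type v) [Ring H] [HopfAlgebra K H]
    (V : Type w) [AddCommGroup V] [Module K V] extends CoalgData K V where
  act : H ⊗[K] V →ₗ[K] V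
  coact : V →ₗ[K] H ⊗[K] V

/-- `h ⊗ v ↦ h₁ v₋₁ S(h₃) ⊗ h₂ v₀`. -/
def ydTwist {V : Type*} [AddCommGroup V] [Module K V]
    (a : H ⊗[K] V →ₗ[K] V) (c : V →ₗ[K] H ⊗[K] V) : H ⊗[K] V →ₗ[K] H ⊗[K] V :=
  -- `((g ⊗ k) ⊗ x) ⊗ (h ⊗ v) ↦ g x S(k) ⊗ h v`
  TensorProduct.map
    (LinearMap.mul' K H ∘ₗ
      TensorProduct.map (LinearMap.mul' K H) (HopfAlgebraStruct.antipode K) ∘ₗ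
      (TensorProduct.rightComm K H H H).toLinearMap) a ∘ₗ
  (TensorProduct.tensorTensorTensorComm K (H ⊗[K] H) H H V).toLinearMap ∘ₗ
  -- `h ⊗ v ↦ ((h₁ ⊗ h₃) ⊗ h₂) ⊗ (v₋₁ ⊗ v₀)`
  TensorProduct.map
    ((TensorProduct.rightComm K H H H).toLinearMap ∘ₗ
      (Coalgebra.comul (R := K) (A := H)).rTensor H ∘ₗ Coalgebra.comul) c

namespace YDData

variable {V W : Type w} [AddCommGroup V] [Module K V] [AddCommGroup W] [Module K W]

/-- The tensor product of coalgebras in the Yetter-Drinfeld category. -/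
def tensor (X : YDData K H V) (Y : YDData K H W) : YDData K H (V ⊗[K] W) where
  comul := braidedComul X.comul X.coact Y.comul Y.act
  counit := epsTensor K X.counit Y.counit
  act := tensorAct X.act Y.act
  coact := tensorCoact X.coact Y.coact

/-- `X` is a coalgebra in the category of left-left Yetter-Drinfeld modules over `H`. -/
structure IsYDCoalgebra (X : YDData K H V) : Prop where
  coalgebra : X.IsCoalgebra
  -- left module
  one_act : ∀ x, X.act ((1 : H) ⊗ₜ x) = x
  mul_act : ∀ (g h : H) (x : V), X.act ((g * h) ⊗ₜ x) = X.act (g ⊗ₜ X.act (h ⊗ₜ x))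
  -- left comodule
  coact_coassoc : ∀ x, TensorProduct.assoc K H H V
      ((Coalgebra.comul (R := K) (A := H)).rTensor V (X.coact x)) = X.coact.lTensor H (X.coact x)
  coact_counit : ∀ x, (Coalgebra.counit (R := K) (A := H)).rTensor V (X.coact x) = (1 : K) ⊗ₜ x
  -- `ρ(h x) = h₁ x₋₁ S(h₃) ⊗ h₂ x₀`
  yetterDrinfeld : ∀ z, X.coact (X.act z) = ydTwist X.act X.coact z
  -- `Δ` and `ε` are linear and colinear over `H`
  comul_act : ∀ (h : H) (x : V),
    X.comul (X.act (h ⊗ₜ x)) = tensorAct X.act X.act (h ⊗ₜ X.comul x)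
  comul_coact : ∀ x, tensorCoact X.coact X.coact (X.comul x) = X.comul.lTensor H (X.coact x)
  counit_act : ∀ (h : H) (x : V),
    X.counit (X.act (h ⊗ₜ x)) = Coalgebra.counit (R := K) h * X.counit x
  counit_coact : ∀ x, X.counit.lTensor H (X.coact x) = (1 : H) ⊗ₜ X.counit x

/-- `f` commutes with the actions and the coactions. -/
structure IsYDMap (X : YDData K H V) (Y : YDData K H W) (f : V →ₗ[K] W) : Prop where
  map_act : ∀ (h : H) (x : V), f (X.act (h ⊗ₜ x)) = Y.act (h ⊗ₜ f x)
  map_coact : ∀ x, Y.coact (f x) = f.lTensor H (X.coact x)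

end YDData

/-- A dual quasi-bialgebra `(Q, m, u, Δ, ε, α)` in the braided monoidal category of left-left
Yetter-Drinfeld modules over `H`. -/
structure YDDualQuasiBialgebra (K : Type u) [Field K] (H : Type v) [Ring H] [HopfAlgebra K H]
    (Q : Type w) [AddCommGroup Q] [Module K Q] extends YDData K H Q where
  mul : Q ⊗[K] Q →ₗ[K] Q
  one : Q
  reassoc : Q ⊗[K] (Q ⊗[K] Q) →ₗ[K] K
  isYDCoalgebra : toYDData.IsYDCoalgebra
  mul_yd : (toYDData.tensor toYDData).IsYDMap toYDData mul
  mul_coalg : CoalgData.IsCoalgMap (toYDData.tensor toYDData).toCoalgData toCoalgData mul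
  one_act : ∀ h : H, act (h ⊗ₜ one) = Coalgebra.counit (R := K) h • one
  one_coact : coact one = (1 : H) ⊗ₜ one
  one_coalg : CoalgData.IsCoalgMap (CoalgData.ofCoalgebra K K) toCoalgData
    (LinearMap.toSpanSingleton K Q one)
  reassoc_act : ∀ (h : H) (z : Q ⊗[K] (Q ⊗[K] Q)),
    reassoc ((toYDData.tensor (toYDData.tensor toYDData)).act (h ⊗ₜ z)) =
      Coalgebra.counit (R := K) h * reassoc z
  reassoc_coact : ∀ z : Q ⊗[K] (Q ⊗[K] Q),
    reassoc.lTensor H ((toYDData.tensor (toYDData.tensor toYDData)).coact z) =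
      (1 : H) ⊗ₜ reassoc z
  laws : QuasiLaws counit (toYDData.tensor (toYDData.tensor toYDData)).toCoalgData
    (toYDData.tensor (toYDData.tensor (toYDData.tensor toYDData))).toCoalgData mul one reassoc

/-- `(q # h) ⊗ w ↦ q ⊗ h w`. -/
def pushAct {V W : Type*} [AddCommGroup V] [Module K V] [AddCommGroup W] [Module K W]
    (aW : H ⊗[K] W →ₗ[K] W) : (V ⊗[K] H) ⊗[K] W →ₗ[K] V ⊗[K] W :=
  aW.lTensor V ∘ₗ (TensorProduct.assoc K V H W).toLinearMap

/-- `q # h ↦ ε(h) q`. -/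
def dropH (K : Type u) [Field K] (H : Type v) [Ring H] [HopfAlgebra K H]
    (V : Type*) [AddCommGroup V] [Module K V] : V ⊗[K] H →ₗ[K] V :=
  dropRight K (Coalgebra.counit (R := K) (A := H))

/-- `℧²(v)((x # h) ⊗ (y # k)) = v(x ⊗ h y) ε(k)`. -/
def mho₂ {V : Type*} [AddCommGroup V] [Module K V] (a : H ⊗[K] V →ₗ[K] V)
    (f : V ⊗[K] V →ₗ[K] K) : (V ⊗[K] H) ⊗[K] (V ⊗[K] H) →ₗ[K] K :=
  f ∘ₗ pushAct a ∘ₗ (dropH K H V).lTensor (V ⊗[K] H)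

/-- `℧³(α)((x # h) ⊗ (y # k) ⊗ (z # l)) = α(x ⊗ h₁ y ⊗ h₂ k z) ε(l)`. -/
def mho₃ {V : Type*} [AddCommGroup V] [Module K V] (a : H ⊗[K] V →ₗ[K] V)
    (α : V ⊗[K] (V ⊗[K] V) →ₗ[K] K) :
    (V ⊗[K] H) ⊗[K] ((V ⊗[K] H) ⊗[K] (V ⊗[K] H)) →ₗ[K] K :=
  α ∘ₗ pushAct (tensorAct a a) ∘ₗ
    (pushAct a ∘ₗ (dropH K H V).lTensor (V ⊗[K] H)).lTensor (V ⊗[K] H)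

namespace YDDualQuasiBialgebra

variable {Q : Type w} [AddCommGroup Q] [Module K Q]

/-- `Q` is connected: its coradical is `K 1`. -/
def Connected (X : YDDualQuasiBialgebra K H Q) : Prop := X.coradical = K ∙ X.one

/-- The bosonization `Q # H`: the vector space `Q ⊗ H` with the smash coproduct
`Δ(r # h) = (r₁ # (r₂)₋₁ h₁) ⊗ ((r₂)₀ # h₂)`, the multiplication
`(r # h)(s # l) = m(r ⊗ h₁ s) # h₂ l`, the unit `1 # 1` and the reassociator `℧³(α)`. -/
def bosonization (X : YDDualQuasiBialgebra K H Q) : DQBData K (Q ⊗[K] H) where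
  comul := braidedComul X.comul X.coact Coalgebra.comul (LinearMap.mul' K H)
  counit := epsTensor K X.counit Coalgebra.counit
  mul := X.mul.rTensor H ∘ₗ (TensorProduct.assoc K Q Q H).symm.toLinearMap ∘ₗ
    pushAct (tensorAct X.act (LinearMap.mul' K H))
  one := X.one ⊗ₜ 1
  reassoc := mho₃ X.act X.reassoc

end YDDualQuasiBialgebra

/-- `lam` is an ad-invariant integral for `H`: a left and right integral in `H*` with `lam 1 = 1`
such that `lam(h₁ x S(h₂)) = ε(h) lam(x) = lam(S(h₁) x h₂)`. -/
structure IsAdInvariantIntegral (lam : H →ₗ[K] K) : Prop where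
  left_integral : ∀ h, lam.lTensor H (Coalgebra.comul h) = (1 : H) ⊗ₜ lam h
  right_integral : ∀ h, lam.rTensor H (Coalgebra.comul h) = lam h ⊗ₜ (1 : H)
  map_one : lam 1 = 1
  ad_left : ∀ h x, lam (LinearMap.mul' K H (TensorProduct.map (LinearMap.mulRight K x)
    (HopfAlgebraStruct.antipode K) (Coalgebra.comul h))) = Coalgebra.counit (R := K) h * lam x
  ad_right : ∀ h x, lam (LinearMap.mul' K H (TensorProduct.map
    (LinearMap.mulRight K x ∘ₗ HopfAlgebraStruct.antipode K) LinearMap.id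
    (Coalgebra.comul h))) = Coalgebra.counit (R := K) h * lam x

end YD

/-! ### Splitting data and the associated pre-bialgebra with cocycle -/

/-- A splitting datum `(A, H, π, σ)`. -/
structure SplittingDatum (K : Type u) [Field K] (A : Type w) [Ring A] [Bialgebra K A]
    (H : Type v) [Ring H] [HopfAlgebra K H] where
  σ : H →ₐc[K] A
  π : A →ₗc[K] H
  bilinear : ∀ (h k : H) (x : A), π (σ h * x * σ k) = h * π x * k
  retraction : ∀ h, π (σ h) = h

namespace SplittingDatum

variable {K : Type u} [Field K] {A : Type w} [Ring A] [Bialgebra K A]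
  {H : Type v} [Ring H] [HopfAlgebra K H] (S : SplittingDatum K A H)

/-- `σ` as a linear map. -/
def σL : H →ₗ[K] A := (S.σ : H →ₐ[K] A).toLinearMap

/-- `π` as a linear map. -/
def πL : A →ₗ[K] H := S.π.toLinearMap

/-- `R = {a | a₁ ⊗ π(a₂) = a ⊗ 1}`. -/
def R : Submodule K A where
  carrier := {a | S.πL.lTensor A (Coalgebra.comul a) = a ⊗ₜ[K] (1 : H)}
  add_mem' := by
    intro a b ha hb
    simp only [Set.mem_ofPred_eq] at *
    rw [map_add, map_add, ha, hb, TensorProduct.add_tmul]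
  zero_mem' := by simp
  smul_mem' := by
    intro c a ha
    simp only [Set.mem_ofPred_eq] at *
    rw [map_smul, map_smul, ha, TensorProduct.smul_tmul']

theorem mem_R {a : A} :
    a ∈ S.R ↔ S.πL.lTensor A (Coalgebra.comul a) = a ⊗ₜ[K] (1 : H) := Iff.rfl

/-- `a ↦ σ(S(π(a)))`. -/
def σSπ : A →ₗ[K] A := S.σL ∘ₗ HopfAlgebraStruct.antipode K ∘ₗ S.πL

/-- `τ(a) = a₁ σ(S(π(a₂)))`, as an endomorphism of `A`. -/
def τA : A →ₗ[K] A := LinearMap.mul' K A ∘ₗ S.σSπ.lTensor A ∘ₗ Coalgebra.comul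

/-- The adjoint action `h ⊗ a ↦ σ(h₁) a σ(S(h₂))` of `H` on `A`. -/
def adA : H ⊗[K] A →ₗ[K] A :=
  LinearMap.mul' K A ∘ₗ
    TensorProduct.map (LinearMap.mul' K A ∘ₗ S.σL.rTensor A)
      (S.σL ∘ₗ HopfAlgebraStruct.antipode K) ∘ₗ
    (TensorProduct.rightComm K H H A).toLinearMap ∘ₗ
    (Coalgebra.comul (R := K) (A := H)).rTensor A

section helpers

open Coalgebra WithConv

theorem map_π_comul (a : A) : TensorProduct.map S.πL S.πL (comul (R := K) a) =
    comul (R := K) (S.πL a) := CoalgHomClass.map_comp_comul_apply S.π a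

theorem map_σ_comul (h : H) : TensorProduct.map S.σL S.σL (comul (R := K) h) =
    comul (R := K) (S.σL h) := CoalgHomClass.map_comp_comul_apply S.σ h

theorem σL_mul (g h : H) : S.σL (g * h) = S.σL g * S.σL h := map_mul S.σ g h

theorem σL_one : S.σL 1 = 1 := map_one S.σ

theorem πL_mul_σL (x : A) (h : H) : S.πL (x * S.σL h) = S.πL x * h := by
  have := S.bilinear 1 h x
  rwa [map_one, _root_.one_mul, _root_.one_mul] at this

theorem πL_σL_mul (x : A) (h : H) : S.πL (S.σL h * x) = h * S.πL x := by
  have := S.bilinear h 1 x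
  rwa [map_one, _root_.mul_one, _root_.mul_one] at this

theorem πL_σL (h : H) : S.πL (S.σL h) = h := S.retraction h

/-- `a ↦ a₁ ⊗ π(a₂)`. -/
def P : A →ₗ[K] A ⊗[K] H := S.πL.lTensor A ∘ₗ comul

/-- `h ↦ σ(h₁) ⊗ h₂`. -/
def θ : H →ₐ[K] A ⊗[K] H :=
  (Algebra.TensorProduct.map (S.σ : H →ₐ[K] A) (AlgHom.id K H)).comp (Bialgebra.comulAlgHom K H)

theorem θ_apply (h : H) : S.θ h = S.σL.rTensor H (comul h) := rfl

theorem lTensor_mul_map (t : A ⊗[K] A) (s : H ⊗[K] H) :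
    S.πL.lTensor A (t * TensorProduct.map S.σL S.σL s) =
      S.πL.lTensor A t * S.σL.rTensor H s := by
  induction s using TensorProduct.induction_on with
  | zero => simp
  | add x y hx hy => rw [map_add, mul_add, map_add, hx, hy, map_add, mul_add]
  | tmul g h =>
    induction t using TensorProduct.induction_on with
    | zero => simp
    | add x y hx hy => rw [add_mul, map_add, hx, hy, map_add, add_mul]
    | tmul a b => simp [πL_mul_σL]

theorem P_mul (b : A) (h : H) : S.P (b * S.σL h) = S.P b * S.θ h := by
  simp only [P, LinearMap.comp_apply, Bialgebra.comul_mul, ← map_σ_comul, lTensor_mul_map, θ_apply]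

theorem conv_σ_inv : toConv S.σSπ * toConv (S.σL ∘ₗ S.πL) = 1 := by
  ext a
  have h1 : ∀ t : H ⊗[K] H, LinearMap.mul' K A (TensorProduct.map
      (S.σL ∘ₗ HopfAlgebraStruct.antipode K) S.σL t) =
      S.σL (LinearMap.mul' K H ((HopfAlgebraStruct.antipode K).rTensor H t)) := by
    intro t
    induction t using TensorProduct.induction_on with
    | zero => simp
    | add x y hx hy => simp only [map_add, hx, hy]
    | tmul g h => simp [σL_mul]
  have h2 : TensorProduct.map S.σSπ (S.σL ∘ₗ S.πL) (comul (R := K) a) =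
      TensorProduct.map (S.σL ∘ₗ HopfAlgebraStruct.antipode K) S.σL (comul (R := K) (S.πL a)) := by
    rw [← map_π_comul, σSπ, ← LinearMap.comp_assoc, TensorProduct.map_comp]
    rfl
  have h3 : counit (R := K) (S.πL a) = counit (R := K) a :=
    CoalgHomClass.counit_comp_apply S.π a
  simp only [LinearMap.convMul_apply, h2, h1,
    HopfAlgebra.mul_antipode_rTensor_comul_apply, LinearMap.convOne_apply, h3]
  exact AlgHom.commutes (S.σ : H →ₐ[K] A) _

theorem τA_conv : toConv S.τA = toConv LinearMap.id * toConv S.σSπ := rfl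

theorem τA_conv_σπ : toConv S.τA * toConv (S.σL ∘ₗ S.πL) = toConv LinearMap.id := by
  rw [τA_conv, mul_assoc, conv_σ_inv, mul_one]

/-- `τ(a₁) σ(π(a₂)) = a`. -/
theorem sum_τA (a : A) :
    LinearMap.mul' K A (TensorProduct.map S.τA (S.σL ∘ₗ S.πL) (comul a)) = a :=
  congr($(S.τA_conv_σπ) a)

theorem θ_inv : toConv (S.θ.toLinearMap ∘ₗ S.πL) *
    toConv (S.θ.toLinearMap ∘ₗ HopfAlgebraStruct.antipode K ∘ₗ S.πL) = 1 := by
  ext a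
  have h1 : ∀ t : H ⊗[K] H, LinearMap.mul' K (A ⊗[K] H) (TensorProduct.map
      S.θ.toLinearMap (S.θ.toLinearMap ∘ₗ HopfAlgebraStruct.antipode K) t) =
      S.θ (LinearMap.mul' K H ((HopfAlgebraStruct.antipode K).lTensor H t)) := by
    intro t
    induction t using TensorProduct.induction_on with
    | zero => simp
    | add x y hx hy => simp only [map_add, hx, hy]
    | tmul g h => simp
  have h2 : TensorProduct.map (S.θ.toLinearMap ∘ₗ S.πL)
      (S.θ.toLinearMap ∘ₗ HopfAlgebraStruct.antipode K ∘ₗ S.πL) (comul (R := K) a) =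
      TensorProduct.map S.θ.toLinearMap (S.θ.toLinearMap ∘ₗ HopfAlgebraStruct.antipode K)
        (comul (R := K) (S.πL a)) := by
    rw [← map_π_comul, ← LinearMap.comp_assoc, TensorProduct.map_comp]
    rfl
  have h3 : counit (R := K) (S.πL a) = counit (R := K) a :=
    CoalgHomClass.counit_comp_apply S.π a
  simp only [LinearMap.convMul_apply, h2, h1,
    HopfAlgebra.mul_antipode_lTensor_comul_apply, LinearMap.convOne_apply, h3]
  exact AlgHom.commutes S.θ _

theorem conv_left : toConv (S.P ∘ₗ S.τA) * toConv (S.θ.toLinearMap ∘ₗ S.πL) = toConv S.P := by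
  ext a
  have h1 : ∀ t : A ⊗[K] A, LinearMap.mul' K (A ⊗[K] H) (TensorProduct.map (S.P ∘ₗ S.τA)
      (S.θ.toLinearMap ∘ₗ S.πL) t) =
      S.P (LinearMap.mul' K A (TensorProduct.map S.τA (S.σL ∘ₗ S.πL) t)) := by
    intro t
    induction t using TensorProduct.induction_on with
    | zero => simp
    | add x y hx hy => simp only [map_add, hx, hy]
    | tmul g h => simp [P_mul]
  simp only [LinearMap.convMul_apply, h1, sum_τA]

theorem conv_right : toConv ((TensorProduct.mk K A H).flip 1 ∘ₗ S.τA) *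
    toConv (S.θ.toLinearMap ∘ₗ S.πL) = toConv S.P := by
  ext a
  have h1 : ∀ t : A ⊗[K] (A ⊗[K] A), LinearMap.mul' K (A ⊗[K] H)
      (TensorProduct.map ((TensorProduct.mk K A H).flip 1 ∘ₗ S.τA) (S.σL.rTensor H)
        ((TensorProduct.map S.πL S.πL).lTensor A t)) =
      TensorProduct.map (LinearMap.mul' K A ∘ₗ TensorProduct.map S.τA (S.σL ∘ₗ S.πL)) S.πL
        ((TensorProduct.assoc K A A A).symm t) := by
    intro t
    induction t using TensorProduct.induction_on with
    | zero => simp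
    | add x y hx hy => simp only [map_add, hx, hy]
    | tmul a s =>
      induction s using TensorProduct.induction_on with
      | zero => simp
      | add x y hx hy => simp only [map_add, TensorProduct.tmul_add, hx, hy]
      | tmul b c => simp
  have h2 : TensorProduct.map ((TensorProduct.mk K A H).flip 1 ∘ₗ S.τA)
      (S.θ.toLinearMap ∘ₗ S.πL) (comul (R := K) a) =
      TensorProduct.map ((TensorProduct.mk K A H).flip 1 ∘ₗ S.τA) (S.σL.rTensor H)
        ((TensorProduct.map S.πL S.πL).lTensor A (comul.lTensor A (comul (R := K) a))) := by
    have h : ∀ t : A ⊗[K] A, TensorProduct.map ((TensorProduct.mk K A H).flip 1 ∘ₗ S.τA)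
        (S.θ.toLinearMap ∘ₗ S.πL) t =
        TensorProduct.map ((TensorProduct.mk K A H).flip 1 ∘ₗ S.τA) (S.σL.rTensor H)
        ((TensorProduct.map S.πL S.πL).lTensor A (comul.lTensor A t)) := by
      intro t
      induction t using TensorProduct.induction_on with
      | zero => simp
      | add x y hx hy => simp only [map_add, hx, hy]
      | tmul b c => simp [θ_apply, map_π_comul]
    exact h _
  have h3 : ∀ t : A ⊗[K] A, TensorProduct.map
      (LinearMap.mul' K A ∘ₗ TensorProduct.map S.τA (S.σL ∘ₗ S.πL)) S.πL (comul.rTensor A t) =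
      S.πL.lTensor A t := by
    intro t
    induction t using TensorProduct.induction_on with
    | zero => simp
    | add x y hx hy => simp only [map_add, hx, hy]
    | tmul b c =>
      rw [LinearMap.rTensor_tmul, TensorProduct.map_tmul, LinearMap.comp_apply, sum_τA,
        LinearMap.lTensor_tmul]
  simp only [LinearMap.convMul_apply, h2, h1, coassoc_symm_apply, h3]
  rfl

theorem τA_mem (a : A) : S.τA a ∈ S.R := by
  have h : toConv (S.P ∘ₗ S.τA) = toConv ((TensorProduct.mk K A H).flip 1 ∘ₗ S.τA) := by
    have := S.conv_left.trans S.conv_right.symm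
    replace this := congr($this *
      toConv (S.θ.toLinearMap ∘ₗ HopfAlgebraStruct.antipode K ∘ₗ S.πL))
    rwa [mul_assoc, mul_assoc, θ_inv, mul_one, mul_one] at this
  exact congr($h a)

theorem adA_eq (h : H) {r : A} (hr : r ∈ S.R) : S.adA (h ⊗ₜ r) = S.τA (S.σL h * r) := by
  have h1 : ∀ (s : H ⊗[K] H) (t : A ⊗[K] A), LinearMap.mul' K A (S.σSπ.lTensor A
      (TensorProduct.map S.σL S.σL s * t)) =
      LinearMap.mul' K A ((S.σL ∘ₗ HopfAlgebraStruct.antipode K).lTensor A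
        (S.σL.rTensor H s * S.πL.lTensor A t)) := by
    intro s t
    induction s using TensorProduct.induction_on with
    | zero => simp
    | add x y hx hy => simp only [map_add, add_mul, hx, hy]
    | tmul g h =>
      induction t using TensorProduct.induction_on with
      | zero => simp
      | add x y hx hy => simp only [map_add, mul_add, hx, hy]
      | tmul a b => simp [πL_σL_mul, σSπ]
  have h2 : ∀ s : H ⊗[K] H, LinearMap.mul' K A ((S.σL ∘ₗ HopfAlgebraStruct.antipode K).lTensor A
        (S.σL.rTensor H s * r ⊗ₜ[K] (1 : H))) =
      LinearMap.mul' K A (TensorProduct.map (LinearMap.mul' K A ∘ₗ S.σL.rTensor A)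
      (S.σL ∘ₗ HopfAlgebraStruct.antipode K) (TensorProduct.rightComm K H H A (s ⊗ₜ r))) := by
    intro s
    induction s using TensorProduct.induction_on with
    | zero => simp
    | add x y hx hy => simp only [map_add, add_mul, hx, hy, TensorProduct.add_tmul]
    | tmul g h => simp
  have e : S.τA (S.σL h * r) = LinearMap.mul' K A (S.σSπ.lTensor A
      (TensorProduct.map S.σL S.σL (comul (R := K) h) * comul (R := K) r)) := by
    rw [map_σ_comul, ← Bialgebra.comul_mul]; rfl
  rw [e, h1, S.mem_R.1 hr, h2]
  rfl

theorem adA_mem (h : H) (r : S.R) : S.adA (h ⊗ₜ (r : A)) ∈ S.R := by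
  rw [S.adA_eq h r.2]
  exact S.τA_mem _

theorem one_mem : (1 : A) ∈ S.R := by
  have : S.πL 1 = 1 := by rw [← S.σL_one, S.πL_σL]
  rw [mem_R, Bialgebra.comul_one, Algebra.TensorProduct.one_def, LinearMap.lTensor_tmul, this]

end helpers

/-- `τ : A → R`, `τ(a) = a₁ σ(S(π(a₂)))`. -/
def τ : A →ₗ[K] S.R := S.τA.codRestrict S.R S.τA_mem

/-- The action `h r = σ(h₁) r σ(S(h₂))` of `H` on `R`. -/
def act : H ⊗[K] S.R →ₗ[K] S.R :=
  (S.adA ∘ₗ S.R.subtype.lTensor H).codRestrict S.R (by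
    intro z
    induction z using TensorProduct.induction_on with
    | zero => simp
    | tmul h r => exact S.adA_mem h r
    | add x y hx hy => rw [map_add]; exact S.R.add_mem hx hy)

/-- The associated coalgebra `R` in the Yetter-Drinfeld category: the action is
`h r = σ(h₁) r σ(S(h₂))`, the coaction is `ρ(r) = π(r₁) ⊗ r₂`, the comultiplication is
`Δ(r) = τ(r₁) ⊗ r₂`, and the counit is the restriction of the counit of `A`.
(In `ρ` and `Δ` the last tensor factor `r₂` is written `τ(r₂)`, to have its value in `R`; see
`coact_eq` and `comul_eq`.) -/
def yd : YDData K H S.R where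
  comul := TensorProduct.map S.τ S.τ ∘ₗ Coalgebra.comul ∘ₗ S.R.subtype
  counit := Coalgebra.counit ∘ₗ S.R.subtype
  act := S.act
  coact := TensorProduct.map S.πL S.τ ∘ₗ Coalgebra.comul ∘ₗ S.R.subtype

/-- `r₁ ⊗ τ(r₂) = r₁ ⊗ r₂` for `r ∈ R`. -/
theorem lTensor_τA (r : S.R) : S.τA.lTensor A (Coalgebra.comul (R := K) (r : A)) =
    Coalgebra.comul (R := K) (r : A) := by
  have h1 : ∀ t : A ⊗[K] A, S.τA.lTensor A t = (LinearMap.mul' K A ∘ₗ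
      (S.σL ∘ₗ HopfAlgebraStruct.antipode K).lTensor A).lTensor A
      (TensorProduct.assoc K A A H (S.πL.lTensor (A ⊗[K] A)
      ((TensorProduct.assoc K A A A).symm (Coalgebra.comul.lTensor A t)))) := by
    intro t
    induction t using TensorProduct.induction_on with
    | zero => simp
    | add x y hx hy => simp only [map_add, hx, hy]
    | tmul b c =>
      have h : ∀ s : A ⊗[K] A, b ⊗ₜ[K] LinearMap.mul' K A (S.σSπ.lTensor A s) =
          (LinearMap.mul' K A ∘ₗ
          (S.σL ∘ₗ HopfAlgebraStruct.antipode K).lTensor A).lTensor A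
          (TensorProduct.assoc K A A H (S.πL.lTensor (A ⊗[K] A)
          ((TensorProduct.assoc K A A A).symm (b ⊗ₜ s)))) := by
        intro s
        induction s using TensorProduct.induction_on with
        | zero => simp
        | add x y hx hy => simp only [map_add, TensorProduct.tmul_add, hx, hy]
        | tmul x y => simp [σSπ]
      exact h _
  have h2 : ∀ t : A ⊗[K] A, S.πL.lTensor (A ⊗[K] A) (Coalgebra.comul.rTensor A t) =
      (Coalgebra.comul (R := K) (A := A)).rTensor H (S.πL.lTensor A t) := by
    intro t
    induction t using TensorProduct.induction_on with
    | zero => simp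
    | add x y hx hy => simp only [map_add, hx, hy]
    | tmul b c => simp
  have h3 : ∀ t : A ⊗[K] A, (LinearMap.mul' K A ∘ₗ
      (S.σL ∘ₗ HopfAlgebraStruct.antipode K).lTensor A).lTensor A
      (TensorProduct.assoc K A A H (t ⊗ₜ 1)) = t := by
    intro t
    induction t using TensorProduct.induction_on with
    | zero => simp
    | add x y hx hy => simp only [map_add, TensorProduct.add_tmul, hx, hy]
    | tmul b c => simp [σL_one]
  rw [h1, Coalgebra.coassoc_symm_apply, h2, S.mem_R.1 r.2, LinearMap.rTensor_tmul, h3]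

theorem coact_eq (r : S.R) : S.R.subtype.lTensor H (S.yd.coact r) =
    S.πL.rTensor A (Coalgebra.comul (r : A)) := by
  have h : ∀ t : A ⊗[K] A, S.R.subtype.lTensor H (TensorProduct.map S.πL S.τ t) =
      S.πL.rTensor A (S.τA.lTensor A t) := by
    intro t
    induction t using TensorProduct.induction_on with
    | zero => simp
    | add x y hx hy => simp only [map_add, hx, hy]
    | tmul b c => simp [τ]
  exact (h _).trans (congrArg _ (S.lTensor_τA r))

theorem comul_eq (r : S.R) : S.R.subtype.lTensor S.R (S.yd.comul r) =
    S.τ.rTensor A (Coalgebra.comul (r : A)) := by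
  have h : ∀ t : A ⊗[K] A, S.R.subtype.lTensor S.R (TensorProduct.map S.τ S.τ t) =
      S.τ.rTensor A (S.τA.lTensor A t) := by
    intro t
    induction t using TensorProduct.induction_on with
    | zero => simp
    | add x y hx hy => simp only [map_add, hx, hy]
    | tmul b c => simp [τ]
  exact (h _).trans (congrArg _ (S.lTensor_τA r))

/-- The cocycle `ξ(r ⊗ s) = π(r s)`. -/
def ξ : S.R ⊗[K] S.R →ₗ[K] H :=
  S.πL ∘ₗ LinearMap.mul' K A ∘ₗ TensorProduct.map S.R.subtype S.R.subtype

theorem τA_of_mem {r : A} (hr : r ∈ S.R) : S.τA r = r := by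
  have h : S.τA r = LinearMap.mul' K A ((S.σL ∘ₗ HopfAlgebraStruct.antipode K).lTensor A
      (S.πL.lTensor A (Coalgebra.comul r))) := by
    rw [← LinearMap.comp_apply (LinearMap.lTensor _ _), ← LinearMap.lTensor_comp]
    rfl
  rw [h, S.mem_R.1 hr]
  simp [σL_one]

theorem τA_mul_σ (b : A) (h : H) : S.τA (b * S.σL h) = Coalgebra.counit (R := K) h • S.τA b := by
  have h1 : ∀ (t : A ⊗[K] A) (s : H ⊗[K] H), LinearMap.mul' K A (S.σSπ.lTensor A
      (t * TensorProduct.map S.σL S.σL s)) =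
      LinearMap.mul' K A (LinearMap.mulRight K (S.σL (LinearMap.mul' K H
        ((HopfAlgebraStruct.antipode K).lTensor H s))) |>.rTensor A <| S.σSπ.lTensor A t) := by
    intro t s
    induction s using TensorProduct.induction_on with
    | zero => simp
    | add x y hx hy =>
      have e : ∀ p q : A, LinearMap.mulRight K (p + q) =
          LinearMap.mulRight K p + LinearMap.mulRight K q := fun p q => by ext; simp [mul_add]
      simp only [map_add, mul_add, hx, hy, e, LinearMap.rTensor_add, LinearMap.add_apply]
    | tmul g h =>
      induction t using TensorProduct.induction_on with
      | zero => simp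
      | add x y hx hy => simp only [map_add, add_mul, hx, hy]
      | tmul a b => simp [πL_mul_σL, σSπ, HopfAlgebra.antipode_mul_antidistrib, σL_mul, mul_assoc]
  have h2 : LinearMap.mulRight K (S.σL (algebraMap K H (Coalgebra.counit (R := K) h))) =
      Coalgebra.counit (R := K) h • (LinearMap.id : A →ₗ[K] A) := by
    ext x
    rw [Algebra.algebraMap_eq_smul_one, map_smul, σL_one]
    simp
  have e : S.τA (b * S.σL h) = LinearMap.mul' K A (S.σSπ.lTensor A
      (Coalgebra.comul (R := K) b * TensorProduct.map S.σL S.σL (Coalgebra.comul (R := K) h))) := by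
    rw [map_σ_comul, ← Bialgebra.comul_mul]; rfl
  rw [e, h1, HopfAlgebra.mul_antipode_lTensor_comul_apply, h2, LinearMap.rTensor_smul,
    LinearMap.rTensor_id, LinearMap.smul_apply, map_smul]
  rfl

/-- `r ⊗ h ↦ r σ(h)`. -/
def ofSmash : S.R ⊗[K] H →ₗ[K] A := LinearMap.mul' K A ∘ₗ TensorProduct.map S.R.subtype S.σL

/-- The isomorphism `A ≅ R # H`, `a ↦ τ(a₁) ⊗ π(a₂)`, with inverse `r ⊗ h ↦ r σ(h)`. -/
def toSmash : A ≃ₗ[K] S.R ⊗[K] H :=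
  LinearEquiv.ofLinearMap (TensorProduct.map S.τ S.πL ∘ₗ Coalgebra.comul) S.ofSmash
    (by
      ext r h
      have h1 : ∀ (t : A ⊗[K] A) (s : H ⊗[K] H), TensorProduct.map S.τ S.πL
          (t * TensorProduct.map S.σL S.σL s) =
          (LinearMap.mulRight K (TensorProduct.lid K H
            ((Coalgebra.counit (R := K) (A := H)).rTensor H s))).lTensor S.R
            (TensorProduct.map S.τ S.πL t) := by
        intro t s
        induction s using TensorProduct.induction_on with
        | zero => simp
        | add x y hx hy =>
          have e : ∀ p q : H, LinearMap.mulRight K (p + q) =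
              LinearMap.mulRight K p + LinearMap.mulRight K q := fun p q => by ext; simp [mul_add]
          simp only [map_add, mul_add, hx, hy, e, LinearMap.lTensor_add, LinearMap.add_apply]
        | tmul g h =>
          induction t using TensorProduct.induction_on with
          | zero => simp
          | add x y hx hy => simp only [map_add, add_mul, hx, hy]
          | tmul a b =>
            have e : S.τ (a * S.σL g) = Coalgebra.counit (R := K) g • S.τ a :=
              Subtype.ext (S.τA_mul_σ a g)
            simp [πL_mul_σL, e, TensorProduct.smul_tmul]
      have h2 : TensorProduct.map S.τ S.πL (Coalgebra.comul (R := K) (r : A)) = r ⊗ₜ 1 := by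
        have e : ∀ t : A ⊗[K] A, TensorProduct.map S.τ S.πL t =
            S.τ.rTensor H (S.πL.lTensor A t) := by
          intro t
          rw [← LinearMap.comp_apply, LinearMap.rTensor_comp_lTensor]
        rw [e, S.mem_R.1 r.2, LinearMap.rTensor_tmul]
        congr 1
        exact Subtype.ext (S.τA_of_mem r.2)
      have e : Coalgebra.comul (R := K) ((r : A) * S.σL h) = Coalgebra.comul (R := K) (r : A) *
          TensorProduct.map S.σL S.σL (Coalgebra.comul (R := K) h) := by
        rw [map_σ_comul, Bialgebra.comul_mul]
      simp only [ofSmash, TensorProduct.AlgebraTensorModule.curry_apply, TensorProduct.curry_apply,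
        LinearMap.restrictScalars_apply, LinearMap.coe_comp, Function.comp_apply,
        TensorProduct.map_tmul, LinearMap.mul'_apply, Submodule.subtype_apply, e, h1, h2]
      simp)
    (by
      ext a
      have h : ∀ t : A ⊗[K] A, S.ofSmash (TensorProduct.map S.τ S.πL t) =
          LinearMap.mul' K A (TensorProduct.map S.τA (S.σL ∘ₗ S.πL) t) := by
        intro t
        induction t using TensorProduct.induction_on with
        | zero => simp
        | add x y hx hy => simp only [map_add, hx, hy]
        | tmul b c => simp [τ, ofSmash]
      exact (h _).trans (S.sum_τA a))

/-- The functional on `A ⊗ A` corresponding to `℧²(v)` under the isomorphism `A ≅ R # H`. -/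
def gaugeOf (v : S.R ⊗[K] S.R →ₗ[K] K) : A ⊗[K] A →ₗ[K] K :=
  mho₂ S.act v ∘ₗ TensorProduct.map S.toSmash.toLinearMap S.toSmash.toLinearMap

end SplittingDatum

end

/-! Write `τ : A → R` for the projection and `γ = λξ`. The braided tensor powers of `R` are handled
by realising them as quotients of the ordinary tensor powers of `A`. For every `H`-module coalgebra
`W` the map `Ψ(a ⊗ w) = τ(a₁) ⊗ π(a₂)w` (`psi`) is a surjective coalgebra map from `A ⊗ W` to the
braided `R ⊗ W` (`IsCoinvariants.isCoalgMap_psi`); the braiding is absorbed by the identity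
`ρ(τ(a₁))π(a₂) = π(a₁) ⊗ τ(a₂)` (`coact_τ`). Iterating gives surjections `psi₂`, `psi₃`, `psi₄` from
`A^{⊗n}` to `R^{⊗n}`, so convolution identities on `R^{⊗n}` can be checked on `A^{⊗n}`, where no
braiding occurs.

The cocycle `ξ` measures the failure of `π` to be multiplicative: `π(ab) = ξ(Ψ(a₁ ⊗ b₁))π(a₂)π(b₂)`
(`mul_convT_cocycle`). Taking coproducts and applying the left integral `λ` to one leg gives
`π(a₁b₁)γ(Ψ(a₂ ⊗ b₂)) = γ(Ψ(a₁ ⊗ b₁))π(a₂)π(b₂)` (`π_mul_convR`). Hence, with `v = γ⁻¹`, conjugating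
the multiplication of `A` by `vΨ` makes `π` multiplicative (`π_twist_mul`). Ad-invariance of `λ`
makes `γ`, and so `v`, invariant under `H`, and the twisted multiplication stays left `H`-linear.
These two properties let the twisted multiplication and reassociator descend along `Ψ` to `R`. The
twist satisfies the axioms of a dual quasi-bialgebra by cancellations in convolution algebras
(`twist_isDualQuasiBialgebra`), the laws pass to the quotient (`QuasiLaws.transfer`), and `a ↦ τ(a₁)
⊗ π(a₂)` becomes an isomorphism from the twist to the bosonization.

The hypothesis on the coradical gives invertibility and connectedness. Since `Ψ(σ(h) ⊗ b) = 1 ⊗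
hτ(b)`, the functional `γΨ` agrees with the counit on `σ(H) ⊗ A`. The coradical filtration exhausts
`A` (`exists_mem_wedgeFil_coradical`), so convolution with `γΨ - ε` is locally nilpotent and `γ` is
invertible. Since `τ(σ(h)) = ε(h)1`, the same filtration shows that every nonzero subcoalgebra of
`R` contains `1`, so the coradical of `R` is `K1`. -/

noncomputable section

/-! ### Tensor-power maps on pure tensors. -/

section Functionals

variable {K : Type*} [Field K] {C D E C' D' : Type*} [AddCommGroup C] [Module K C]
  [AddCommGroup D] [Module K D] [AddCommGroup E] [Module K E] [AddCommGroup C'] [Module K C']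
  [AddCommGroup D'] [Module K D']

@[simp] theorem dropRight_tmul (ε : D →ₗ[K] K) (x : C) (y : D) :
    dropRight K ε (x ⊗ₜ[K] y) = ε y • x := by simp [dropRight]

@[simp] theorem mulFirst_tmul (m : D ⊗[K] D →ₗ[K] D) (x y : D) (z : C) :
    mulFirst K m (x ⊗ₜ[K] (y ⊗ₜ[K] z)) = m (x ⊗ₜ y) ⊗ₜ z := by simp [mulFirst]

@[simp] theorem epsTensor_tmul (f : D →ₗ[K] K) (g : C →ₗ[K] K) (x : D) (y : C) :
    epsTensor K f g (x ⊗ₜ[K] y) = f x * g y := by simp [epsTensor]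

@[simp] theorem tensorEps₂_tmul (ε : D →ₗ[K] K) (f : D ⊗[K] D →ₗ[K] K) (x y z : D) :
    tensorEps₂ K ε f (x ⊗ₜ[K] (y ⊗ₜ[K] z)) = ε z * f (x ⊗ₜ y) := by simp [tensorEps₂]

@[simp] theorem tensorEps₃_tmul (ε : D →ₗ[K] K) (f : D ⊗[K] (D ⊗[K] D) →ₗ[K] K) (x y z t : D) :
    tensorEps₃ K ε f (x ⊗ₜ[K] (y ⊗ₜ[K] (z ⊗ₜ[K] t))) = ε t * f (x ⊗ₜ (y ⊗ₜ z)) := by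
  simp [tensorEps₃]

/-- Two linear maps that agree on pure tensors agree. -/
theorem eq_of_tmul {f g : C ⊗[K] D →ₗ[K] E} (h : ∀ x y, f (x ⊗ₜ y) = g (x ⊗ₜ y)) (z : C ⊗[K] D) :
    f z = g z := congr($(TensorProduct.ext' h) z)

theorem eq_of_tmul₃ {f g : C ⊗[K] (D ⊗[K] C') →ₗ[K] E}
    (h : ∀ x y z, f (x ⊗ₜ (y ⊗ₜ z)) = g (x ⊗ₜ (y ⊗ₜ z))) (z : C ⊗[K] (D ⊗[K] C')) : f z = g z := by
  have : f = g := by ext x y z; exact h x y z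
  rw [this]

end Functionals

/-! ### Convolution calculus over a coalgebra. -/

namespace CoalgData

variable {K : Type*} [Field K] {C D E C' D' M N : Type*} [AddCommGroup C] [Module K C]
  [AddCommGroup D] [Module K D] [AddCommGroup E] [Module K E] [AddCommGroup C'] [Module K C']
  [AddCommGroup D'] [Module K D'] [AddCommGroup M] [Module K M] [AddCommGroup N] [Module K N]
  {X : CoalgData K C} {Y : CoalgData K D} {Z : CoalgData K E}

theorem isCoalgebra_ofCoalgebra [Coalgebra K C] : (ofCoalgebra K C).IsCoalgebra where
  coassoc := Coalgebra.coassoc_apply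
  counit_left := Coalgebra.rTensor_counit_comul
  counit_right := Coalgebra.lTensor_counit_comul

theorem convL_apply (f : C →ₗ[K] K) (g : C →ₗ[K] M) (c : C) :
    X.convL f g c = TensorProduct.lid K M (TensorProduct.map f g (X.comul c)) := rfl

theorem convR_apply (g : C →ₗ[K] M) (f : C →ₗ[K] K) (c : C) :
    X.convR g f c = TensorProduct.rid K M (TensorProduct.map g f (X.comul c)) := rfl

theorem convR_eq_convL (f g : C →ₗ[K] K) : X.convR f g = X.convL f g := by
  ext c
  rw [convL_apply, convR_apply]
  exact eq_of_tmul (f := (TensorProduct.rid K K).toLinearMap ∘ₗ TensorProduct.map f g)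
    (g := (TensorProduct.lid K K).toLinearMap ∘ₗ TensorProduct.map f g)
    (fun x y => by simp [mul_comm]) _

theorem comp_convL (F : M →ₗ[K] N) (f : C →ₗ[K] K) (g : C →ₗ[K] M) :
    F ∘ₗ X.convL f g = X.convL f (F ∘ₗ g) := by
  ext c
  simp only [convL_apply, LinearMap.comp_apply]
  exact eq_of_tmul (f := F ∘ₗ (TensorProduct.lid K M).toLinearMap ∘ₗ TensorProduct.map f g)
    (g := (TensorProduct.lid K N).toLinearMap ∘ₗ TensorProduct.map f (F ∘ₗ g))
    (fun x y => by simp) _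

theorem comp_convR (F : M →ₗ[K] N) (g : C →ₗ[K] M) (f : C →ₗ[K] K) :
    F ∘ₗ X.convR g f = X.convR (F ∘ₗ g) f := by
  ext c
  simp only [convR_apply, LinearMap.comp_apply]
  exact eq_of_tmul (f := F ∘ₗ (TensorProduct.rid K M).toLinearMap ∘ₗ TensorProduct.map g f)
    (g := (TensorProduct.rid K N).toLinearMap ∘ₗ TensorProduct.map (F ∘ₗ g) f)
    (fun x y => by simp) _

/-- Linear maps out of the iterated coproduct can be compared after rebracketing. -/
theorem IsCoalgebra.rebracket (hX : X.IsCoalgebra) {F : (C ⊗[K] C) ⊗[K] C →ₗ[K] M}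
    {G : C ⊗[K] (C ⊗[K] C) →ₗ[K] M} (h : ∀ x y z, F ((x ⊗ₜ y) ⊗ₜ z) = G (x ⊗ₜ (y ⊗ₜ z))) (c : C) :
    F (X.comul.rTensor C (X.comul c)) = G (X.comul.lTensor C (X.comul c)) := by
  rw [← hX.coassoc]
  have : F = G ∘ₗ (TensorProduct.assoc K C C C).toLinearMap := by ext x y z; exact h x y z
  rw [this]
  rfl

theorem IsCoalgebra.convL_assoc (hX : X.IsCoalgebra) (f g : C →ₗ[K] K) (h : C →ₗ[K] M) :
    X.convL (X.convL f g) h = X.convL f (X.convL g h) := by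
  ext c
  have e := hX.rebracket
    (F := (TensorProduct.lid K M).toLinearMap ∘ₗ
      TensorProduct.map ((TensorProduct.lid K K).toLinearMap ∘ₗ TensorProduct.map f g) h)
    (G := (TensorProduct.lid K M).toLinearMap ∘ₗ
      TensorProduct.map f ((TensorProduct.lid K M).toLinearMap ∘ₗ TensorProduct.map g h))
    (fun x y z => by simp [smul_smul, mul_comm]) c
  -- The one-sided coproducts merge with the outer maps, and both sides become iterated
  -- convolutions.
  simp only [LinearMap.comp_apply, LinearMap.rTensor, LinearMap.lTensor, LinearEquiv.coe_coe,
    TensorProduct.map_map, LinearMap.comp_id, LinearMap.comp_assoc] at e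
  exact e

theorem IsCoalgebra.convR_convL (hX : X.IsCoalgebra) (f g : C →ₗ[K] K) (h : C →ₗ[K] M) :
    X.convR (X.convL f h) g = X.convL f (X.convR h g) := by
  ext c
  have e := hX.rebracket
    (F := (TensorProduct.rid K M).toLinearMap ∘ₗ
      TensorProduct.map ((TensorProduct.lid K M).toLinearMap ∘ₗ TensorProduct.map f h) g)
    (G := (TensorProduct.lid K M).toLinearMap ∘ₗ
      TensorProduct.map f ((TensorProduct.rid K M).toLinearMap ∘ₗ TensorProduct.map h g))
    (fun x y z => by simp [smul_smul, mul_comm]) c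
  simp only [LinearMap.comp_apply, LinearMap.rTensor, LinearMap.lTensor, LinearEquiv.coe_coe,
    TensorProduct.map_map, LinearMap.comp_id, LinearMap.comp_assoc] at e
  exact e

theorem IsCoalgebra.convR_convR (hX : X.IsCoalgebra) (f g : C →ₗ[K] K) (h : C →ₗ[K] M) :
    X.convR (X.convR h f) g = X.convR h (X.convL f g) := by
  ext c
  have e := hX.rebracket
    (F := (TensorProduct.rid K M).toLinearMap ∘ₗ
      TensorProduct.map ((TensorProduct.rid K M).toLinearMap ∘ₗ TensorProduct.map h f) g)
    (G := (TensorProduct.rid K M).toLinearMap ∘ₗ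
      TensorProduct.map h ((TensorProduct.lid K K).toLinearMap ∘ₗ TensorProduct.map f g))
    (fun x y z => by simp [smul_smul, mul_comm]) c
  simp only [LinearMap.comp_apply, LinearMap.rTensor, LinearMap.lTensor, LinearEquiv.coe_coe,
    TensorProduct.map_map, LinearMap.comp_id, LinearMap.comp_assoc] at e
  exact e

theorem IsCoalgebra.counit_convL (hX : X.IsCoalgebra) (g : C →ₗ[K] M) :
    X.convL X.counit g = g := by
  ext c
  have : TensorProduct.map X.counit g = g.lTensor K ∘ₗ X.counit.rTensor C := by ext; simp
  rw [convL_apply, this, LinearMap.comp_apply, hX.counit_left]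
  simp

theorem IsCoalgebra.convR_counit (hX : X.IsCoalgebra) (g : C →ₗ[K] M) :
    X.convR g X.counit = g := by
  ext c
  have : TensorProduct.map g X.counit = g.rTensor K ∘ₗ X.counit.lTensor C := by ext; simp
  rw [convR_apply, this, LinearMap.comp_apply, hX.counit_right]
  simp

theorem IsCoalgebra.convL_counit (hX : X.IsCoalgebra) (g : C →ₗ[K] K) :
    X.convL g X.counit = g := by
  rw [← convR_eq_convL, hX.convR_counit]

theorem IsConvInv.symm {f g : C →ₗ[K] K} (h : X.IsConvInv f g) : X.IsConvInv g f := ⟨h.2, h.1⟩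

theorem IsConvInv.cancel {f g : C →ₗ[K] K} (h : X.IsConvInv f g) (hX : X.IsCoalgebra)
    (k : C →ₗ[K] M) : X.convL f (X.convL g k) = k := by
  rw [← hX.convL_assoc, h.1, hX.counit_convL]

theorem IsConvInv.unique {f g g' : C →ₗ[K] K} (hX : X.IsCoalgebra) (h : X.IsConvInv f g)
    (h' : X.convL g' f = X.counit) : g' = g := by
  have := h.cancel hX X.counit
  rw [← hX.convL_counit g', ← h.1, ← hX.convL_assoc, h', hX.counit_convL]

theorem IsConvInv.mul {f g f' g' : C →ₗ[K] K} (hX : X.IsCoalgebra) (h : X.IsConvInv f g)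
    (h' : X.IsConvInv f' g') : X.IsConvInv (X.convL f f') (X.convL g' g) := by
  constructor
  · rw [hX.convL_assoc, h'.cancel hX, h.1]
  · rw [hX.convL_assoc, h.symm.cancel hX, h'.2]

/-! ### Coalgebra maps -/

theorem IsCoalgMap.comp {g : D →ₗ[K] E} {f : C →ₗ[K] D} (hg : IsCoalgMap Y Z g)
    (hf : IsCoalgMap X Y f) : IsCoalgMap X Z (g ∘ₗ f) where
  map_comul c := by
    rw [LinearMap.comp_apply, hg.map_comul, hf.map_comul, TensorProduct.map_comp]; rfl
  map_counit c := by rw [LinearMap.comp_apply, hg.map_counit, hf.map_counit]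

theorem IsCoalgMap.id : IsCoalgMap X X (LinearMap.id : C →ₗ[K] C) where
  map_comul c := by simp
  map_counit _ := rfl

theorem IsCoalgMap.counit_comp {f : C →ₗ[K] D} (hf : IsCoalgMap X Y f) :
    Y.counit ∘ₗ f = X.counit := LinearMap.ext hf.map_counit

theorem IsCoalgMap.comul_comp {f : C →ₗ[K] D} (hf : IsCoalgMap X Y f) :
    Y.comul ∘ₗ f = TensorProduct.map f f ∘ₗ X.comul := LinearMap.ext hf.map_comul

theorem IsCoalgMap.convL_comp {p : C →ₗ[K] D} (hp : IsCoalgMap X Y p) (f : D →ₗ[K] K)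
    (g : D →ₗ[K] M) : Y.convL f g ∘ₗ p = X.convL (f ∘ₗ p) (g ∘ₗ p) := by
  simp only [convL, LinearMap.comp_assoc, hp.comul_comp, TensorProduct.map_comp]

theorem IsCoalgMap.convR_comp {p : C →ₗ[K] D} (hp : IsCoalgMap X Y p) (g : D →ₗ[K] M)
    (f : D →ₗ[K] K) : Y.convR g f ∘ₗ p = X.convR (g ∘ₗ p) (f ∘ₗ p) := by
  simp only [convR, LinearMap.comp_assoc, hp.comul_comp, TensorProduct.map_comp]

theorem IsCoalgMap.isConvInv_comp {p : C →ₗ[K] D} (hp : IsCoalgMap X Y p) {f g : D →ₗ[K] K}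
    (h : Y.IsConvInv f g) : X.IsConvInv (f ∘ₗ p) (g ∘ₗ p) := by
  constructor
  · rw [← hp.convL_comp, h.1, hp.counit_comp]
  · rw [← hp.convL_comp, h.2, hp.counit_comp]

/-- Composition with a surjection is cancellable. This is how invertibility on a braided tensor
power is tested on a tensor power of `A`. -/
theorem IsCoalgMap.isConvInv_of_comp {p : C →ₗ[K] D} (hp : IsCoalgMap X Y p)
    (hs : Function.Surjective p) {f g : D →ₗ[K] K}
    (h : X.IsConvInv (f ∘ₗ p) (g ∘ₗ p)) : Y.IsConvInv f g := by
  constructor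
  · rw [← LinearMap.cancel_right hs, hp.convL_comp, h.1, hp.counit_comp]
  · rw [← LinearMap.cancel_right hs, hp.convL_comp, h.2, hp.counit_comp]

/-- The image of a coalgebra is a coalgebra. -/
theorem IsCoalgMap.isCoalgebra {p : C →ₗ[K] D} (hp : IsCoalgMap X Y p)
    (hs : Function.Surjective p) (hX : X.IsCoalgebra) : Y.IsCoalgebra where
  coassoc d := by
    obtain ⟨c, rfl⟩ := hs d
    have h1 : ∀ t : C ⊗[K] C, Y.comul.rTensor D (TensorProduct.map p p t) =
        TensorProduct.map (TensorProduct.map p p) p (X.comul.rTensor C t) :=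
      eq_of_tmul (f := Y.comul.rTensor D ∘ₗ TensorProduct.map p p)
        (g := TensorProduct.map (TensorProduct.map p p) p ∘ₗ X.comul.rTensor C)
        (fun x y => by simp [hp.map_comul])
    have h2 : ∀ t : C ⊗[K] C, Y.comul.lTensor D (TensorProduct.map p p t) =
        TensorProduct.map p (TensorProduct.map p p) (X.comul.lTensor C t) :=
      eq_of_tmul (f := Y.comul.lTensor D ∘ₗ TensorProduct.map p p)
        (g := TensorProduct.map p (TensorProduct.map p p) ∘ₗ X.comul.lTensor C)
        (fun x y => by simp [hp.map_comul])
    rw [hp.map_comul, h1, h2, ← hX.coassoc]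
    generalize X.comul.rTensor C (X.comul c) = t
    have : (TensorProduct.assoc K D D D).toLinearMap ∘ₗ TensorProduct.map (TensorProduct.map p p) p
        = TensorProduct.map p (TensorProduct.map p p) ∘ₗ
          (TensorProduct.assoc K C C C).toLinearMap := by ext; simp
    exact congr($this t)
  counit_left d := by
    obtain ⟨c, rfl⟩ := hs d
    have h1 : ∀ t : C ⊗[K] C, Y.counit.rTensor D (TensorProduct.map p p t) =
        p.lTensor K (X.counit.rTensor C t) :=
      eq_of_tmul (f := Y.counit.rTensor D ∘ₗ TensorProduct.map p p)
        (g := p.lTensor K ∘ₗ X.counit.rTensor C) (fun x y => by simp [hp.map_counit])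
    rw [hp.map_comul, h1, hX.counit_left, LinearMap.lTensor_tmul]
  counit_right d := by
    obtain ⟨c, rfl⟩ := hs d
    have h1 : ∀ t : C ⊗[K] C, Y.counit.lTensor D (TensorProduct.map p p t) =
        p.rTensor K (X.counit.lTensor C t) :=
      eq_of_tmul (f := Y.counit.lTensor D ∘ₗ TensorProduct.map p p)
        (g := p.rTensor K ∘ₗ X.counit.lTensor C) (fun x y => by simp [hp.map_counit])
    rw [hp.map_comul, h1, hX.counit_right, LinearMap.rTensor_tmul]

/-- A coalgebra map factors through a surjective coalgebra map as a coalgebra map. -/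
theorem IsCoalgMap.of_comp {p : C →ₗ[K] D} (hp : IsCoalgMap X Y p)
    (hs : Function.Surjective p) {q : D →ₗ[K] E} (hq : IsCoalgMap X Z (q ∘ₗ p)) :
    IsCoalgMap Y Z q where
  map_comul d := by
    obtain ⟨c, rfl⟩ := hs d
    rw [hp.map_comul, TensorProduct.map_map]
    exact hq.map_comul c
  map_counit d := by
    obtain ⟨c, rfl⟩ := hs d
    rw [hp.map_counit]
    exact hq.map_counit c

/-! ### Tensor products of coalgebras -/

theorem tensor_counit : (X.tensor Y).counit = epsTensor K X.counit Y.counit := rfl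

theorem tensor_comul_tmul (c : C) (d : D) : (X.tensor Y).comul (c ⊗ₜ d) =
    TensorProduct.tensorTensorTensorComm K C C D D (X.comul c ⊗ₜ Y.comul d) := rfl

theorem IsCoalgMap.tensor {X' : CoalgData K C'} {Y' : CoalgData K D'} {f : C →ₗ[K] C'}
    {g : D →ₗ[K] D'} (hf : IsCoalgMap X X' f) (hg : IsCoalgMap Y Y' g) :
    IsCoalgMap (X.tensor Y) (X'.tensor Y') (TensorProduct.map f g) where
  map_comul := eq_of_tmul (f := (X'.tensor Y').comul ∘ₗ TensorProduct.map f g)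
    (g := TensorProduct.map (TensorProduct.map f g) (TensorProduct.map f g) ∘ₗ (X.tensor Y).comul)
    (fun x y => by
      simp only [LinearMap.comp_apply, TensorProduct.map_tmul, tensor_comul_tmul, hf.map_comul,
        hg.map_comul]
      generalize X.comul x = s
      generalize Y.comul y = t
      induction s using TensorProduct.induction_on with
      | zero => simp
      | add a b ha hb => simp only [map_add, TensorProduct.add_tmul, ha, hb]
      | tmul a b =>
        induction t using TensorProduct.induction_on with
        | zero => simp
        | add a b ha hb => simp only [map_add, TensorProduct.tmul_add, ha, hb]
        | tmul a b => simp)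
  map_counit := eq_of_tmul (f := (X'.tensor Y').counit ∘ₗ TensorProduct.map f g)
    (g := (X.tensor Y).counit)
    (fun x y => by simp [tensor_counit, hf.map_counit, hg.map_counit])

theorem isCoalgMap_assoc : IsCoalgMap ((X.tensor Y).tensor Z) (X.tensor (Y.tensor Z))
    (TensorProduct.assoc K C D E).toLinearMap where
  map_comul z := by
    have : (X.tensor (Y.tensor Z)).comul ∘ₗ (TensorProduct.assoc K C D E).toLinearMap =
      TensorProduct.map (TensorProduct.assoc K C D E).toLinearMap
        (TensorProduct.assoc K C D E).toLinearMap ∘ₗ ((X.tensor Y).tensor Z).comul := by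
      ext x y z
      simp only [TensorProduct.AlgebraTensorModule.curry_apply, TensorProduct.curry_apply,
        LinearMap.restrictScalars_apply, LinearMap.comp_apply, LinearEquiv.coe_coe,
        TensorProduct.assoc_tmul, tensor_comul_tmul]
      generalize X.comul x = s
      generalize Y.comul y = t
      generalize Z.comul z = r
      induction s using TensorProduct.induction_on with
      | zero => simp
      | add a b ha hb => simp only [map_add, TensorProduct.add_tmul, ha, hb]
      | tmul a b =>
        induction t using TensorProduct.induction_on with
        | zero => simp
        | add a b ha hb =>
          simp only [map_add, TensorProduct.add_tmul, TensorProduct.tmul_add, ha, hb]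
        | tmul a b =>
          induction r using TensorProduct.induction_on with
          | zero => simp
          | add a b ha hb => simp only [map_add, TensorProduct.tmul_add, ha, hb]
          | tmul a b => simp
    exact congr($this z)
  map_counit z := by
    have : (X.tensor (Y.tensor Z)).counit ∘ₗ (TensorProduct.assoc K C D E).toLinearMap =
      ((X.tensor Y).tensor Z).counit := by
      ext x y z
      simp [tensor_counit, mul_assoc]
    exact congr($this z)

theorem IsCoalgMap.symm {e : C ≃ₗ[K] D} (h : IsCoalgMap X Y e.toLinearMap) :
    IsCoalgMap Y X e.symm.toLinearMap := by
  refine IsCoalgMap.of_comp h e.surjective ?_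
  have : e.symm.toLinearMap ∘ₗ e.toLinearMap = LinearMap.id := by ext; simp
  rw [this]
  exact IsCoalgMap.id

/-- Convolution on a tensor product of coalgebras is computed factorwise. -/
theorem tensor_convL_map (f : C →ₗ[K] K) (f' : D →ₗ[K] K) (g : C →ₗ[K] M) (g' : D →ₗ[K] N) :
    (X.tensor Y).convL (epsTensor K f f') (TensorProduct.map g g') =
      TensorProduct.map (X.convL f g) (Y.convL f' g') := by
  refine TensorProduct.ext' fun x y => ?_
  simp only [convL_apply, TensorProduct.map_tmul, tensor_comul_tmul]
  generalize X.comul x = s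
  generalize Y.comul y = t
  induction s using TensorProduct.induction_on with
  | zero => simp
  | add a b ha hb => simp only [map_add, TensorProduct.add_tmul, ha, hb]
  | tmul a b =>
    induction t using TensorProduct.induction_on with
    | zero => simp
    | add a b ha hb => simp only [map_add, TensorProduct.tmul_add, ha, hb]
    | tmul a b => simp [TensorProduct.smul_tmul', TensorProduct.tmul_smul, smul_smul, mul_comm]

theorem tensor_convR_map (f : C →ₗ[K] K) (f' : D →ₗ[K] K) (g : C →ₗ[K] M) (g' : D →ₗ[K] N) :
    (X.tensor Y).convR (TensorProduct.map g g') (epsTensor K f f') =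
      TensorProduct.map (X.convR g f) (Y.convR g' f') := by
  refine TensorProduct.ext' fun x y => ?_
  simp only [convR_apply, TensorProduct.map_tmul, tensor_comul_tmul]
  generalize X.comul x = s
  generalize Y.comul y = t
  induction s using TensorProduct.induction_on with
  | zero => simp
  | add a b ha hb => simp only [map_add, TensorProduct.add_tmul, ha, hb]
  | tmul a b =>
    induction t using TensorProduct.induction_on with
    | zero => simp
    | add a b ha hb => simp only [map_add, TensorProduct.tmul_add, ha, hb]
    | tmul a b => simp [TensorProduct.smul_tmul', TensorProduct.tmul_smul, smul_smul, mul_comm]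

theorem tensor_convL_epsTensor (f g : C →ₗ[K] K) (f' g' : D →ₗ[K] K) :
    (X.tensor Y).convL (epsTensor K f f') (epsTensor K g g') =
      epsTensor K (X.convL f g) (Y.convL f' g') := by
  rw [epsTensor, epsTensor, epsTensor, ← tensor_convL_map, comp_convL]
  rfl

theorem IsConvInv.tensor {f g : C →ₗ[K] K} {f' g' : D →ₗ[K] K} (h : X.IsConvInv f g)
    (h' : Y.IsConvInv f' g') :
    (X.tensor Y).IsConvInv (epsTensor K f f') (epsTensor K g g') := by
  constructor
  · rw [tensor_convL_epsTensor, h.1, h'.1, tensor_counit]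
  · rw [tensor_convL_epsTensor, h.2, h'.2, tensor_counit]

theorem IsCoalgebra.isConvInv_counit (hX : X.IsCoalgebra) : X.IsConvInv X.counit X.counit :=
  ⟨hX.counit_convL _, hX.counit_convL _⟩

/-- The data are promoted to local `Coalgebra` instances; `tensor` then agrees with the tensor
product coalgebra of Mathlib on pure tensors. -/
theorem IsCoalgebra.tensor (hX : X.IsCoalgebra) (hY : Y.IsCoalgebra) :
    (X.tensor Y).IsCoalgebra := by
  let _ : Coalgebra K C :=
    { comul := X.comul
      counit := X.counit
      coassoc := LinearMap.ext hX.coassoc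
      rTensor_counit_comp_comul := LinearMap.ext hX.counit_left
      lTensor_counit_comp_comul := LinearMap.ext hX.counit_right }
  let _ : Coalgebra K D :=
    { comul := Y.comul
      counit := Y.counit
      coassoc := LinearMap.ext hY.coassoc
      rTensor_counit_comp_comul := LinearMap.ext hY.counit_left
      lTensor_counit_comp_comul := LinearMap.ext hY.counit_right }
  have h : X.tensor Y = ofCoalgebra K (C ⊗[K] D) := by
    simp only [CoalgData.tensor, ofCoalgebra, mk.injEq]
    constructor
    · refine TensorProduct.ext' fun x y => ?_
      rw [TensorProduct.comul_tmul]; rfl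
    · refine TensorProduct.ext' fun x y => ?_
      simp [TensorProduct.counit_tmul, mul_comm]; rfl
  rw [h]
  exact isCoalgebra_ofCoalgebra

/-- If `c ↦ c₁ f(c₂) - c` is locally nilpotent, then `f` is convolution invertible. -/
theorem IsCoalgebra.exists_isConvInv (hX : X.IsCoalgebra) (f : C →ₗ[K] K)
    (h : ∀ c, ∃ n, ((X.convR LinearMap.id (f - X.counit)) ^ n) c = 0) :
    ∃ g, X.IsConvInv f g := by
  set L : Module.End K C := X.convR LinearMap.id (f - X.counit) with hL
  have hL1 : X.convR LinearMap.id f = 1 + L := by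
    have : X.convR LinearMap.id (f - X.counit) = X.convR LinearMap.id f - LinearMap.id := by
      ext c
      have e : (X.convR (LinearMap.id : C →ₗ[K] C) X.counit) c = c := by
        rw [hX.convR_counit]; rfl
      have e' : ∀ t : C ⊗[K] C, TensorProduct.map LinearMap.id (f - X.counit) t =
          TensorProduct.map LinearMap.id f t - TensorProduct.map LinearMap.id X.counit t :=
        eq_of_tmul (f := TensorProduct.map LinearMap.id (f - X.counit))
          (g := TensorProduct.map LinearMap.id f - TensorProduct.map LinearMap.id X.counit)
          (fun x y => by simp [TensorProduct.tmul_sub])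
      rw [convR_apply, e', map_sub, ← convR_apply, ← convR_apply, e]
      rfl
    rw [hL, this]
    simp [Module.End.one_eq_id]
  -- On the kernel of `1 + L` the operator `L` acts as `-1`, which is nilpotent only on zero.
  have inj : Function.Injective (1 + L : Module.End K C) := by
    rw [← LinearMap.ker_eq_bot, LinearMap.ker_eq_bot']
    intro c hc
    have hc' : L c = -c := by
      rw [LinearMap.add_apply, Module.End.one_apply, add_comm] at hc
      exact eq_neg_of_add_eq_zero_left hc
    obtain ⟨n, hn⟩ := h c
    have : ∀ n, (L ^ n) c = (-1 : K) ^ n • c := by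
      intro n
      induction n with
      | zero => simp
      | succ n ih => rw [pow_succ', Module.End.mul_apply, ih, map_smul, hc', pow_succ]; simp
    rw [this] at hn
    exact (smul_eq_zero.1 hn).resolve_left (pow_ne_zero _ (by simp))
  -- Since `c = (1 + L)c - Lc`, it suffices that `Lc` is in the range: induction on the nilpotency
  -- index.
  have surj : Function.Surjective (1 + L : Module.End K C) := by
    have : ∀ n c, (L ^ n) c = 0 → c ∈ LinearMap.range (1 + L : Module.End K C) := by
      intro n
      induction n with
      | zero => intro c hc; rw [show c = 0 by simpa using hc]; exact Submodule.zero_mem _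
      | succ n ih =>
        intro c hc
        have h1 := ih (L c) (by rw [← Module.End.mul_apply, ← pow_succ, hc])
        have h2 : c = (1 + L) c - L c := by simp
        rw [h2]
        exact Submodule.sub_mem _ (LinearMap.mem_range_self _ _) h1
    intro c
    obtain ⟨n, hn⟩ := h c
    exact this n c hn
  -- By `comp` and `eps`, `a ↦ (c ↦ c₁ a(c₂))` is a multiplicative embedding of the convolution
  -- algebra into `End C`, with left inverse given by composing with the counit. An inverse of `f`
  -- can therefore be read off from `(1 + L)⁻¹`.
  have comp : ∀ a b : C →ₗ[K] K, X.convR LinearMap.id a ∘ₗ X.convR LinearMap.id b =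
      X.convR LinearMap.id (X.convL a b) := by
    intro a b
    rw [comp_convR, LinearMap.comp_id, hX.convR_convR]
  have eps : ∀ a : C →ₗ[K] K, X.counit ∘ₗ X.convR LinearMap.id a = a := by
    intro a
    rw [comp_convR, convR_eq_convL, LinearMap.comp_id, hX.counit_convL]
  let e := LinearEquiv.ofBijective (1 + L : Module.End K C) ⟨inj, surj⟩
  let g : C →ₗ[K] K := X.counit ∘ₗ e.symm.toLinearMap
  have hg : X.convL g f = X.counit := by
    rw [← eps (X.convL g f), ← comp, ← LinearMap.comp_assoc, eps, hL1]
    ext c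
    exact congrArg X.counit (e.symm_apply_apply c)
  refine ⟨g, ?_, hg⟩
  -- `g` is so far only a left inverse. As `(f * g) * f = f * (g * f) = f`, the operator of `f * g`
  -- is the identity on the range of `1 + L`, which is everything.
  have h1 : X.convR LinearMap.id (X.convL f g) ∘ₗ (1 + L) = (1 + L : Module.End K C) := by
    rw [← hL1, comp, hX.convL_assoc, hg, hX.convL_counit]
  have h2 : X.convR LinearMap.id (X.convL f g) = LinearMap.id :=
    (LinearMap.cancel_right surj).1 (by rw [h1]; rfl)
  rw [← eps (X.convL f g), h2]
  rfl

end CoalgData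

end

/-! ### Subcoalgebras and exhaustion by the coradical filtration. -/

noncomputable section

section Separation

variable {K : Type*} [Field K] {M N : Type*} [AddCommGroup M] [Module K M]
  [AddCommGroup N] [Module K N]

/-- The coordinate functionals of a basis of `N` already separate tensors. -/
theorem tensor_ext_right {t t' : M ⊗[K] N}
    (h : ∀ f : N →ₗ[K] K, f.lTensor M t = f.lTensor M t') : t = t' := by
  classical
  apply (TensorProduct.equivFinsuppOfBasisRight (Module.Basis.ofVectorSpace K N)).injective
  ext i
  have key : ∀ t : M ⊗[K] N,
      (TensorProduct.equivFinsuppOfBasisRight (Module.Basis.ofVectorSpace K N)) t i =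
      TensorProduct.rid K M (((Module.Basis.ofVectorSpace K N).coord i).lTensor M t) := by
    intro t
    induction t using TensorProduct.induction_on with
    | zero => simp
    | add x y hx hy => simp only [map_add, Finsupp.add_apply, hx, hy]
    | tmul x y => simp
  rw [key, key, h]

theorem tensor_ext_left {t t' : M ⊗[K] N}
    (h : ∀ f : M →ₗ[K] K, f.rTensor N t = f.rTensor N t') : t = t' := by
  apply (TensorProduct.comm K M N).injective
  refine tensor_ext_right fun f => ?_
  have key : ∀ t : M ⊗[K] N, f.lTensor N (TensorProduct.comm K M N t) =
      TensorProduct.comm K K N (f.rTensor N t) := by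
    intro t
    induction t using TensorProduct.induction_on with
    | zero => simp
    | add x y hx hy => simp only [map_add, hx, hy]
    | tmul x y => simp
  rw [key, key, h]

end Separation

namespace CoalgData

variable {K : Type*} [Field K] {C : Type*} [AddCommGroup C] [Module K C] {X : CoalgData K C}

/-- Let `q` be a linear projection of `C` onto `V`. All slices of `Δ(c)` by functionals lie in `V`
and are fixed by `q`. Since slices separate tensors, `q ⊗ id` and `id ⊗ q` fix `Δ(c)`, hence so does
`q ⊗ q`. -/
theorem isSubcoalgebra_of_stable {V : Submodule K C}
    (hr : ∀ f : C →ₗ[K] K, ∀ c ∈ V, X.convR LinearMap.id f c ∈ V)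
    (hl : ∀ f : C →ₗ[K] K, ∀ c ∈ V, X.convL f LinearMap.id c ∈ V) : X.IsSubcoalgebra V := by
  intro c hc
  obtain ⟨p, hp⟩ := V.subtype.exists_leftInverse_of_injective V.ker_subtype
  have hp' : ∀ x ∈ V, (p x : C) = x := fun x hx => congrArg Subtype.val congr($hp ⟨x, hx⟩)
  set q : C →ₗ[K] C := V.subtype ∘ₗ p with hq
  have h1 : q.rTensor C (X.comul c) = X.comul c := by
    refine tensor_ext_right fun f => (TensorProduct.rid K C).injective ?_
    have e : ∀ t : C ⊗[K] C, TensorProduct.rid K C (f.lTensor C (q.rTensor C t)) =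
        q (TensorProduct.rid K C (f.lTensor C t)) :=
      eq_of_tmul (f := (TensorProduct.rid K C).toLinearMap ∘ₗ f.lTensor C ∘ₗ q.rTensor C)
        (g := q ∘ₗ (TensorProduct.rid K C).toLinearMap ∘ₗ f.lTensor C) (fun x y => by simp)
    rw [e]
    exact hp' _ (hr f c hc)
  have h2 : q.lTensor C (X.comul c) = X.comul c := by
    refine tensor_ext_left fun f => (TensorProduct.lid K C).injective ?_
    have e : ∀ t : C ⊗[K] C, TensorProduct.lid K C (f.rTensor C (q.lTensor C t)) =
        q (TensorProduct.lid K C (f.rTensor C t)) :=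
      eq_of_tmul (f := (TensorProduct.lid K C).toLinearMap ∘ₗ f.rTensor C ∘ₗ q.lTensor C)
        (g := q ∘ₗ (TensorProduct.lid K C).toLinearMap ∘ₗ f.rTensor C) (fun x y => by simp)
    rw [e]
    exact hp' _ (hl f c hc)
  refine ⟨TensorProduct.map p p (X.comul c), ?_⟩
  rw [TensorProduct.map_map]
  change TensorProduct.map q q _ = _
  rw [← LinearMap.lTensor_comp_rTensor, LinearMap.comp_apply, h1, h2]

theorem IsSubcoalgebra.convR_mem {V : Submodule K C} (h : X.IsSubcoalgebra V) (f : C →ₗ[K] K)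
    {c : C} (hc : c ∈ V) : X.convR LinearMap.id f c ∈ V := by
  obtain ⟨t, ht⟩ := h c hc
  rw [convR_apply, ← ht]
  clear ht
  induction t using TensorProduct.induction_on with
  | zero => simp
  | add x y hx hy => simp only [map_add]; exact V.add_mem hx hy
  | tmul x y => simpa using V.smul_mem _ x.2

theorem IsSubcoalgebra.convR_eq_zero {V : Submodule K C} (h : X.IsSubcoalgebra V)
    {f : C →ₗ[K] K} (hf : V ≤ LinearMap.ker f) {c : C} (hc : c ∈ V) :
    X.convR LinearMap.id f c = 0 := by
  obtain ⟨t, ht⟩ := h c hc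
  rw [convR_apply, ← ht]
  clear ht
  induction t using TensorProduct.induction_on with
  | zero => simp
  | add x y hx hy => simp only [map_add, hx, hy, add_zero]
  | tmul x y => simp [LinearMap.mem_ker.1 (hf y.2)]

/-- The elements killed by all products of `n` functionals vanishing on `V`, for the action
`f • c = c₁ f(c₂)`. -/
def wedgeFil (X : CoalgData K C) (V : Submodule K C) : ℕ → Set C
  | 0 => {0}
  | n + 1 => {c | ∀ f : C →ₗ[K] K, V ≤ LinearMap.ker f →
      X.convR LinearMap.id f c ∈ X.wedgeFil V n}

end CoalgData

section Coradical

open WithConv CoalgData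

variable {K : Type*} [Field K] {C : Type*} [AddCommGroup C] [Module K C] [Coalgebra K C]

/-- The dual algebra of a coalgebra, with the convolution product. -/
def DualAlg (K : Type*) [Field K] (C : Type*) [AddCommGroup C] [Module K C] [Coalgebra K C] :=
  WithConv (C →ₗ[K] K)

instance : Ring (DualAlg K C) := inferInstanceAs (Ring (WithConv (C →ₗ[K] K)))

instance : Algebra K (DualAlg K C) := LinearMap.convAlgebra

/-- A functional as an element of the dual algebra. -/
def DualAlg.of (f : C →ₗ[K] K) : DualAlg K C := toConv f

/-- The functional underlying an element of the dual algebra. -/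
def DualAlg.toFun (f : DualAlg K C) : C →ₗ[K] K := WithConv.ofConv f

/-- The action `f • c = c₁ f(c₂)` of the dual algebra on a coalgebra. -/
def dualAction (K : Type*) [Field K] (C : Type*) [AddCommGroup C] [Module K C] [Coalgebra K C] :
    DualAlg K C →+* Module.End K C where
  toFun f := (ofCoalgebra K C).convR LinearMap.id f.toFun
  map_one' := by
    have : (1 : DualAlg K C).toFun = (ofCoalgebra K C).counit := by
      ext c; exact LinearMap.convOne_apply c
    rw [this, isCoalgebra_ofCoalgebra.convR_counit]
    rfl
  map_mul' f g := by
    have : (f * g).toFun = (ofCoalgebra K C).convL f.toFun g.toFun := by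
      ext c
      refine eq_of_tmul (f := LinearMap.mul' K K ∘ₗ TensorProduct.map f.toFun g.toFun)
        (g := (TensorProduct.lid K K).toLinearMap ∘ₗ TensorProduct.map f.toFun g.toFun) ?_ _
      simp
    rw [this, Module.End.mul_eq_comp, comp_convR, LinearMap.comp_id,
      isCoalgebra_ofCoalgebra.convR_convR]
  map_zero' := by
    ext c
    have : (0 : DualAlg K C).toFun = 0 := rfl
    simp [convR_apply, this]
  map_add' f g := by
    ext c
    have : (f + g).toFun = f.toFun + g.toFun := rfl
    simp [convR_apply, TensorProduct.map_add_right, this]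

/-- The module structure `f • c = c₁ f(c₂)` over the dual algebra. -/
@[reducible] def dualModule (K : Type*) [Field K] (C : Type*) [AddCommGroup C] [Module K C]
    [Coalgebra K C] : Module (DualAlg K C) C :=
  Module.compHom C (dualAction K C)

attribute [local instance] dualModule

theorem dual_smul_def (f : DualAlg K C) (c : C) :
    f • c = (ofCoalgebra K C).convR LinearMap.id f.toFun c := rfl

theorem counit_dual_smul (f : DualAlg K C) (c : C) :
    Coalgebra.counit (R := K) (f • c) = f.toFun c := by
  have : (ofCoalgebra K C).counit ∘ₗ (ofCoalgebra K C).convR LinearMap.id f.toFun = f.toFun := by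
    rw [comp_convR, convR_eq_convL, LinearMap.comp_id, isCoalgebra_ofCoalgebra.counit_convL]
  exact congr($this c)

theorem dual_isScalarTower : IsScalarTower K (DualAlg K C) C where
  smul_assoc k f c := by
    have : ∀ t : C ⊗[K] C, TensorProduct.map LinearMap.id (k • f.toFun) t =
        k • TensorProduct.map LinearMap.id f.toFun t := fun t => by
      rw [TensorProduct.map_smul_right, LinearMap.smul_apply]
    rw [dual_smul_def, dual_smul_def, convR_apply, convR_apply, ← map_smul, ← this]
    rfl

attribute [local instance] dual_isScalarTower

/-- `c ↦ φ(c₁) c₂` is linear over the dual algebra. -/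
def coeffMap (φ : C →ₗ[K] K) : C →ₗ[DualAlg K C] C where
  toFun := (ofCoalgebra K C).convL φ LinearMap.id
  map_add' := map_add _
  map_smul' f c := by
    have : (ofCoalgebra K C).convL φ LinearMap.id ∘ₗ (ofCoalgebra K C).convR LinearMap.id f.toFun =
        (ofCoalgebra K C).convR LinearMap.id f.toFun ∘ₗ
          (ofCoalgebra K C).convL φ LinearMap.id := by
      rw [comp_convR, comp_convL, LinearMap.comp_id, LinearMap.comp_id,
        isCoalgebra_ofCoalgebra.convR_convL]
    exact congr($this c)

theorem counit_coeffMap (φ : C →ₗ[K] K) (c : C) :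
    Coalgebra.counit (R := K) (coeffMap φ c) = φ c := by
  have : (ofCoalgebra K C).counit ∘ₗ (ofCoalgebra K C).convL φ LinearMap.id = φ := by
    rw [comp_convL, LinearMap.comp_id, isCoalgebra_ofCoalgebra.convL_counit]
  exact congr($this c)

/-- Both sides are `φ(c₁) f(c₂)`. This lets membership in a submodule for the dual algebra control
the kernel of `coeffMap φ`. -/
theorem functional_coeffMap (φ f : C →ₗ[K] K) (c : C) :
    f (coeffMap φ c) = φ (DualAlg.of f • c) := by
  have : f ∘ₗ (ofCoalgebra K C).convL φ LinearMap.id =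
      φ ∘ₗ (ofCoalgebra K C).convR LinearMap.id f := by
    rw [comp_convL, comp_convR, LinearMap.comp_id, LinearMap.comp_id, convR_eq_convL]
  exact congr($this c)

/-- A submodule for the dual algebra is stable under slicing the right leg of `Δ`. An isotypic
component is moreover fully invariant, so stable under the endomorphisms `coeffMap φ`, which slice
the left leg; it is thus a subcoalgebra. If a nonzero subcoalgebra `N` inside it missed some `x`, a
functional `f` vanishing on `N` but not at `x` would kill a simple submodule of `N`, hence all
copies of `S`, hence the whole component, although `ε(f • x) = f(x) ≠ 0`. -/
theorem isotypicComponent_isSimpleSubcoalgebra (S : Submodule (DualAlg K C) C)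
    [IsSimpleModule (DualAlg K C) S] :
    (ofCoalgebra K C).IsSimpleSubcoalgebra
      ((isotypicComponent (DualAlg K C) C S).restrictScalars K) := by
  set B := DualAlg K C
  refine ⟨isSubcoalgebra_of_stable (fun f c hc => ?_) (fun f c hc => ?_), ?_, ?_⟩
  · exact (isotypicComponent B C S).smul_mem (DualAlg.of f) hc
  · exact Submodule.IsFullyInvariant.isotypicComponent B C S (coeffMap f) hc
  · rw [Ne, Submodule.restrictScalars_eq_bot_iff]
    exact (bot_lt_isotypicComponent S).ne'
  · intro N hN hsub
    rw [or_iff_not_imp_left]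
    intro hne
    let N' : Submodule B C :=
      { carrier := N, add_mem' := N.add_mem, zero_mem' := N.zero_mem
        smul_mem' := fun f c hc => hsub.convR_mem f.toFun hc }
    have hN' : N' ≤ isotypicComponent B C S := hN
    have : IsSemisimpleModule B N' := IsSemisimpleModule.of_injective
      (M := isotypicComponent B C S) (Submodule.inclusion hN') (Submodule.inclusion_injective hN')
    obtain h | ⟨T, hT, hTs⟩ := IsSemisimpleModule.eq_bot_or_exists_simple_le N'
    · exact absurd (by rw [eq_bot_iff]; intro x hx; exact (Submodule.mem_bot B).1 (h ▸ hx)) hne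
    have simp' : ∀ m : {m : Submodule B C | Nonempty (m ≃ₗ[B] S)}, IsSimpleModule B m :=
      fun m => IsSimpleModule.congr m.2.some
    -- A simple submodule of a sum of copies of `S` is itself isomorphic to `S`.
    obtain ⟨m, ⟨em⟩, ⟨e⟩⟩ := T.linearEquiv_of_le_sSup _ (hT.trans hN')
    refine le_antisymm hN fun x hx => ?_
    by_contra hxN
    obtain ⟨f, hfx, hf⟩ := Submodule.exists_le_ker_of_notMem hxN
    have hkT : ∀ t : T, DualAlg.of f • t = 0 := fun t =>
      Subtype.ext (hsub.convR_eq_zero hf (hT t.2))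
    have hkS : ∀ s : S, DualAlg.of f • s = 0 := fun s => by
      have : s = (e.trans em) ((e.trans em).symm s) := by simp
      rw [this, ← map_smul, hkT, map_zero]
    have hk : ∀ y ∈ isotypicComponent B C S, DualAlg.of f • y = 0 := by
      intro y hy
      rw [isotypicComponent, sSup_eq_iSup'] at hy
      refine Submodule.iSup_induction _ (motive := fun y => DualAlg.of f • y = 0) hy ?_ ?_ ?_
      · rintro ⟨m, ⟨em⟩⟩ z hz
        have : (⟨z, hz⟩ : m) = em.symm (em ⟨z, hz⟩) := by simp
        have h2 : DualAlg.of f • (⟨z, hz⟩ : m) = 0 := by rw [this, ← map_smul, hkS, map_zero]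
        exact congrArg Subtype.val h2
      · exact smul_zero _
      · intro a b ha hb
        rw [smul_add, ha, hb, add_zero]
    apply hfx
    have := counit_dual_smul (DualAlg.of f) x
    rw [hk x hx, map_zero] at this
    exact this.symm

/-- Simple subquotients are killed by functionals vanishing on the coradical. -/
theorem smul_mem_of_isCoatom (N : Submodule (DualAlg K C) C)
    (N' : Submodule (DualAlg K C) N) (h : IsCoatom N') (f : C →ₗ[K] K)
    (hf : (ofCoalgebra K C).coradical ≤ LinearMap.ker f) (x : N) :
    DualAlg.of f • x ∈ N' := by
  set B := DualAlg K C
  have simple : IsSimpleModule B (N ⧸ N') := isSimpleModule_iff_isCoatom.2 h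
  have nt : Nontrivial (N ⧸ N') := IsSimpleModule.nontrivial B _
  obtain ⟨x₀, hx₀⟩ := exists_ne (0 : N ⧸ N')
  obtain ⟨φ, hφ⟩ : ∃ φ : Module.Dual K (N ⧸ N'), φ x₀ ≠ 0 := by
    by_contra! hc
    exact hx₀ ((Module.forall_dual_apply_eq_zero_iff K x₀).1 hc)
  obtain ⟨n₀, rfl⟩ := N'.mkQ_surjective x₀
  -- A nonzero functional on the simple quotient is lifted to `N` and extended to all of `C`, so
  -- that it has a coefficient map.
  obtain ⟨ψ, hψ⟩ := (φ ∘ₗ (N'.mkQ).restrictScalars K : N →ₗ[K] K).exists_extend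
    (p := N.restrictScalars K)
  have hψ' : ∀ n : N, ψ n = φ (N'.mkQ n) := fun n => congr($hψ n)
  -- For `n ∈ N'`, `g (coeffMap ψ n) = ψ(g • n) = 0` for all `g`. Hence `coeffMap ψ` induces a map
  -- from the simple quotient to `C`; it is nonzero because the counit recovers `ψ`, so it embeds
  -- the quotient into a simple subcoalgebra, on which `f` acts as zero.
  have hle : N' ≤ LinearMap.ker (coeffMap ψ ∘ₗ N.subtype) := by
    intro n hn
    rw [LinearMap.mem_ker, LinearMap.comp_apply, ← Module.forall_dual_apply_eq_zero_iff K]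
    intro g
    rw [functional_coeffMap]
    have := hψ' (DualAlg.of g • n)
    rw [(Submodule.Quotient.mk_eq_zero N' (x := DualAlg.of g • n)).2 (N'.smul_mem _ hn) |>
      (show N'.mkQ (DualAlg.of g • n) = 0 from ·), map_zero] at this
    exact this
  let F : N ⧸ N' →ₗ[B] C := N'.liftQ _ hle
  have hF : ∀ n, F (N'.mkQ n) = coeffMap ψ n := fun n => rfl
  have inj : Function.Injective F := by
    refine F.injective_or_eq_zero.resolve_right fun h0 => hφ ?_
    rw [← hψ', ← counit_coeffMap, ← hF, h0]
    simp
  let e := LinearEquiv.ofInjective F inj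
  have := IsSimpleModule.congr e.symm
  have hE := isotypicComponent_isSimpleSubcoalgebra (LinearMap.range F)
  have hE' := (le_sSup hE : _ ≤ (ofCoalgebra K C).coradical)
  have hm : (F (N'.mkQ x)) ∈ (isotypicComponent B C (LinearMap.range F)).restrictScalars K :=
    Submodule.le_isotypicComponent (LinearMap.range F) (LinearMap.mem_range_self _ _)
  have h0 := hE.1.convR_eq_zero (hE'.trans hf) hm
  change DualAlg.of f • F (N'.mkQ x) = 0 at h0
  rw [← map_smul, ← map_smul] at h0
  have := inj (h0.trans F.map_zero.symm)
  exact (Submodule.Quotient.mk_eq_zero N').1 this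

/-- The finiteness theorem for comodules: every `f • c` lies in the span of the finitely many left
legs of one expression for `Δ(c)`. -/
theorem finite_span_dual (c : C) :
    Module.Finite K ((Submodule.span (DualAlg K C) {c})) := by
  have : ∀ t : C ⊗[K] C, ∃ V : Submodule K C, FiniteDimensional K V ∧ ∀ f : C →ₗ[K] K,
      TensorProduct.rid K C (TensorProduct.map LinearMap.id f t) ∈ V := by
    intro t
    induction t using TensorProduct.induction_on with
    | zero => exact ⟨⊥, inferInstance, fun f => by simp⟩
    | tmul x y =>
      refine ⟨K ∙ x, inferInstance, fun f => ?_⟩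
      simpa using Submodule.smul_mem _ _ (Submodule.mem_span_singleton_self x)
    | add x y hx hy =>
      obtain ⟨V, _, hV⟩ := hx
      obtain ⟨W, _, hW⟩ := hy
      refine ⟨V ⊔ W, inferInstance, fun f => ?_⟩
      rw [map_add, map_add]
      exact Submodule.add_mem_sup (hV f) (hW f)
  obtain ⟨V, hV, h⟩ := this (Coalgebra.comul c)
  have hle : (Submodule.span (DualAlg K C) {c}).restrictScalars K ≤ V := by
    intro x hx
    obtain ⟨f, rfl⟩ := Submodule.mem_span_singleton.1 hx
    exact h f.toFun
  exact Module.Finite.of_injective (Submodule.inclusion hle) (Submodule.inclusion_injective hle)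

/-- Induction on the dimension. A functional vanishing on the coradical kills the simple quotient of
`N` by a maximal submodule, so it sends `c` into a submodule of smaller dimension. -/
theorem mem_wedgeFil_of_finrank_le (n : ℕ) : ∀ N : Submodule (DualAlg K C) C,
    Module.Finite K N → Module.finrank K N ≤ n → ∀ c ∈ N,
      c ∈ (ofCoalgebra K C).wedgeFil (ofCoalgebra K C).coradical n := by
  set B := DualAlg K C
  induction n with
  | zero =>
    intro N hN hr c hc
    have : Subsingleton N := Module.finrank_zero_iff.1 (Nat.le_zero.1 hr)
    exact congrArg Subtype.val (Subsingleton.elim (⟨c, hc⟩ : N) 0)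
  | succ n ih =>
    intro N hN hr c hc f hf
    have hNB : Module.Finite B N := Module.Finite.of_restrictScalars_finite K B N
    -- The first alternative, in which there is no maximal submodule, occurs only for `N = 0`.
    obtain h | ⟨N', hN', -⟩ := IsCoatomic.eq_top_or_exists_le_coatom (⊥ : Submodule B N)
    · have : c = 0 := by
        have : (⟨c, hc⟩ : N) ∈ (⊥ : Submodule B N) := h ▸ Submodule.mem_top
        exact congrArg Subtype.val ((Submodule.mem_bot B).1 this)
      subst this
      rw [map_zero]
      have : Module.Finite K (⊥ : Submodule B C) :=
        inferInstanceAs (Module.Finite K (⊥ : Submodule K C))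
      refine ih ⊥ this (le_of_eq_of_le ?_ (Nat.zero_le n)) 0 (Submodule.zero_mem _)
      exact Module.finrank_zero_of_subsingleton
    · have hlt : N'.map N.subtype < N := by
        refine lt_of_le_of_ne (N.map_subtype_le N') fun he => hN'.1 ?_
        rw [eq_top_iff]
        intro x _
        have : (x : C) ∈ N'.map N.subtype := by rw [he]; exact x.2
        obtain ⟨y, hy, hyx⟩ := this
        rwa [← Subtype.ext hyx]
      have hlt' : (N'.map N.subtype).restrictScalars K < N.restrictScalars K := hlt
      have hN2 : FiniteDimensional K (N.restrictScalars K) := hN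
      refine ih (N'.map N.subtype) (Submodule.finiteDimensional_of_le hlt'.le) ?_ _ ?_
      · exact Nat.le_of_lt_succ (lt_of_lt_of_le (Submodule.finrank_lt_finrank_of_lt hlt') hr)
      · exact ⟨_, smul_mem_of_isCoatom N N' hN' f hf ⟨c, hc⟩, rfl⟩

/-- The coradical filtration exhausts the coalgebra. -/
theorem exists_mem_wedgeFil_coradical (c : C) :
    ∃ n, c ∈ (ofCoalgebra K C).wedgeFil (ofCoalgebra K C).coradical n :=
  ⟨_, mem_wedgeFil_of_finrank_le _ (Submodule.span _ {c}) (finite_span_dual c) le_rfl c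
    (Submodule.mem_span_singleton_self c)⟩

end Coradical

end

/-! ### Vector-valued convolution and conjugation by functionals. -/

noncomputable section

section DropLeft

variable {K : Type*} [Field K] {C W : Type*} [AddCommGroup C] [Module K C]
  [AddCommGroup W] [Module K W]

/-- `x ⊗ y ↦ ε(x) y`. -/
def dropLeft (ε : C →ₗ[K] K) : C ⊗[K] W →ₗ[K] W :=
  (TensorProduct.lid K W).toLinearMap ∘ₗ ε.rTensor W

@[simp] theorem dropLeft_tmul (ε : C →ₗ[K] K) (x : C) (y : W) :
    dropLeft ε (x ⊗ₜ[K] y) = ε x • y := by simp [dropLeft]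

theorem epsTensor_eq_comp_dropLeft (ε : C →ₗ[K] K) (f : W →ₗ[K] K) :
    epsTensor K ε f = f ∘ₗ dropLeft ε := TensorProduct.ext' fun x y => by simp

theorem epsTensor_eq_comp_dropRight (f : W →ₗ[K] K) (ε : C →ₗ[K] K) :
    epsTensor K f ε = f ∘ₗ dropRight K ε := TensorProduct.ext' fun x y => by simp [mul_comm]

end DropLeft

namespace CoalgData

variable {K : Type*} [Field K] {C D E W M N P : Type*} [AddCommGroup C] [Module K C]
  [AddCommGroup D] [Module K D] [AddCommGroup E] [Module K E] [AddCommGroup W] [Module K W]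
  [AddCommGroup M] [Module K M] [AddCommGroup N] [Module K N] [AddCommGroup P] [Module K P]
  {X : CoalgData K C} {Y : CoalgData K D} {Z : CoalgData K W}

/-- The convolution `c ↦ p(c₁) ⊗ q(c₂)`. -/
def convT (X : CoalgData K C) (p : C →ₗ[K] M) (q : C →ₗ[K] N) : C →ₗ[K] M ⊗[K] N :=
  TensorProduct.map p q ∘ₗ X.comul

theorem convT_apply (p : C →ₗ[K] M) (q : C →ₗ[K] N) (c : C) :
    X.convT p q c = TensorProduct.map p q (X.comul c) := rfl

theorem IsCoalgMap.convT_self {f : C →ₗ[K] D} (hf : IsCoalgMap X Y f) :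
    X.convT f f = Y.comul ∘ₗ f := hf.comul_comp.symm

theorem IsCoalgMap.convT_comp {f : C →ₗ[K] D} (hf : IsCoalgMap X Y f) (p : D →ₗ[K] M)
    (q : D →ₗ[K] N) : Y.convT p q ∘ₗ f = X.convT (p ∘ₗ f) (q ∘ₗ f) := by
  rw [convT, convT, LinearMap.comp_assoc, hf.comul_comp, TensorProduct.map_comp,
    LinearMap.comp_assoc]

theorem IsCoalgebra.convT_assoc (hX : X.IsCoalgebra) (p : C →ₗ[K] M) (q : C →ₗ[K] N)
    (r : C →ₗ[K] P) : (TensorProduct.assoc K M N P).toLinearMap ∘ₗ X.convT (X.convT p q) r =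
      X.convT p (X.convT q r) := by
  ext c
  have e := hX.rebracket
    (F := (TensorProduct.assoc K M N P).toLinearMap ∘ₗ TensorProduct.map (TensorProduct.map p q) r)
    (G := TensorProduct.map p (TensorProduct.map q r)) (fun x y z => by simp) c
  simp only [LinearMap.comp_apply, LinearMap.rTensor, LinearMap.lTensor, LinearEquiv.coe_coe,
    TensorProduct.map_map, LinearMap.comp_id] at e
  exact e

theorem IsCoalgebra.convT_convL (hX : X.IsCoalgebra) (f : C →ₗ[K] K) (p : C →ₗ[K] M)
    (q : C →ₗ[K] N) : X.convT (X.convL f p) q = X.convL f (X.convT p q) := by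
  ext c
  have e := hX.rebracket
    (F := TensorProduct.map ((TensorProduct.lid K M).toLinearMap ∘ₗ TensorProduct.map f p) q)
    (G := (TensorProduct.lid K (M ⊗[K] N)).toLinearMap ∘ₗ
      TensorProduct.map f (TensorProduct.map p q))
    (fun x y z => by simp [TensorProduct.smul_tmul']) c
  simp only [LinearMap.comp_apply, LinearMap.rTensor, LinearMap.lTensor, LinearEquiv.coe_coe,
    TensorProduct.map_map, LinearMap.comp_id, LinearMap.comp_assoc] at e
  exact e

theorem IsCoalgebra.convT_convR (hX : X.IsCoalgebra) (f : C →ₗ[K] K) (p : C →ₗ[K] M)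
    (q : C →ₗ[K] N) : X.convT p (X.convR q f) = X.convR (X.convT p q) f := by
  ext c
  have e := hX.rebracket
    (F := (TensorProduct.rid K (M ⊗[K] N)).toLinearMap ∘ₗ
      TensorProduct.map (TensorProduct.map p q) f)
    (G := TensorProduct.map p ((TensorProduct.rid K N).toLinearMap ∘ₗ TensorProduct.map q f))
    (fun x y z => by simp) c
  simp only [LinearMap.comp_apply, LinearMap.rTensor, LinearMap.lTensor, LinearEquiv.coe_coe,
    TensorProduct.map_map, LinearMap.comp_id, LinearMap.comp_assoc] at e
  exact e.symm

theorem IsCoalgebra.convT_balanced (hX : X.IsCoalgebra) (f : C →ₗ[K] K) (p : C →ₗ[K] M)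
    (q : C →ₗ[K] N) : X.convT (X.convR p f) q = X.convT p (X.convL f q) := by
  ext c
  have e := hX.rebracket
    (F := TensorProduct.map ((TensorProduct.rid K M).toLinearMap ∘ₗ TensorProduct.map p f) q)
    (G := TensorProduct.map p ((TensorProduct.lid K N).toLinearMap ∘ₗ TensorProduct.map f q))
    (fun x y z => by simp [TensorProduct.smul_tmul']) c
  simp only [LinearMap.rTensor, LinearMap.lTensor, TensorProduct.map_map, LinearMap.comp_id,
    LinearMap.comp_assoc] at e
  exact e

/-- Conjugating a coalgebra map by a convolution invertible functional gives a coalgebra map. -/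
theorem IsCoalgMap.conj (hX : X.IsCoalgebra) {p : C →ₗ[K] D} (hp : IsCoalgMap X Y p)
    {f g : C →ₗ[K] K} (h : X.IsConvInv f g) : IsCoalgMap X Y (X.convR (X.convL f p) g) where
  map_comul c := by
    have : Y.comul ∘ₗ X.convR (X.convL f p) g =
        X.convT (X.convR (X.convL f p) g) (X.convR (X.convL f p) g) := by
      -- In `(f * p * g) ⊗ (f * p * g)` the inner `g` and `f` are adjacent and cancel, leaving `f *
      -- (p ⊗ p) * g`.
      rw [comp_convR, comp_convL, hX.convT_convR, hX.convT_balanced, hX.convT_convL,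
        h.symm.cancel hX, ← hp.convT_self]
    exact congr($this c)
  map_counit c := by
    have : Y.counit ∘ₗ X.convR (X.convL f p) g = X.counit := by
      rw [comp_convR, comp_convL, hp.counit_comp, hX.convL_counit, convR_eq_convL, h.1]
    exact congr($this c)

theorem IsCoalgebra.isCoalgMap_dropLeft (hX : X.IsCoalgebra) :
    IsCoalgMap (X.tensor Z) Z (dropLeft X.counit : C ⊗[K] W →ₗ[K] W) where
  map_comul := eq_of_tmul (f := Z.comul ∘ₗ dropLeft X.counit)
    (g := TensorProduct.map (dropLeft X.counit) (dropLeft X.counit) ∘ₗ (X.tensor Z).comul)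
    (fun x y => by
      -- Writing `ε(x)` as `ε(x₁)ε(x₂)` makes both sides linear in `Δ(x)`, which can then be
      -- replaced by an arbitrary tensor.
      have h : (TensorProduct.lid K K) (TensorProduct.map X.counit X.counit (X.comul x)) =
          X.counit x := congr($(hX.counit_convL X.counit) x)
      simp only [LinearMap.comp_apply, dropLeft_tmul, tensor_comul_tmul, map_smul, ← h]
      clear h
      generalize X.comul x = s
      generalize Z.comul y = t
      induction s using TensorProduct.induction_on with
      | zero => simp
      | add a b ha hb => simp only [map_add, TensorProduct.add_tmul, add_smul, ha, hb]
      | tmul a b =>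
        induction t using TensorProduct.induction_on with
        | zero => simp
        | add a b ha hb => simp only [map_add, TensorProduct.tmul_add, smul_add, ha, hb]
        | tmul a b => simp [TensorProduct.smul_tmul', TensorProduct.tmul_smul, smul_smul,
            mul_comm])
  map_counit := eq_of_tmul (f := Z.counit ∘ₗ dropLeft X.counit)
    (g := (X.tensor Z).counit) (fun x y => by simp [tensor_counit])

theorem IsCoalgebra.isCoalgMap_dropRight (hX : X.IsCoalgebra) :
    IsCoalgMap (Z.tensor X) Z (dropRight K X.counit : W ⊗[K] C →ₗ[K] W) where
  map_comul := eq_of_tmul (f := Z.comul ∘ₗ dropRight K X.counit)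
    (g := TensorProduct.map (dropRight K X.counit) (dropRight K X.counit) ∘ₗ (Z.tensor X).comul)
    (fun y x => by
      have h : (TensorProduct.lid K K) (TensorProduct.map X.counit X.counit (X.comul x)) =
          X.counit x := congr($(hX.counit_convL X.counit) x)
      simp only [LinearMap.comp_apply, dropRight_tmul, tensor_comul_tmul, map_smul, ← h]
      clear h
      generalize X.comul x = s
      generalize Z.comul y = t
      induction s using TensorProduct.induction_on with
      | zero => simp
      | add a b ha hb => simp only [map_add, TensorProduct.tmul_add, add_smul, ha, hb]
      | tmul a b =>
        induction t using TensorProduct.induction_on with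
        | zero => simp
        | add a b ha hb => simp only [map_add, TensorProduct.add_tmul, smul_add, ha, hb]
        | tmul a b => simp [TensorProduct.smul_tmul', TensorProduct.tmul_smul, smul_smul,
            mul_comm])
  map_counit := eq_of_tmul (f := Z.counit ∘ₗ dropRight K X.counit)
    (g := (Z.tensor X).counit) (fun x y => by simp [tensor_counit, mul_comm])

theorem IsCoalgMap.lTensor {f : D →ₗ[K] E} {Y' : CoalgData K E} (hf : IsCoalgMap Y Y' f) :
    IsCoalgMap (X.tensor Y) (X.tensor Y') (f.lTensor C) := IsCoalgMap.id.tensor hf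

theorem IsCoalgMap.rTensor {f : D →ₗ[K] E} {Y' : CoalgData K E} (hf : IsCoalgMap Y Y' f) :
    IsCoalgMap (Y.tensor X) (Y'.tensor X) (f.rTensor C) := hf.tensor IsCoalgMap.id

theorem isCoalgMap_assoc_symm : IsCoalgMap (X.tensor (Y.tensor Z)) ((X.tensor Y).tensor Z)
    (TensorProduct.assoc K C D W).symm.toLinearMap := isCoalgMap_assoc.symm

theorem IsCoalgMap.mulFirst {m : C ⊗[K] C →ₗ[K] C} (hm : IsCoalgMap (X.tensor X) X m) :
    IsCoalgMap (X.tensor (X.tensor Z)) (X.tensor Z) (mulFirst K m) :=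
  hm.rTensor.comp isCoalgMap_assoc_symm

/-- Conjugation in the second tensor factor. -/
theorem conj_lTensor (hX : X.IsCoalgebra) (p : D →ₗ[K] M) (f g : D →ₗ[K] K) :
    (Y.convR (Y.convL f p) g).lTensor C =
      (X.tensor Y).convR ((X.tensor Y).convL (f ∘ₗ dropLeft X.counit) (p.lTensor C))
        (g ∘ₗ dropLeft X.counit) := by
  rw [← epsTensor_eq_comp_dropLeft, ← epsTensor_eq_comp_dropLeft, LinearMap.lTensor,
    LinearMap.lTensor, tensor_convL_map, tensor_convR_map, hX.counit_convL, hX.convR_counit]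

theorem conj_mulFirst (hZ : Z.IsCoalgebra) (m : C ⊗[K] C →ₗ[K] C)
    (f g : C ⊗[K] C →ₗ[K] K) :
    mulFirst K (W := W) ((X.tensor X).convR ((X.tensor X).convL f m) g) =
      (X.tensor (X.tensor Z)).convR ((X.tensor (X.tensor Z)).convL
        (f ∘ₗ (dropRight K Z.counit).lTensor C) (mulFirst K m))
        (g ∘ₗ (dropRight K Z.counit).lTensor C) := by
  have e : ∀ f : C ⊗[K] C →ₗ[K] K, f ∘ₗ (dropRight K Z.counit).lTensor C =
      epsTensor K f Z.counit ∘ₗ (TensorProduct.assoc K C C W).symm.toLinearMap := by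
    intro f
    ext x y z
    simp [mul_comm]
  rw [e, e, _root_.mulFirst, _root_.mulFirst, ← isCoalgMap_assoc_symm.convL_comp,
    ← isCoalgMap_assoc_symm.convR_comp, LinearMap.rTensor, LinearMap.rTensor, tensor_convL_map,
    tensor_convR_map, hZ.counit_convL, hZ.convR_counit]

/-- Functionals on different tensor factors commute. -/
theorem epsTensor_comm (hX : X.IsCoalgebra) (hY : Y.IsCoalgebra) (f : C →ₗ[K] K)
    (g : D →ₗ[K] K) : (X.tensor Y).convL (f ∘ₗ dropRight K Y.counit) (g ∘ₗ dropLeft X.counit) =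
      (X.tensor Y).convL (g ∘ₗ dropLeft X.counit) (f ∘ₗ dropRight K Y.counit) := by
  rw [← epsTensor_eq_comp_dropLeft, ← epsTensor_eq_comp_dropRight, tensor_convL_epsTensor,
    tensor_convL_epsTensor, hX.convL_counit, hX.counit_convL, hY.convL_counit, hY.counit_convL]

end CoalgData

/-! ### Transfer of the laws of a dual quasi-bialgebra along surjections -/

/-- The laws of a dual quasi-bialgebra pass to a quotient. -/
theorem QuasiLaws.transfer {K : Type*} [Field K] {D E : Type*} [AddCommGroup D] [Module K D]
    [AddCommGroup E] [Module K E]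
    {ε : D →ₗ[K] K} {X₃ : CoalgData K (D ⊗[K] (D ⊗[K] D))}
    {X₄ : CoalgData K (D ⊗[K] (D ⊗[K] (D ⊗[K] D)))}
    {m : D ⊗[K] D →ₗ[K] D} {e : D} {α : D ⊗[K] (D ⊗[K] D) →ₗ[K] K}
    (h : QuasiLaws ε X₃ X₄ m e α)
    {ε' : E →ₗ[K] K} {Y₃ : CoalgData K (E ⊗[K] (E ⊗[K] E))}
    {Y₄ : CoalgData K (E ⊗[K] (E ⊗[K] (E ⊗[K] E)))}
    {m' : E ⊗[K] E →ₗ[K] E} {e' : E} {α' : E ⊗[K] (E ⊗[K] E) →ₗ[K] K}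
    {p₁ : D →ₗ[K] E} {p₂ : D ⊗[K] D →ₗ[K] E ⊗[K] E}
    {p₃ : D ⊗[K] (D ⊗[K] D) →ₗ[K] E ⊗[K] (E ⊗[K] E)}
    {p₄ : D ⊗[K] (D ⊗[K] (D ⊗[K] D)) →ₗ[K] E ⊗[K] (E ⊗[K] (E ⊗[K] E))}
    {j : E → D} (hj1 : ∀ x, p₁ (j x) = x) (hj2 : ∀ x y, p₂ (j x ⊗ₜ j y) = x ⊗ₜ y)
    (hj3 : ∀ x y z, p₃ (j x ⊗ₜ (j y ⊗ₜ j z)) = x ⊗ₜ (y ⊗ₜ z))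
    (hje : j e' = e) (hjε : ∀ x, ε (j x) = ε' x)
    (c₃ : CoalgData.IsCoalgMap X₃ Y₃ p₃) (s₃ : Function.Surjective p₃)
    (c₄ : CoalgData.IsCoalgMap X₄ Y₄ p₄) (s₄ : Function.Surjective p₄)
    (inv : ∃ β, Y₃.IsConvInv α' β)
    (hm : m' ∘ₗ p₂ = p₁ ∘ₗ m) (hα : α' ∘ₗ p₃ = α)
    (h23l : m'.lTensor E ∘ₗ p₃ = p₂ ∘ₗ m.lTensor D)
    (h23f : mulFirst K m' ∘ₗ p₃ = p₂ ∘ₗ mulFirst K m)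
    (h34l : (m'.lTensor E).lTensor E ∘ₗ p₄ = p₃ ∘ₗ (m.lTensor D).lTensor D)
    (h34f : mulFirst K m' ∘ₗ p₄ = p₃ ∘ₗ mulFirst K m)
    (h34m : (mulFirst K m').lTensor E ∘ₗ p₄ = p₃ ∘ₗ (mulFirst K m).lTensor D)
    (hl : epsTensor K ε' α' ∘ₗ p₄ = epsTensor K ε α)
    (hr : tensorEps₃ K ε' α' ∘ₗ p₄ = tensorEps₃ K ε α) :
    QuasiLaws ε' Y₃ Y₄ m' e' α' where
  one_mul x := by
    rw [← hj1 (m' _), ← hj2 e' x, ← LinearMap.comp_apply, hm, LinearMap.comp_apply, hje, h.one_mul,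
      hj1, hj1]
  mul_one x := by
    rw [← hj1 (m' _), ← hj2 x e', ← LinearMap.comp_apply, hm, LinearMap.comp_apply, hje, h.mul_one,
      hj1, hj1]
  invertible := inv
  cocycle := by
    rw [← LinearMap.cancel_right s₄, c₄.convL_comp, c₄.convL_comp, c₄.convL_comp, hl, hr,
      LinearMap.comp_assoc, h34l, LinearMap.comp_assoc, h34f, LinearMap.comp_assoc, h34m,
      ← LinearMap.comp_assoc, hα, ← LinearMap.comp_assoc, hα, ← LinearMap.comp_assoc, hα]
    exact h.cocycle
  unital_left x y := by
    rw [← hj3, ← LinearMap.comp_apply, hα, hje, h.unital_left, hjε, hjε]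
  unital_mid x y := by
    rw [← hj3, ← LinearMap.comp_apply, hα, hje, h.unital_mid, hjε, hjε]
  unital_right x y := by
    rw [← hj3, ← LinearMap.comp_apply, hα, hje, h.unital_right, hjε, hjε]
  quasi_assoc := by
    rw [← LinearMap.cancel_right s₃, c₃.convR_comp, c₃.convL_comp, hα, LinearMap.comp_assoc, h23l,
      LinearMap.comp_assoc, h23f, ← LinearMap.comp_assoc, hm, ← LinearMap.comp_assoc, hm,
      LinearMap.comp_assoc, LinearMap.comp_assoc, ← CoalgData.comp_convR, h.quasi_assoc,
      CoalgData.comp_convL]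

/-! ### Transport of axioms, gauge transformations and twists along isomorphisms. -/

namespace DQBData

open CoalgData

variable {K : Type*} [Field K] {D E : Type*} [AddCommGroup D] [Module K D] [AddCommGroup E]
  [Module K E] {X : DQBData K D} {Y : DQBData K E}

namespace Iso

theorem mul_comp (i : X.Iso Y) : Y.mul ∘ₗ TensorProduct.map i.equiv.toLinearMap
    i.equiv.toLinearMap = i.equiv.toLinearMap ∘ₗ X.mul :=
  TensorProduct.ext' fun x y => (i.map_mul x y).symm

theorem reassoc_comp (i : X.Iso Y) : Y.reassoc ∘ₗ TensorProduct.map i.equiv.toLinearMap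
    (TensorProduct.map i.equiv.toLinearMap i.equiv.toLinearMap) = X.reassoc := by
  ext x y z
  exact i.map_reassoc x y z

theorem isDualQuasiBialgebra (i : X.Iso Y) (h : X.IsDualQuasiBialgebra) :
    Y.IsDualQuasiBialgebra := by
  set f := i.equiv.toLinearMap with hf
  have s₁ : Function.Surjective f := i.equiv.surjective
  have s₂ : Function.Surjective (TensorProduct.map f f) := TensorProduct.map_surjective s₁ s₁
  have s₃ := TensorProduct.map_surjective s₁ s₂
  have s₄ := TensorProduct.map_surjective s₁ s₃
  have c₂ := i.coalg.tensor i.coalg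
  have c₃ := i.coalg.tensor c₂
  have c₄ := i.coalg.tensor c₃
  have hε : Y.counit ∘ₗ f = X.counit := i.coalg.counit_comp
  have hε' : ∀ x, Y.counit (i.equiv x) = X.counit x := i.coalg.map_counit
  have hm := i.mul_comp
  have hm' : ∀ x y, i.equiv (X.mul (x ⊗ₜ y)) = Y.mul (i.equiv x ⊗ₜ i.equiv y) := i.map_mul
  have hα := i.reassoc_comp
  have hα' : ∀ x y z, Y.reassoc (i.equiv x ⊗ₜ (i.equiv y ⊗ₜ i.equiv z)) = X.reassoc (x ⊗ₜ (y ⊗ₜ z)) :=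
    i.map_reassoc
  have hfe : ∀ x, f (i.equiv.symm x) = x := i.equiv.apply_symm_apply
  refine ⟨i.coalg.isCoalgebra s₁ h.coalgebra, ?_, ?_, ?_⟩
  · refine c₂.of_comp s₂ ?_
    rw [hm]
    exact i.coalg.comp h.mul_coalg
  · have : LinearMap.toSpanSingleton K E Y.one = f ∘ₗ LinearMap.toSpanSingleton K D X.one := by
      ext; simp [hf, i.map_one]
    rw [this]
    exact i.coalg.comp h.one_coalg
  · refine h.laws.transfer (p₁ := f) (j := i.equiv.symm) hfe (fun x y => by simp)
      (fun x y z => by simp) (i.equiv.symm_apply_eq.2 i.map_one.symm)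
      (fun x => by rw [← hε', i.equiv.apply_symm_apply]) c₃ s₃ c₄ s₄ ?_ hm hα ?_ ?_ ?_ ?_ ?_ ?_ ?_
    · obtain ⟨β, hβ⟩ := h.laws.invertible
      set g := i.equiv.symm.toLinearMap with hg
      have hgf : ∀ x, g (f x) = x := i.equiv.symm_apply_apply
      refine ⟨β ∘ₗ TensorProduct.map g (TensorProduct.map g g), c₃.isConvInv_of_comp s₃ ?_⟩
      have : (β ∘ₗ TensorProduct.map g (TensorProduct.map g g)) ∘ₗ
          TensorProduct.map f (TensorProduct.map f f) = β := by
        ext x y z; simp [hgf]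
      rw [this, hα]
      exact hβ
    · ext x y z; simp [hm']
    · ext x y z; simp [hm']
    · ext x y z; simp [hm']
    · ext x y z; simp [hm']
    · ext x y z; simp [hm']
    · ext x y z; simp [hα', hε']
    · ext x y z; simp [hα', hε']

/-- Transport of a gauge transformation along an isomorphism. -/
def gauge (i : X.Iso Y) (g : X.Gauge) : Y.Gauge where
  toFun := g.toFun ∘ₗ TensorProduct.map i.equiv.symm.toLinearMap i.equiv.symm.toLinearMap
  inv := g.inv ∘ₗ TensorProduct.map i.equiv.symm.toLinearMap i.equiv.symm.toLinearMap
  isConvInv := (i.coalg.symm.tensor i.coalg.symm).isConvInv_comp g.isConvInv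
  one_left x := by
    have : i.equiv.symm Y.one = X.one := i.equiv.symm_apply_eq.2 i.map_one.symm
    simp [this, g.one_left]
    exact i.coalg.symm.map_counit x
  one_right x := by
    have : i.equiv.symm Y.one = X.one := i.equiv.symm_apply_eq.2 i.map_one.symm
    simp [this, g.one_right]
    exact i.coalg.symm.map_counit x

theorem gauge_toFun_comp (i : X.Iso Y) (g : X.Gauge) : (i.gauge g).toFun ∘ₗ
    TensorProduct.map i.equiv.toLinearMap i.equiv.toLinearMap = g.toFun := by
  ext x y; simp [gauge]

theorem gauge_inv_comp (i : X.Iso Y) (g : X.Gauge) : (i.gauge g).inv ∘ₗ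
    TensorProduct.map i.equiv.toLinearMap i.equiv.toLinearMap = g.inv := by
  ext x y; simp [gauge]

/-- Isomorphic dual quasi-bialgebras have isomorphic twists. -/
def twist (i : X.Iso Y) (g : X.Gauge) : (X.twist g).Iso (Y.twist (i.gauge g)) where
  equiv := i.equiv
  coalg := i.coalg
  map_one := i.map_one
  map_mul x y := by
    have c₂ : IsCoalgMap X.sq Y.sq _ := i.coalg.tensor i.coalg
    have : (Y.twist (i.gauge g)).mul ∘ₗ TensorProduct.map i.equiv.toLinearMap
        i.equiv.toLinearMap = i.equiv.toLinearMap ∘ₗ (X.twist g).mul := by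
      simp only [DQBData.twist, c₂.convR_comp, c₂.convL_comp, i.mul_comp, i.gauge_toFun_comp,
        i.gauge_inv_comp, comp_convR, comp_convL]
    exact congr($this (x ⊗ₜ y)).symm
  map_reassoc x y z := by
    have c₃ : IsCoalgMap X.cube Y.cube _ := i.coalg.tensor (i.coalg.tensor i.coalg)
    set f := i.equiv.toLinearMap with hf
    have hε : ∀ x, Y.counit (i.equiv x) = X.counit x := i.coalg.map_counit
    have hm : ∀ x y, Y.mul (i.equiv x ⊗ₜ i.equiv y) = i.equiv (X.mul (x ⊗ₜ y)) := fun x y => (i.map_mul x y).symm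
    have hg : ∀ x y, (i.gauge g).toFun (i.equiv x ⊗ₜ i.equiv y) = g.toFun (x ⊗ₜ y) :=
      fun x y => congr($(i.gauge_toFun_comp g) (x ⊗ₜ y))
    have hg' : ∀ x y, (i.gauge g).inv (i.equiv x ⊗ₜ i.equiv y) = g.inv (x ⊗ₜ y) :=
      fun x y => congr($(i.gauge_inv_comp g) (x ⊗ₜ y))
    have : (Y.twist (i.gauge g)).reassoc ∘ₗ TensorProduct.map f (TensorProduct.map f f) =
        (X.twist g).reassoc := by
      simp only [DQBData.twist, c₃.convL_comp]
      congr 1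
      · ext x y z; simp [hf, hε, hg]
      congr 1
      · ext x y z; simp [hf, hm, hg]
      congr 1
      · exact i.reassoc_comp
      congr 1
      · ext x y z; simp [hf, hm, hg']
      · ext x y z; simp [hf, hε, hg']
    exact congr($this (x ⊗ₜ (y ⊗ₜ z)))

end Iso

end DQBData

end

/-! ### The twist of a bialgebra is a dual quasi-bialgebra. -/

noncomputable section

namespace DQBData

open CoalgData

variable {K : Type*} [Field K] {A : Type*} [Ring A] [Bialgebra K A]

theorem isCoalgMap_mul' : IsCoalgMap ((ofCoalgebra K A).tensor (ofCoalgebra K A))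
    (ofCoalgebra K A) (LinearMap.mul' K A) where
  map_comul := eq_of_tmul (f := Coalgebra.comul ∘ₗ LinearMap.mul' K A)
    (g := TensorProduct.map (LinearMap.mul' K A) (LinearMap.mul' K A) ∘ₗ
      ((ofCoalgebra K A).tensor (ofCoalgebra K A)).comul) (fun x y => by
      simp only [LinearMap.comp_apply, LinearMap.mul'_apply, Bialgebra.comul_mul,
        tensor_comul_tmul]
      change _ = TensorProduct.map (LinearMap.mul' K A) (LinearMap.mul' K A)
        (TensorProduct.tensorTensorTensorComm K A A A A
          (Coalgebra.comul (R := K) x ⊗ₜ Coalgebra.comul (R := K) y))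
      generalize Coalgebra.comul (R := K) x = s
      generalize Coalgebra.comul (R := K) y = t
      induction s using TensorProduct.induction_on with
      | zero => simp
      | add a b ha hb => simp only [map_add, TensorProduct.add_tmul, add_mul, ha, hb]
      | tmul a b =>
        induction t using TensorProduct.induction_on with
        | zero => simp
        | add a b ha hb => simp only [map_add, TensorProduct.tmul_add, mul_add, ha, hb]
        | tmul a b => simp)
  map_counit := eq_of_tmul (f := Coalgebra.counit ∘ₗ LinearMap.mul' K A)
    (g := ((ofCoalgebra K A).tensor (ofCoalgebra K A)).counit) (fun x y => by
      simp [tensor_counit]; rfl)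

theorem isCoalgMap_one : IsCoalgMap (ofCoalgebra K K) (ofCoalgebra K A)
    (LinearMap.toSpanSingleton K A 1) where
  map_comul c := by
    simp [ofCoalgebra, Algebra.TensorProduct.one_def]
  map_counit c := by simp [ofCoalgebra]

theorem isCoalgMap_one_tmul {W : Type*} [AddCommGroup W] [Module K W] {Y : CoalgData K W} :
    IsCoalgMap Y ((ofCoalgebra K A).tensor Y) (TensorProduct.mk K A W 1) where
  map_comul y := by
    have : Coalgebra.comul (R := K) (1 : A) = 1 ⊗ₜ 1 := by
      rw [Bialgebra.comul_one, Algebra.TensorProduct.one_def]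
    simp only [TensorProduct.mk_apply, tensor_comul_tmul]
    change TensorProduct.tensorTensorTensorComm K A A W W
      (Coalgebra.comul (R := K) (1 : A) ⊗ₜ Y.comul y) = _
    rw [this]
    generalize Y.comul y = t
    induction t using TensorProduct.induction_on with
    | zero => simp
    | add a b ha hb => simp only [map_add, TensorProduct.tmul_add, ha, hb]
    | tmul a b => simp
  map_counit y := by simp [tensor_counit, ofCoalgebra]

theorem isCoalgMap_tmul_one {W : Type*} [AddCommGroup W] [Module K W] {Y : CoalgData K W} :
    IsCoalgMap Y (Y.tensor (ofCoalgebra K A)) ((TensorProduct.mk K W A).flip 1) where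
  map_comul y := by
    have : Coalgebra.comul (R := K) (1 : A) = 1 ⊗ₜ 1 := by
      rw [Bialgebra.comul_one, Algebra.TensorProduct.one_def]
    simp only [TensorProduct.mk_apply, tensor_comul_tmul, LinearMap.flip_apply]
    change TensorProduct.tensorTensorTensorComm K W W A A
      (Y.comul y ⊗ₜ Coalgebra.comul (R := K) (1 : A)) = _
    rw [this]
    generalize Y.comul y = t
    induction t using TensorProduct.induction_on with
    | zero => simp
    | add a b ha hb => simp only [map_add, TensorProduct.add_tmul, ha, hb]
    | tmul a b => simp
  map_counit y := by simp [tensor_counit, ofCoalgebra]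

theorem isCoalgebra_sq : (ofBialgebra K A).sq.IsCoalgebra :=
  isCoalgebra_ofCoalgebra.tensor isCoalgebra_ofCoalgebra

theorem isCoalgebra_cube : (ofBialgebra K A).cube.IsCoalgebra :=
  isCoalgebra_ofCoalgebra.tensor isCoalgebra_sq

theorem isCoalgebra_fourth :
    ((ofBialgebra K A).toCoalgData.tensor (ofBialgebra K A).cube).IsCoalgebra :=
  isCoalgebra_ofCoalgebra.tensor isCoalgebra_cube

theorem reassoc_ofBialgebra : (ofBialgebra K A).reassoc = (ofBialgebra K A).cube.counit := rfl

variable (g : (ofBialgebra K A).Gauge)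

/-- Restricting along the coalgebra map `x ↦ 1 ⊗ x` turns `g.inv` into a convolution inverse of the
counit, and the counit is its own inverse. -/
theorem Gauge.inv_one_left (x : A) : g.inv (1 ⊗ₜ x) = Coalgebra.counit (R := K) x := by
  have h := (isCoalgMap_one_tmul (A := A) (Y := ofCoalgebra K A)).isConvInv_comp g.isConvInv
  have e : g.toFun ∘ₗ TensorProduct.mk K A A 1 = (ofCoalgebra K A).counit :=
    LinearMap.ext g.one_left
  rw [e] at h
  have := h.unique isCoalgebra_ofCoalgebra (g' := (ofCoalgebra K A).counit)
    (isCoalgebra_ofCoalgebra.counit_convL _)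
  exact congr($this x).symm

theorem Gauge.inv_one_right (x : A) : g.inv (x ⊗ₜ 1) = Coalgebra.counit (R := K) x := by
  have h := (isCoalgMap_tmul_one (A := A) (Y := ofCoalgebra K A)).isConvInv_comp g.isConvInv
  have e : g.toFun ∘ₗ (TensorProduct.mk K A A).flip 1 = (ofCoalgebra K A).counit :=
    LinearMap.ext g.one_right
  rw [e] at h
  have := h.unique isCoalgebra_ofCoalgebra (g' := (ofCoalgebra K A).counit)
    (isCoalgebra_ofCoalgebra.counit_convL _)
  exact congr($this x).symm

/-- The multiplication of the twist of a bialgebra. -/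
theorem twist_mul : ((ofBialgebra K A).twist g).mul =
    (ofBialgebra K A).sq.convR ((ofBialgebra K A).sq.convL g.toFun (LinearMap.mul' K A)) g.inv :=
  rfl

theorem isCoalgMap_twist_mul : IsCoalgMap (ofBialgebra K A).sq (ofBialgebra K A).toCoalgData
    ((ofBialgebra K A).twist g).mul :=
  isCoalgMap_mul'.conj isCoalgebra_sq g.isConvInv

/-- Each factor is put in the form of `g` or its inverse composed with a coalgebra map, so that
invertibility and further restrictions can be treated factor by factor. -/
theorem twist_reassoc : ((ofBialgebra K A).twist g).reassoc =
    (ofBialgebra K A).cube.convL (g.toFun ∘ₗ dropLeft Coalgebra.counit)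
      ((ofBialgebra K A).cube.convL (g.toFun ∘ₗ (LinearMap.mul' K A).lTensor A)
        ((ofBialgebra K A).cube.convL (g.inv ∘ₗ mulFirst K (LinearMap.mul' K A))
          (g.inv ∘ₗ (dropRight K Coalgebra.counit).lTensor A))) := by
  rw [twist, reassoc_ofBialgebra, isCoalgebra_cube.counit_convL, epsTensor_eq_comp_dropLeft]
  rfl

theorem twist_mul_one_left (x : A) : ((ofBialgebra K A).twist g).mul (1 ⊗ₜ x) = x := by
  have c : IsCoalgMap (ofCoalgebra K A) (ofBialgebra K A).sq (TensorProduct.mk K A A 1) :=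
    isCoalgMap_one_tmul
  have e : ((ofBialgebra K A).twist g).mul ∘ₗ TensorProduct.mk K A A 1 = LinearMap.id := by
    rw [twist_mul, c.convR_comp, c.convL_comp,
      show g.toFun ∘ₗ TensorProduct.mk K A A 1 = (ofCoalgebra K A).counit from
        LinearMap.ext g.one_left,
      show g.inv ∘ₗ TensorProduct.mk K A A 1 = (ofCoalgebra K A).counit from
        LinearMap.ext g.inv_one_left,
      isCoalgebra_ofCoalgebra.convR_counit, isCoalgebra_ofCoalgebra.counit_convL]
    ext; simp
  exact congr($e x)

theorem twist_mul_one_right (x : A) : ((ofBialgebra K A).twist g).mul (x ⊗ₜ 1) = x := by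
  have c : IsCoalgMap (ofCoalgebra K A) (ofBialgebra K A).sq ((TensorProduct.mk K A A).flip 1) :=
    isCoalgMap_tmul_one
  have e : ((ofBialgebra K A).twist g).mul ∘ₗ (TensorProduct.mk K A A).flip 1 =
      LinearMap.id := by
    rw [twist_mul, c.convR_comp, c.convL_comp,
      show g.toFun ∘ₗ (TensorProduct.mk K A A).flip 1 = (ofCoalgebra K A).counit from
        LinearMap.ext g.one_right,
      show g.inv ∘ₗ (TensorProduct.mk K A A).flip 1 = (ofCoalgebra K A).counit from
        LinearMap.ext g.inv_one_right,
      isCoalgebra_ofCoalgebra.convR_counit, isCoalgebra_ofCoalgebra.counit_convL]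
    ext; simp
  exact congr($e x)

theorem isCoalgMap_mul_lTensor : IsCoalgMap (ofBialgebra K A).cube (ofBialgebra K A).sq
    ((LinearMap.mul' K A).lTensor A) := isCoalgMap_mul'.lTensor

theorem isCoalgMap_mulFirst_mul : IsCoalgMap (ofBialgebra K A).cube (ofBialgebra K A).sq
    (mulFirst K (LinearMap.mul' K A)) := isCoalgMap_mul'.mulFirst

theorem isCoalgMap_dropLeft_cube : IsCoalgMap (ofBialgebra K A).cube (ofBialgebra K A).sq
    (dropLeft Coalgebra.counit) := isCoalgebra_ofCoalgebra.isCoalgMap_dropLeft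

theorem isCoalgMap_dropRight_cube : IsCoalgMap (ofBialgebra K A).cube (ofBialgebra K A).sq
    ((dropRight K Coalgebra.counit).lTensor A) :=
  isCoalgebra_ofCoalgebra.isCoalgMap_dropRight.lTensor

/-- A functional on `A ⊗ A` with its inverse, pulled back along a coalgebra map. -/
theorem Gauge.pull {C : Type*} [AddCommGroup C] [Module K C] {X : CoalgData K C}
    {p : C →ₗ[K] A ⊗[K] A} (hp : IsCoalgMap X (ofBialgebra K A).sq p) :
    X.IsConvInv (g.toFun ∘ₗ p) (g.inv ∘ₗ p) := hp.isConvInv_comp g.isConvInv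

/-- `m'(D ⊗ m')` and `m'(m' ⊗ D)` for the twisted multiplication `m'`. -/
theorem twist_mul_lTensor : ((ofBialgebra K A).twist g).mul.lTensor A =
    (ofBialgebra K A).cube.convR ((ofBialgebra K A).cube.convL
      (g.toFun ∘ₗ dropLeft Coalgebra.counit) ((LinearMap.mul' K A).lTensor A))
      (g.inv ∘ₗ dropLeft Coalgebra.counit) :=
  conj_lTensor isCoalgebra_ofCoalgebra _ _ _

theorem twist_mulFirst {W : Type*} [AddCommGroup W] [Module K W] {Z : CoalgData K W}
    (hZ : Z.IsCoalgebra) : mulFirst K (W := W) ((ofBialgebra K A).twist g).mul =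
    ((ofCoalgebra K A).tensor ((ofCoalgebra K A).tensor Z)).convR
      (((ofCoalgebra K A).tensor ((ofCoalgebra K A).tensor Z)).convL
        (g.toFun ∘ₗ (dropRight K Z.counit).lTensor A) (mulFirst K (LinearMap.mul' K A)))
        (g.inv ∘ₗ (dropRight K Z.counit).lTensor A) :=
  conj_mulFirst hZ _ _ _

/-- Write `v₂₃`, `v₁,₂₃`, `v₁₂,₃`, `v₁₂` for `v` on the indicated (multiplied) factors, `w` for its
inverse, and `F` for the threefold product in `A`. Then `m'(A ⊗ m') = v₂₃ v₁,₂₃ F w₁,₂₃ w₂₃`, `m'(m'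
⊗ A) = v₁₂ v₁₂,₃ F w₁₂,₃ w₁₂`, and the reassociator is `v₂₃ v₁,₂₃ w₁₂,₃ w₁₂`. Both sides reduce to
`v₂₃ v₁,₂₃ F w₁₂,₃ w₁₂`. -/
theorem twist_quasi_assoc : (ofBialgebra K A).cube.convR (((ofBialgebra K A).twist g).mul ∘ₗ
      ((ofBialgebra K A).twist g).mul.lTensor A) ((ofBialgebra K A).twist g).reassoc =
    (ofBialgebra K A).cube.convL ((ofBialgebra K A).twist g).reassoc
      (((ofBialgebra K A).twist g).mul ∘ₗ mulFirst K ((ofBialgebra K A).twist g).mul) := by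
  have hC := isCoalgebra_cube (K := K) (A := A)
  have e1 : mulFirst K ((ofBialgebra K A).twist g).mul =
    (ofBialgebra K A).cube.convR ((ofBialgebra K A).cube.convL
      (g.toFun ∘ₗ (dropRight K Coalgebra.counit).lTensor A) (mulFirst K (LinearMap.mul' K A)))
      (g.inv ∘ₗ (dropRight K Coalgebra.counit).lTensor A) :=
    twist_mulFirst g isCoalgebra_ofCoalgebra
  have e2 : ((ofBialgebra K A).twist g).mul ∘ₗ mulFirst K (LinearMap.mul' K A) =
      (ofBialgebra K A).cube.convR ((ofBialgebra K A).cube.convL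
        (g.toFun ∘ₗ mulFirst K (LinearMap.mul' K A))
        (LinearMap.mul' K A ∘ₗ (LinearMap.mul' K A).lTensor A))
        (g.inv ∘ₗ mulFirst K (LinearMap.mul' K A)) := by
    rw [twist_mul, isCoalgMap_mulFirst_mul.convR_comp, isCoalgMap_mulFirst_mul.convL_comp]
    congr 2
    ext; simp [mul_assoc]
  have e3 : ((ofBialgebra K A).twist g).mul ∘ₗ (LinearMap.mul' K A).lTensor A =
      (ofBialgebra K A).cube.convR ((ofBialgebra K A).cube.convL
        (g.toFun ∘ₗ (LinearMap.mul' K A).lTensor A)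
        (LinearMap.mul' K A ∘ₗ (LinearMap.mul' K A).lTensor A))
        (g.inv ∘ₗ (LinearMap.mul' K A).lTensor A) := by
    rw [twist_mul, isCoalgMap_mul_lTensor.convR_comp, isCoalgMap_mul_lTensor.convL_comp]
  have i1 := g.pull isCoalgMap_dropLeft_cube
  have i2 := g.pull isCoalgMap_mul_lTensor
  have i3 := g.pull isCoalgMap_mulFirst_mul
  have i4 := g.pull isCoalgMap_dropRight_cube
  rw [twist_mul_lTensor, comp_convR, comp_convL, e3, e1, comp_convR, comp_convL, e2, twist_reassoc]
  generalize LinearMap.mul' K A ∘ₗ (LinearMap.mul' K A).lTensor A = F at *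
  simp only [hC.convL_assoc, hC.convR_convL, hC.convR_convR]
  rw [i1.symm.cancel hC, i2.symm.cancel hC, i4.symm.cancel hC, i3.symm.cancel hC]

/-- In the same index notation on `A^{⊗4}`, both sides cancel down to `v₃₄ v₂,₃₄ v₁,₂₃₄ w₁₂₃,₄ w₁₂,₃
w₁₂`. Inner twisted multiplications contribute conjugations by `v₃₄`, `v₁₂` and `v₂₃`. The only
commutation needed is that of `w₁₂` with `w₃₄`, which live on disjoint factors (`comm`). The
identities `f1` to `f11` match the indices arising from different routes and use associativity of
`A` and multiplicativity of its counit. -/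
theorem twist_cocycle : ((ofBialgebra K A).toCoalgData.tensor (ofBialgebra K A).cube).convL
      (((ofBialgebra K A).twist g).reassoc ∘ₗ
        (((ofBialgebra K A).twist g).mul.lTensor A).lTensor A)
      (((ofBialgebra K A).twist g).reassoc ∘ₗ mulFirst K ((ofBialgebra K A).twist g).mul) =
    ((ofBialgebra K A).toCoalgData.tensor (ofBialgebra K A).cube).convL
      (((ofBialgebra K A).toCoalgData.tensor (ofBialgebra K A).cube).convL
        (epsTensor K Coalgebra.counit ((ofBialgebra K A).twist g).reassoc)
        (((ofBialgebra K A).twist g).reassoc ∘ₗ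
          (mulFirst K ((ofBialgebra K A).twist g).mul).lTensor A))
      (tensorEps₃ K Coalgebra.counit ((ofBialgebra K A).twist g).reassoc) := by
  set X₂ := (ofBialgebra K A).sq with hX₂
  set X₃ := (ofBialgebra K A).cube with hX₃
  set X₄ := (ofBialgebra K A).toCoalgData.tensor X₃ with hX₄
  have hC : X₄.IsCoalgebra := isCoalgebra_fourth
  set ε : A →ₗ[K] K := Coalgebra.counit with hε
  set m := LinearMap.mul' K A with hm
  set α := ((ofBialgebra K A).twist g).reassoc with hα
  set v := g.toFun with hv
  set w := g.inv with hw
  have hεm : ∀ a b, ε (m (a ⊗ₜ b)) = ε a * ε b := by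
    intro a b; rw [hm, LinearMap.mul'_apply, hε, Bialgebra.counit_mul]
  have hX₂ε : ∀ a b, X₂.counit (a ⊗ₜ b) = ε a * ε b := epsTensor_tmul ε ε
  have cP : IsCoalgMap X₄ X₃ ((m.lTensor A).lTensor A) := isCoalgMap_mul_lTensor.lTensor
  have cQ : IsCoalgMap X₄ X₃ (mulFirst K m) := isCoalgMap_mul'.mulFirst
  have cR : IsCoalgMap X₄ X₃ ((mulFirst K m).lTensor A) := isCoalgMap_mulFirst_mul.lTensor
  have cD : IsCoalgMap X₄ X₃ (dropLeft ε) := isCoalgebra_ofCoalgebra.isCoalgMap_dropLeft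
  have cT : IsCoalgMap X₄ X₃ (((dropRight K ε).lTensor A).lTensor A) :=
    isCoalgMap_dropRight_cube.lTensor
  have cB : IsCoalgMap X₄ X₂ ((dropRight K X₂.counit).lTensor A) :=
    isCoalgebra_sq.isCoalgMap_dropRight.lTensor
  have h34 : (((ofBialgebra K A).twist g).mul.lTensor A).lTensor A =
      X₄.convR (X₄.convL ((v ∘ₗ dropLeft ε) ∘ₗ dropLeft ε) ((m.lTensor A).lTensor A))
        ((w ∘ₗ dropLeft ε) ∘ₗ dropLeft ε) := by
    rw [twist_mul_lTensor]
    exact conj_lTensor isCoalgebra_ofCoalgebra _ _ _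
  have h12 : mulFirst K ((ofBialgebra K A).twist g).mul =
      X₄.convR (X₄.convL (v ∘ₗ (dropRight K X₂.counit).lTensor A) (mulFirst K m))
        (w ∘ₗ (dropRight K X₂.counit).lTensor A) := twist_mulFirst g isCoalgebra_sq
  have h23 : (mulFirst K ((ofBialgebra K A).twist g).mul).lTensor A =
      X₄.convR (X₄.convL ((v ∘ₗ (dropRight K ε).lTensor A) ∘ₗ dropLeft ε)
        ((mulFirst K m).lTensor A)) ((w ∘ₗ (dropRight K ε).lTensor A) ∘ₗ dropLeft ε) := by
    rw [twist_mulFirst g isCoalgebra_ofCoalgebra]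
    exact conj_lTensor isCoalgebra_ofCoalgebra _ _ _
  have i34 : X₄.IsConvInv ((v ∘ₗ dropLeft ε) ∘ₗ dropLeft ε) ((w ∘ₗ dropLeft ε) ∘ₗ dropLeft ε) :=
    cD.isConvInv_comp (g.pull isCoalgMap_dropLeft_cube)
  have i12 : X₄.IsConvInv (v ∘ₗ (dropRight K X₂.counit).lTensor A)
      (w ∘ₗ (dropRight K X₂.counit).lTensor A) := g.pull cB
  have i23 : X₄.IsConvInv ((v ∘ₗ (dropRight K ε).lTensor A) ∘ₗ dropLeft ε)
      ((w ∘ₗ (dropRight K ε).lTensor A) ∘ₗ dropLeft ε) :=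
    cD.isConvInv_comp (g.pull isCoalgMap_dropRight_cube)
  have i12_34 : X₄.IsConvInv ((v ∘ₗ mulFirst K m) ∘ₗ (m.lTensor A).lTensor A)
      ((w ∘ₗ mulFirst K m) ∘ₗ (m.lTensor A).lTensor A) := cP.isConvInv_comp (g.pull isCoalgMap_mulFirst_mul)
  have i23_4 : X₄.IsConvInv ((v ∘ₗ mulFirst K m) ∘ₗ dropLeft ε)
      ((w ∘ₗ mulFirst K m) ∘ₗ dropLeft ε) := cD.isConvInv_comp (g.pull isCoalgMap_mulFirst_mul)
  have i1_23 : X₄.IsConvInv ((v ∘ₗ (dropRight K ε).lTensor A) ∘ₗ (mulFirst K m).lTensor A)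
      ((w ∘ₗ (dropRight K ε).lTensor A) ∘ₗ (mulFirst K m).lTensor A) :=
    cR.isConvInv_comp (g.pull isCoalgMap_dropRight_cube)
  have comm : ∀ k : A ⊗[K] (A ⊗[K] (A ⊗[K] A)) →ₗ[K] K,
      X₄.convL (w ∘ₗ (dropRight K X₂.counit).lTensor A)
        (X₄.convL ((w ∘ₗ dropLeft ε) ∘ₗ dropLeft ε) k) =
      X₄.convL ((w ∘ₗ dropLeft ε) ∘ₗ dropLeft ε)
        (X₄.convL (w ∘ₗ (dropRight K X₂.counit).lTensor A) k) := by
    intro k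
    rw [← hC.convL_assoc, ← hC.convL_assoc]
    congr 1
    have h1 : w ∘ₗ (dropRight K X₂.counit).lTensor A = (w ∘ₗ dropRight K X₂.counit) ∘ₗ
        (TensorProduct.assoc K A A (A ⊗[K] A)).symm.toLinearMap := by ext; simp
    have h2 : (w ∘ₗ dropLeft ε) ∘ₗ dropLeft ε = (w ∘ₗ dropLeft X₂.counit) ∘ₗ
        (TensorProduct.assoc K A A (A ⊗[K] A)).symm.toLinearMap := by
      ext
      simp [hX₂, DQBData.sq, tensor_counit, mul_smul, hε]
      simp [ofBialgebra, ofCoalgebra]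
    have ca : IsCoalgMap X₄ (X₂.tensor X₂)
        (TensorProduct.assoc K A A (A ⊗[K] A)).symm.toLinearMap := isCoalgMap_assoc_symm
    rw [h1, h2, ← ca.convL_comp, ← ca.convL_comp, epsTensor_comm isCoalgebra_sq isCoalgebra_sq]
  have key : ∀ {C : Type _} [AddCommGroup C] [Module K C] (Y : CoalgData K C)
      (p : C →ₗ[K] A ⊗[K] (A ⊗[K] A)), IsCoalgMap Y X₃ p → α ∘ₗ p =
      Y.convL ((v ∘ₗ dropLeft ε) ∘ₗ p) (Y.convL ((v ∘ₗ m.lTensor A) ∘ₗ p)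
        (Y.convL ((w ∘ₗ mulFirst K m) ∘ₗ p) ((w ∘ₗ (dropRight K ε).lTensor A) ∘ₗ p))) := by
    intro C _ _ Y p hp
    rw [hα, twist_reassoc, hp.convL_comp, hp.convL_comp, hp.convL_comp]
  rw [epsTensor_eq_comp_dropLeft, tensorEps₃, h34, h12, h23, comp_convR, comp_convL, comp_convR,
    comp_convL, comp_convR, comp_convL, key X₄ _ cP, key X₄ _ cQ, key X₄ _ cR, key X₄ _ cD,
    key X₄ _ cT]
  have f1 : ∀ u : A ⊗[K] A →ₗ[K] K, (u ∘ₗ (dropRight K ε).lTensor A) ∘ₗ (m.lTensor A).lTensor A =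
      u ∘ₗ (dropRight K X₂.counit).lTensor A := by
    intro u; ext; simp [hX₂ε, hεm]
  have f2 : (v ∘ₗ dropLeft ε) ∘ₗ mulFirst K m = (v ∘ₗ dropLeft ε) ∘ₗ dropLeft ε := by
    ext; simp [hεm, mul_smul]
  have f3 : (v ∘ₗ m.lTensor A) ∘ₗ mulFirst K m =
      (v ∘ₗ mulFirst K m) ∘ₗ (m.lTensor A).lTensor A := by ext; simp
  have f4 : (v ∘ₗ m.lTensor A) ∘ₗ dropLeft ε = (v ∘ₗ dropLeft ε) ∘ₗ (m.lTensor A).lTensor A := by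
    ext; simp
  have f5 : (v ∘ₗ dropLeft ε) ∘ₗ (mulFirst K m).lTensor A = (v ∘ₗ mulFirst K m) ∘ₗ dropLeft ε := by
    ext; simp
  have f6 : (v ∘ₗ m.lTensor A) ∘ₗ (mulFirst K m).lTensor A =
      (v ∘ₗ m.lTensor A) ∘ₗ (m.lTensor A).lTensor A := by ext; simp [hm, mul_assoc]
  have f7 : (w ∘ₗ mulFirst K m) ∘ₗ (mulFirst K m).lTensor A =
      (w ∘ₗ mulFirst K m) ∘ₗ mulFirst K m := by ext; simp [hm, mul_assoc]
  have f8 : (v ∘ₗ dropLeft ε) ∘ₗ ((dropRight K ε).lTensor A).lTensor A =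
      (v ∘ₗ (dropRight K ε).lTensor A) ∘ₗ dropLeft ε := by ext; simp [mul_left_comm]
  have f9 : (v ∘ₗ m.lTensor A) ∘ₗ ((dropRight K ε).lTensor A).lTensor A =
      (v ∘ₗ (dropRight K ε).lTensor A) ∘ₗ (mulFirst K m).lTensor A := by ext; simp
  have f10 : (w ∘ₗ mulFirst K m) ∘ₗ ((dropRight K ε).lTensor A).lTensor A =
      (w ∘ₗ (dropRight K ε).lTensor A) ∘ₗ mulFirst K m := by ext; simp
  have f11 : (w ∘ₗ (dropRight K ε).lTensor A) ∘ₗ ((dropRight K ε).lTensor A).lTensor A =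
      w ∘ₗ (dropRight K X₂.counit).lTensor A := by
    ext; simp [hX₂ε, mul_assoc, mul_left_comm]
  rw [f1, f2, f3, f4, f5, f6, f7, f8, f9, f10, f11]
  simp only [hC.convL_assoc, convR_eq_convL]
  rw [comm, i12.symm.cancel hC, i34.symm.cancel hC, i12_34.symm.cancel hC, i23.symm.cancel hC,
    i23_4.symm.cancel hC, i23.symm.cancel hC, i1_23.symm.cancel hC]

theorem twist_isDualQuasiBialgebra : ((ofBialgebra K A).twist g).IsDualQuasiBialgebra where
  coalgebra := isCoalgebra_ofCoalgebra
  mul_coalg := isCoalgMap_twist_mul g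
  one_coalg := isCoalgMap_one
  laws :=
    { one_mul := twist_mul_one_left g
      mul_one := twist_mul_one_right g
      invertible := by
        have hC := isCoalgebra_cube (K := K) (A := A)
        have h := (g.pull isCoalgMap_dropLeft_cube).mul hC <|
          (g.pull isCoalgMap_mul_lTensor).mul hC <|
          (g.pull isCoalgMap_mulFirst_mul).symm.mul hC (g.pull isCoalgMap_dropRight_cube).symm
        rw [twist_reassoc]
        exact ⟨_, h⟩
      cocycle := twist_cocycle g
      unital_left := fun x y => by
        have c : IsCoalgMap (ofBialgebra K A).sq (ofBialgebra K A).cube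
          (TensorProduct.mk K A (A ⊗[K] A) 1) := isCoalgMap_one_tmul
        have : ((ofBialgebra K A).twist g).reassoc ∘ₗ TensorProduct.mk K A (A ⊗[K] A) 1 =
            (ofBialgebra K A).sq.counit := by
          rw [twist_reassoc, c.convL_comp, c.convL_comp, c.convL_comp]
          have e1 : (g.toFun ∘ₗ dropLeft Coalgebra.counit) ∘ₗ
            TensorProduct.mk K A (A ⊗[K] A) 1 = g.toFun := by ext; simp
          have e2 : (g.toFun ∘ₗ (LinearMap.mul' K A).lTensor A) ∘ₗ
            TensorProduct.mk K A (A ⊗[K] A) 1 = (ofBialgebra K A).sq.counit := by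
            ext a b
            refine (g.one_left (a * b)).trans ?_
            exact isCoalgMap_mul'.map_counit (a ⊗ₜ b)
          have e3 : (g.inv ∘ₗ mulFirst K (LinearMap.mul' K A)) ∘ₗ
            TensorProduct.mk K A (A ⊗[K] A) 1 = g.inv := by ext; simp
          have e4 : (g.inv ∘ₗ (dropRight K Coalgebra.counit).lTensor A) ∘ₗ
            TensorProduct.mk K A (A ⊗[K] A) 1 = (ofBialgebra K A).sq.counit := by
            ext a b
            simp [g.inv_one_left, mul_comm]
            rfl
          rw [e1, e2, e3, e4, isCoalgebra_sq.counit_convL, isCoalgebra_sq.convL_counit,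
            g.isConvInv.1]
        exact congr($this (x ⊗ₜ y))
      unital_mid := fun x y => by
        have c : IsCoalgMap (ofBialgebra K A).sq (ofBialgebra K A).cube
          ((TensorProduct.mk K A A 1).lTensor A) := isCoalgMap_one_tmul.lTensor
        have : ((ofBialgebra K A).twist g).reassoc ∘ₗ (TensorProduct.mk K A A 1).lTensor A =
            (ofBialgebra K A).sq.counit := by
          rw [twist_reassoc, c.convL_comp, c.convL_comp, c.convL_comp]
          have e1 : (g.toFun ∘ₗ dropLeft Coalgebra.counit) ∘ₗ
              (TensorProduct.mk K A A 1).lTensor A = (ofBialgebra K A).sq.counit := by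
            ext a b
            simp
            exact congrArg _ (g.one_left b)
          have e2 : (g.toFun ∘ₗ (LinearMap.mul' K A).lTensor A) ∘ₗ
            (TensorProduct.mk K A A 1).lTensor A = g.toFun := by ext; simp
          have e3 : (g.inv ∘ₗ mulFirst K (LinearMap.mul' K A)) ∘ₗ
            (TensorProduct.mk K A A 1).lTensor A = g.inv := by ext; simp
          have e4 : (g.inv ∘ₗ (dropRight K Coalgebra.counit).lTensor A) ∘ₗ
              (TensorProduct.mk K A A 1).lTensor A = (ofBialgebra K A).sq.counit := by
            ext a b
            simp [g.inv_one_right, mul_comm]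
            rfl
          rw [e1, e2, e3, e4, isCoalgebra_sq.counit_convL, isCoalgebra_sq.convL_counit,
            g.isConvInv.1]
        exact congr($this (x ⊗ₜ y))
      unital_right := fun x y => by
        have c : IsCoalgMap (ofBialgebra K A).sq (ofBialgebra K A).cube
          (((TensorProduct.mk K A A).flip 1).lTensor A) := isCoalgMap_tmul_one.lTensor
        have : ((ofBialgebra K A).twist g).reassoc ∘ₗ
            ((TensorProduct.mk K A A).flip 1).lTensor A = (ofBialgebra K A).sq.counit := by
          rw [twist_reassoc, c.convL_comp, c.convL_comp, c.convL_comp]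
          have e1 : (g.toFun ∘ₗ dropLeft Coalgebra.counit) ∘ₗ
              ((TensorProduct.mk K A A).flip 1).lTensor A = (ofBialgebra K A).sq.counit := by
            ext a b
            simp
            exact congrArg _ (g.one_right b)
          have e2 : (g.toFun ∘ₗ (LinearMap.mul' K A).lTensor A) ∘ₗ
            ((TensorProduct.mk K A A).flip 1).lTensor A = g.toFun := by ext; simp
          have e3 : (g.inv ∘ₗ mulFirst K (LinearMap.mul' K A)) ∘ₗ
              ((TensorProduct.mk K A A).flip 1).lTensor A = (ofBialgebra K A).sq.counit := by
            ext a b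
            refine (g.inv_one_right (a * b)).trans ?_
            exact isCoalgMap_mul'.map_counit (a ⊗ₜ b)
          have e4 : (g.inv ∘ₗ (dropRight K Coalgebra.counit).lTensor A) ∘ₗ
              ((TensorProduct.mk K A A).flip 1).lTensor A = g.inv := by ext; simp
          rw [e1, e2, e3, e4, isCoalgebra_sq.counit_convL, isCoalgebra_sq.counit_convL,
            g.isConvInv.1]
        exact congr($this (x ⊗ₜ y))
      quasi_assoc := twist_quasi_assoc g }

/-- A bialgebra is its own twist by the trivial gauge transformation `ε ⊗ ε`, so the axioms are a
special case of those for twists. -/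
theorem ofBialgebra_isDualQuasiBialgebra : (ofBialgebra K A).IsDualQuasiBialgebra where
  coalgebra := isCoalgebra_ofCoalgebra
  mul_coalg := isCoalgMap_mul'
  one_coalg := isCoalgMap_one
  laws := by
    let g : (ofBialgebra K A).Gauge :=
      { toFun := (ofBialgebra K A).sq.counit
        inv := (ofBialgebra K A).sq.counit
        isConvInv := isCoalgebra_sq.isConvInv_counit
        one_left := fun x => by
          refine (epsTensor_tmul _ _ _ _).trans ?_
          simp [ofBialgebra, ofCoalgebra]
        one_right := fun x => by
          refine (epsTensor_tmul _ _ _ _).trans ?_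
          simp [ofBialgebra, ofCoalgebra] }
    have h := (twist_isDualQuasiBialgebra g).laws
    have h1 : ((ofBialgebra K A).twist g).mul = (ofBialgebra K A).mul := by
      rw [twist_mul]
      change (ofBialgebra K A).sq.convR ((ofBialgebra K A).sq.convL _ _)
        (ofBialgebra K A).sq.counit = _
      rw [isCoalgebra_sq.convR_counit]
      exact isCoalgebra_sq.counit_convL _
    have h2 : ((ofBialgebra K A).twist g).reassoc = (ofBialgebra K A).reassoc := by
      have e1 := isCoalgMap_dropLeft_cube (K := K) (A := A) |>.counit_comp
      have e2 := isCoalgMap_mul_lTensor (K := K) (A := A) |>.counit_comp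
      have e3 := isCoalgMap_mulFirst_mul (K := K) (A := A) |>.counit_comp
      have e4 := isCoalgMap_dropRight_cube (K := K) (A := A) |>.counit_comp
      rw [twist_reassoc]
      change (ofBialgebra K A).cube.convL ((ofBialgebra K A).sq.counit ∘ₗ _)
        ((ofBialgebra K A).cube.convL ((ofBialgebra K A).sq.counit ∘ₗ _)
        ((ofBialgebra K A).cube.convL ((ofBialgebra K A).sq.counit ∘ₗ _)
        ((ofBialgebra K A).sq.counit ∘ₗ _))) = _
      rw [e1, e2, e3, e4]
      simp only [isCoalgebra_cube.counit_convL]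
      rfl
    rw [h1, h2] at h
    exact h

/-- The inverse of a gauge transformation, as a gauge transformation of the twist. -/
def Gauge.inverse : ((ofBialgebra K A).twist g).Gauge where
  toFun := g.inv
  inv := g.toFun
  isConvInv := g.isConvInv.symm
  one_left := g.inv_one_left
  one_right := g.inv_one_right

/-- Twisting back by the inverse gauge transformation. -/
def twistInverseIso :
    (ofBialgebra K A).Iso (((ofBialgebra K A).twist g).twist g.inverse) where
  equiv := LinearEquiv.refl K A
  coalg := IsCoalgMap.id
  map_one := rfl
  map_mul x y := by
    have hC := isCoalgebra_sq (K := K) (A := A)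
    have : (((ofBialgebra K A).twist g).twist g.inverse).mul = LinearMap.mul' K A := by
      change (ofBialgebra K A).sq.convR ((ofBialgebra K A).sq.convL g.inv
        ((ofBialgebra K A).sq.convR ((ofBialgebra K A).sq.convL g.toFun (LinearMap.mul' K A))
          g.inv)) g.toFun = _
      simp only [hC.convR_convL, hC.convR_convR, g.isConvInv.symm.cancel hC]
      rw [g.isConvInv.2, hC.convR_counit]
    exact congr($this (x ⊗ₜ y)).symm
  map_reassoc x y z := by
    have hC := isCoalgebra_cube (K := K) (A := A)
    have i1 := g.pull isCoalgMap_dropLeft_cube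
    have i2 := g.pull isCoalgMap_mul_lTensor
    have i3 := g.pull isCoalgMap_mulFirst_mul
    have i4 := g.pull isCoalgMap_dropRight_cube
    have e1 : mulFirst K ((ofBialgebra K A).twist g).mul =
      (ofBialgebra K A).cube.convR ((ofBialgebra K A).cube.convL
        (g.toFun ∘ₗ (dropRight K Coalgebra.counit).lTensor A) (mulFirst K (LinearMap.mul' K A)))
        (g.inv ∘ₗ (dropRight K Coalgebra.counit).lTensor A) :=
      twist_mulFirst g isCoalgebra_ofCoalgebra
    have : (((ofBialgebra K A).twist g).twist g.inverse).reassoc =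
        (ofBialgebra K A).cube.counit := by
      change (ofBialgebra K A).cube.convL (epsTensor K Coalgebra.counit g.inv)
        ((ofBialgebra K A).cube.convL (g.inv ∘ₗ ((ofBialgebra K A).twist g).mul.lTensor A)
        ((ofBialgebra K A).cube.convL ((ofBialgebra K A).twist g).reassoc
        ((ofBialgebra K A).cube.convL (g.toFun ∘ₗ mulFirst K ((ofBialgebra K A).twist g).mul)
          (g.toFun ∘ₗ (dropRight K Coalgebra.counit).lTensor A)))) = _
      -- The inverse gauge meets the twisted multiplication, so its inner factors are conjugated by
      -- `v₂₃` and `v₁₂`; once these are expanded, everything cancels in adjacent pairs.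
      rw [epsTensor_eq_comp_dropLeft, twist_mul_lTensor, e1, twist_reassoc, comp_convR, comp_convL,
        comp_convR, comp_convL]
      simp only [hC.convL_assoc, convR_eq_convL]
      rw [i1.symm.cancel hC, i1.symm.cancel hC, i2.symm.cancel hC, i4.symm.cancel hC,
        i3.symm.cancel hC, i4.2]
    exact congr($this (x ⊗ₜ (y ⊗ₜ z)))

end DQBData

end

/-! ### Rebracketing, and `R` as a coalgebra quotient of `A`. -/

noncomputable section

namespace CoalgData

variable {K : Type*} [Field K] {C D M N M' N' P : Type*} [AddCommGroup C] [Module K C]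
  [AddCommGroup D] [Module K D] [AddCommGroup M] [Module K M] [AddCommGroup N] [Module K N]
  [AddCommGroup M'] [Module K M'] [AddCommGroup N'] [Module K N'] [AddCommGroup P] [Module K P]
  {X : CoalgData K C}

theorem map_comp_convT (f : M →ₗ[K] M') (g : N →ₗ[K] N') (p : C →ₗ[K] M) (q : C →ₗ[K] N) :
    TensorProduct.map f g ∘ₗ X.convT p q = X.convT (f ∘ₗ p) (g ∘ₗ q) := by
  rw [convT, convT, ← LinearMap.comp_assoc, TensorProduct.map_comp]

theorem map_convT (f : M →ₗ[K] M') (g : N →ₗ[K] N') (p : C →ₗ[K] M) (q : C →ₗ[K] N) (c : C) :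
    TensorProduct.map f g (X.convT p q c) = X.convT (f ∘ₗ p) (g ∘ₗ q) c :=
  congr($(map_comp_convT f g p q) c)

theorem lTensor_convT (g : N →ₗ[K] N') (p : C →ₗ[K] M) (q : C →ₗ[K] N) (c : C) :
    g.lTensor M (X.convT p q c) = X.convT p (g ∘ₗ q) c := map_convT _ _ _ _ _

theorem rTensor_convT (f : M →ₗ[K] M') (p : C →ₗ[K] M) (q : C →ₗ[K] N) (c : C) :
    f.rTensor N (X.convT p q c) = X.convT (f ∘ₗ p) q c := map_convT _ _ _ _ _

theorem IsCoalgebra.assoc_convT (hX : X.IsCoalgebra) (p : C →ₗ[K] M) (q : C →ₗ[K] N)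
    (r : C →ₗ[K] P) (c : C) : TensorProduct.assoc K M N P (X.convT (X.convT p q) r c) =
      X.convT p (X.convT q r) c := congr($(hX.convT_assoc p q r) c)

theorem IsCoalgebra.assoc_symm_convT (hX : X.IsCoalgebra) (p : C →ₗ[K] M) (q : C →ₗ[K] N)
    (r : C →ₗ[K] P) (c : C) : (TensorProduct.assoc K M N P).symm (X.convT p (X.convT q r) c) =
      X.convT (X.convT p q) r c := by
  rw [← hX.assoc_convT, LinearEquiv.symm_apply_apply]

/-- Any linear map out of a doubly nested convolution can be rebracketed. -/
theorem IsCoalgebra.convT_rebracket (hX : X.IsCoalgebra) {p : C →ₗ[K] M} {q : C →ₗ[K] N}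
    {r : C →ₗ[K] P} {F : (M ⊗[K] N) ⊗[K] P →ₗ[K] M'} {G : M ⊗[K] (N ⊗[K] P) →ₗ[K] M'}
    (h : ∀ x y z, F ((x ⊗ₜ y) ⊗ₜ z) = G (x ⊗ₜ (y ⊗ₜ z))) (c : C) :
    F (X.convT (X.convT p q) r c) = G (X.convT p (X.convT q r) c) := by
  rw [← hX.assoc_convT]
  have : F = G ∘ₗ (TensorProduct.assoc K M N P).toLinearMap := by ext x y z; exact h x y z
  rw [this]
  rfl

theorem IsCoalgebra.dropLeft_convT (hX : X.IsCoalgebra) (q : C →ₗ[K] N) (c : C) :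
    TensorProduct.lid K N (X.convT X.counit q c) = q c := congr($(hX.counit_convL q) c)

theorem IsCoalgebra.dropRight_convT (hX : X.IsCoalgebra) (q : C →ₗ[K] N) (c : C) :
    TensorProduct.rid K N (X.convT q X.counit c) = q c := congr($(hX.convR_counit q) c)

end CoalgData

namespace SplittingDatum

open CoalgData

variable {K : Type u} [Field K] {A : Type w} [Ring A] [Bialgebra K A]
  {H : Type v} [Ring H] [HopfAlgebra K H] (S : SplittingDatum K A H)

theorem τ_coe (r : S.R) : S.τ r = r := Subtype.ext (S.τA_of_mem r.2)

theorem τ_surjective : Function.Surjective S.τ := fun r => ⟨r, S.τ_coe r⟩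

theorem τ_mul_σ (x : A) (h : H) : S.τ (x * S.σL h) = Coalgebra.counit (R := K) h • S.τ x :=
  Subtype.ext (S.τA_mul_σ x h)

theorem isCoalgMap_σ : IsCoalgMap (ofCoalgebra K H) (ofCoalgebra K A) S.σL where
  map_comul h := (S.map_σ_comul h).symm
  map_counit h := CoalgHomClass.counit_comp_apply S.σ h

theorem isCoalgMap_π : IsCoalgMap (ofCoalgebra K A) (ofCoalgebra K H) S.πL where
  map_comul h := (S.map_π_comul h).symm
  map_counit h := CoalgHomClass.counit_comp_apply S.π h

theorem counit_σ (h : H) : Coalgebra.counit (R := K) (S.σL h) = Coalgebra.counit (R := K) h :=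
  S.isCoalgMap_σ.map_counit h

theorem counit_π (a : A) : Coalgebra.counit (R := K) (S.πL a) = Coalgebra.counit (R := K) a :=
  S.isCoalgMap_π.map_counit a

/-- A map `F` on `A` which is compatible with right multiplication by `σ(h)` is determined by
its restriction to `R`. -/
theorem eq_of_mul_σ {M : Type*} [AddCommGroup M] [Module K M] {F : A →ₗ[K] M}
    {G : M ⊗[K] H →ₗ[K] M} (hF : ∀ x h, F (x * S.σL h) = G (F x ⊗ₜ h)) (a : A) :
    G ((ofCoalgebra K A).convT (F ∘ₗ S.R.subtype ∘ₗ S.τ) S.πL a) = F a := by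
  conv_rhs => rw [← S.sum_τA a]
  rw [convT_apply]
  exact eq_of_tmul (f := G ∘ₗ TensorProduct.map (F ∘ₗ S.R.subtype ∘ₗ S.τ) S.πL)
    (g := F ∘ₗ LinearMap.mul' K A ∘ₗ TensorProduct.map S.τA (S.σL ∘ₗ S.πL))
    (fun x y => by simp [hF]; rfl) _

/-- A map `F` on `A` with `F(x σ(h)) = F(x) ε(h)` factors through `τ`. -/
theorem comp_τ {M : Type*} [AddCommGroup M] [Module K M] {F : A →ₗ[K] M}
    (hF : ∀ x h, F (x * S.σL h) = Coalgebra.counit (R := K) h • F x) (a : A) :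
    F (S.τ a) = F a := by
  have h := S.eq_of_mul_σ (F := F) (G := dropRight K Coalgebra.counit)
    (fun x h => by simp [hF]) a
  rw [← h]
  have e := isCoalgebra_ofCoalgebra.dropRight_convT (F ∘ₗ S.R.subtype ∘ₗ S.τ) a
  rw [← S.isCoalgMap_π.counit_comp, ← lTensor_convT] at e
  exact e.symm

/-- In `Δ(xσ(h)) = x₁σ(h₁) ⊗ x₂σ(h₂)` the map `g` turns `h₂` into `ε(h₂)`, so all of `h` is carried
by the first leg. -/
theorem map_comul_mul_σ {M N : Type*} [AddCommGroup M] [Module K M] [AddCommGroup N] [Module K N]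
    {f : A →ₗ[K] M} {g : A →ₗ[K] N} {f' : M ⊗[K] H →ₗ[K] M}
    (hf : ∀ x h, f (x * S.σL h) = f' (f x ⊗ₜ h))
    (hg : ∀ x h, g (x * S.σL h) = Coalgebra.counit (R := K) h • g x) (x : A) (h : H) :
    TensorProduct.map f g (Coalgebra.comul (R := K) (x * S.σL h)) =
      f'.rTensor N ((TensorProduct.rightComm K M N H) (TensorProduct.map f g
        (Coalgebra.comul (R := K) x) ⊗ₜ h)) := by
  have e : ∀ (s : A ⊗[K] A) (t : H ⊗[K] H), TensorProduct.map f g (s * TensorProduct.map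
      S.σL S.σL t) = f'.rTensor N ((TensorProduct.rightComm K M N H) (TensorProduct.map f g s ⊗ₜ
        (dropRight K Coalgebra.counit t))) := by
    intro s t
    induction s using TensorProduct.induction_on with
    | zero => simp
    | add a b ha hb => simp only [map_add, TensorProduct.add_tmul, add_mul, ha, hb]
    | tmul a b =>
      induction t using TensorProduct.induction_on with
      | zero => simp
      | add a b ha hb => simp only [map_add, TensorProduct.tmul_add, mul_add, ha, hb]
      | tmul h k => simp [hf, hg]
  rw [Bialgebra.comul_mul, ← S.map_σ_comul, e, dropRight, LinearMap.comp_apply,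
    Coalgebra.lTensor_counit_comul]
  simp

/-- The comultiplication of `R` is `(τ ⊗ τ)Δ` evaluated on representatives in `R`. That it may be
evaluated on any representative follows from `comp_τ`, because `(τ ⊗ τ)Δ` and the counit turn right
multiplication by `σ(h)` into `ε(h)`. -/
theorem isCoalgMap_τ : IsCoalgMap (ofCoalgebra K A) S.yd.toCoalgData S.τ where
  map_comul a := by
    refine S.comp_τ (M := S.R ⊗[K] S.R) (F := TensorProduct.map S.τ S.τ ∘ₗ Coalgebra.comul) (fun x h => ?_) a
    have := S.map_comul_mul_σ (f := S.τ) (g := S.τ) (f' := dropRight K Coalgebra.counit)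
      (fun x h => by simp [S.τ_mul_σ]) S.τ_mul_σ x h
    simp only [LinearMap.comp_apply]
    rw [this]
    exact eq_of_tmul (f := (dropRight K Coalgebra.counit).rTensor S.R ∘ₗ
      (TensorProduct.rightComm K S.R S.R H).toLinearMap ∘ₗ
      (TensorProduct.mk K (S.R ⊗[K] S.R) H).flip h) (g := Coalgebra.counit (R := K) h •
        LinearMap.id) (fun x y => by simp [TensorProduct.smul_tmul']) _
  map_counit a := by
    refine S.comp_τ (F := Coalgebra.counit) (fun x h => ?_) a
    rw [Bialgebra.counit_mul, S.counit_σ, mul_comm]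
    rfl

theorem act_eq (h : H) (r : S.R) : S.yd.act (h ⊗ₜ r) = S.τ (S.σL h * r) :=
  Subtype.ext (S.adA_eq h r.2)

/-- The adjoint action on `R` is thus the one induced by left multiplication by `σ(h)` on `A`, which
is much easier to handle. -/
theorem act_τ (h : H) (a : A) : S.yd.act (h ⊗ₜ S.τ a) = S.τ (S.σL h * a) := by
  rw [act_eq]
  refine S.comp_τ (F := S.τ ∘ₗ LinearMap.mulLeft K (S.σL h)) (fun x k => ?_) a
  simp [← mul_assoc, S.τ_mul_σ]

end SplittingDatum

/-! ### Right multiplication on the `H`-leg and the coaction on `τ(a)`. -/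

section MulLeg

variable {K : Type u} [Field K] {H : Type v} [Ring H] [HopfAlgebra K H] {V W : Type*}
  [AddCommGroup V] [Module K V] [AddCommGroup W] [Module K W]

/-- `(g ⊗ v) ⊗ h ↦ g h ⊗ v`. -/
def mulLeg : (H ⊗[K] V) ⊗[K] H →ₗ[K] H ⊗[K] V :=
  (LinearMap.mul' K H).rTensor V ∘ₗ (TensorProduct.rightComm K H V H).toLinearMap

@[simp] theorem mulLeg_tmul (g h : H) (v : V) : mulLeg (K := K) ((g ⊗ₜ v) ⊗ₜ h) = (g * h) ⊗ₜ v := by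
  simp [mulLeg]

@[simp] theorem pushAct_tmul (a : H ⊗[K] W →ₗ[K] W) (x : V) (h : H) (y : W) :
    pushAct a ((x ⊗ₜ[K] h) ⊗ₜ[K] y) = x ⊗ₜ a (h ⊗ₜ y) := by
  simp [pushAct]

end MulLeg

namespace SplittingDatum

open CoalgData

variable {K : Type u} [Field K] {A : Type w} [Ring A] [Bialgebra K A]
  {H : Type v} [Ring H] [HopfAlgebra K H] (S : SplittingDatum K A H)

/-- `ρ(τ(a₁)) π(a₂) = π(a₁) ⊗ τ(a₂)`. -/
theorem coact_τ : mulLeg ∘ₗ (ofCoalgebra K A).convT (S.yd.coact ∘ₗ S.τ) S.πL =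
    (ofCoalgebra K A).convT S.πL S.τ := by
  ext a
  refine S.eq_of_mul_σ (M := H ⊗[K] S.R) (F := TensorProduct.map S.πL S.τ ∘ₗ Coalgebra.comul)
    (G := mulLeg) (fun x h => ?_) a
  exact S.map_comul_mul_σ (f' := LinearMap.mul' K H) (fun x h => by simp [S.πL_mul_σL])
    S.τ_mul_σ x h

/-- Apply the counit to the first leg of the coinvariance condition `r₁ ⊗ π(r₂) = r ⊗ 1`. -/
theorem π_coe (r : S.R) : S.πL r = Coalgebra.counit (R := K) (r : A) • 1 := by
  have h := congrArg (dropLeft Coalgebra.counit) (S.mem_R.1 r.2)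
  rw [dropLeft_tmul] at h
  rw [← h]
  have := isCoalgebra_ofCoalgebra (K := K) (C := A) |>.dropLeft_convT S.πL (r : A)
  rw [← this]
  exact eq_of_tmul (f := (TensorProduct.lid K H).toLinearMap ∘ₗ TensorProduct.map
    (ofCoalgebra K A).counit S.πL) (g := dropLeft Coalgebra.counit ∘ₗ S.πL.lTensor A)
    (fun x y => by simp; rfl) _

end SplittingDatum

end

/-! ### Module coalgebras and the Yetter-Drinfeld condition. -/

noncomputable section

section ModuleCoalgebra

open CoalgData

variable {K : Type u} [Field K] {H : Type v} [Ring H] [HopfAlgebra K H] {V W V' W' : Type*}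
  [AddCommGroup V] [Module K V] [AddCommGroup W] [Module K W]
  [AddCommGroup V'] [Module K V'] [AddCommGroup W'] [Module K W']

/-- The orbit map `h ↦ h w`. -/
def orbit (a : H ⊗[K] W →ₗ[K] W) (w : W) : H →ₗ[K] W := a ∘ₗ (TensorProduct.mk K H W).flip w

@[simp] theorem orbit_apply (a : H ⊗[K] W →ₗ[K] W) (w : W) (h : H) : orbit a w h = a (h ⊗ₜ w) :=
  rfl

theorem tensorAct_tmul (aV : H ⊗[K] V →ₗ[K] V) (aW : H ⊗[K] W →ₗ[K] W) (h : H) (x : V) (y : W) :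
    tensorAct aV aW (h ⊗ₜ (x ⊗ₜ y)) =
      (ofCoalgebra K H).convT (orbit aV x) (orbit aW y) h := by
  simp only [tensorAct, LinearMap.comp_apply, LinearMap.rTensor_tmul, convT_apply]
  exact eq_of_tmul (f := TensorProduct.map aV aW ∘ₗ
    (TensorProduct.tensorTensorTensorComm K H H V W).toLinearMap ∘ₗ
      (TensorProduct.mk K (H ⊗[K] H) (V ⊗[K] W)).flip (x ⊗ₜ y))
    (g := TensorProduct.map (orbit aV x) (orbit aW y)) (fun a b => by simp) _

theorem orbit_tensorAct (aV : H ⊗[K] V →ₗ[K] V) (aW : H ⊗[K] W →ₗ[K] W) (x : V) (y : W) :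
    orbit (tensorAct aV aW) (x ⊗ₜ y) = (ofCoalgebra K H).convT (orbit aV x) (orbit aW y) :=
  LinearMap.ext fun h => tensorAct_tmul aV aW h x y

theorem tensorAct_naturality {aV : H ⊗[K] V →ₗ[K] V} {aW : H ⊗[K] W →ₗ[K] W}
    {bV : H ⊗[K] V' →ₗ[K] V'} {bW : H ⊗[K] W' →ₗ[K] W'} {f : V →ₗ[K] V'} {g : W →ₗ[K] W'}
    (hf : ∀ h x, f (aV (h ⊗ₜ x)) = bV (h ⊗ₜ f x)) (hg : ∀ h x, g (aW (h ⊗ₜ x)) = bW (h ⊗ₜ g x))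
    (h : H) (z : V ⊗[K] W) : TensorProduct.map f g (tensorAct aV aW (h ⊗ₜ z)) =
      tensorAct bV bW (h ⊗ₜ TensorProduct.map f g z) := by
  induction z using TensorProduct.induction_on with
  | zero => simp
  | add a b ha hb => simp only [map_add, TensorProduct.tmul_add, ha, hb]
  | tmul x y =>
    rw [tensorAct_tmul, TensorProduct.map_tmul, tensorAct_tmul, map_convT]
    congr 2
    · ext h; simp [hf]
    · ext h; simp [hg]

/-- A coalgebra `W` with an `H`-module structure whose structure maps are `H`-linear. -/
structure IsModuleCoalgebra (Y : CoalgData K W) (a : H ⊗[K] W →ₗ[K] W) : Prop where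
  coalgebra : Y.IsCoalgebra
  one_act : ∀ x, a (1 ⊗ₜ x) = x
  mul_act : ∀ g h x, a ((g * h) ⊗ₜ x) = a (g ⊗ₜ a (h ⊗ₜ x))
  comul_act : ∀ h x, Y.comul (a (h ⊗ₜ x)) = tensorAct a a (h ⊗ₜ Y.comul x)
  counit_act : ∀ h x, Y.counit (a (h ⊗ₜ x)) = Coalgebra.counit (R := K) h * Y.counit x

variable {Y : CoalgData K W} {a : H ⊗[K] W →ₗ[K] W}

theorem IsModuleCoalgebra.convT_act (hW : IsModuleCoalgebra Y a) {bV : H ⊗[K] V →ₗ[K] V}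
    {bV' : H ⊗[K] V' →ₗ[K] V'} {f : W →ₗ[K] V} {g : W →ₗ[K] V'}
    (hf : ∀ h x, f (a (h ⊗ₜ x)) = bV (h ⊗ₜ f x)) (hg : ∀ h x, g (a (h ⊗ₜ x)) = bV' (h ⊗ₜ g x))
    (h : H) (x : W) : Y.convT f g (a (h ⊗ₜ x)) = tensorAct bV bV' (h ⊗ₜ Y.convT f g x) := by
  rw [convT_apply, hW.comul_act, tensorAct_naturality hf hg, convT_apply]

theorem tensorAct_one {aV : H ⊗[K] V →ₗ[K] V} {aW : H ⊗[K] W →ₗ[K] W}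
    (hV : ∀ x, aV (1 ⊗ₜ x) = x) (hW : ∀ x, aW (1 ⊗ₜ x) = x) (z : V ⊗[K] W) :
    tensorAct aV aW (1 ⊗ₜ z) = z := by
  induction z using TensorProduct.induction_on with
  | zero => simp
  | add a b ha hb => simp only [map_add, TensorProduct.tmul_add, ha, hb]
  | tmul x y => simp [tensorAct, hV, hW, Algebra.TensorProduct.one_def]

theorem tensorAct_mul {aV : H ⊗[K] V →ₗ[K] V} {aW : H ⊗[K] W →ₗ[K] W}
    (hV : ∀ g h x, aV ((g * h) ⊗ₜ x) = aV (g ⊗ₜ aV (h ⊗ₜ x)))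
    (hW : ∀ g h x, aW ((g * h) ⊗ₜ x) = aW (g ⊗ₜ aW (h ⊗ₜ x))) (g h : H) (z : V ⊗[K] W) :
    tensorAct aV aW ((g * h) ⊗ₜ z) = tensorAct aV aW (g ⊗ₜ tensorAct aV aW (h ⊗ₜ z)) := by
  induction z using TensorProduct.induction_on with
  | zero => simp
  | add a b ha hb => simp only [map_add, TensorProduct.tmul_add, ha, hb]
  | tmul x y =>
    simp only [tensorAct, LinearMap.comp_apply, LinearMap.rTensor_tmul, Bialgebra.comul_mul]
    generalize Coalgebra.comul (R := K) g = s
    generalize Coalgebra.comul (R := K) h = t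
    induction s using TensorProduct.induction_on with
    | zero => simp
    | add a b ha hb => simp only [map_add, TensorProduct.add_tmul, add_mul, ha, hb]
    | tmul g g' =>
      induction t using TensorProduct.induction_on with
      | zero => simp
      | add a b ha hb =>
        simp only [map_add, TensorProduct.add_tmul, TensorProduct.tmul_add, mul_add, ha, hb]
      | tmul h h' => simp [hV, hW]

/-- Module coalgebras pass to quotients. -/
theorem IsModuleCoalgebra.of_surjective (hW : IsModuleCoalgebra Y a) {Z : CoalgData K V}
    {b : H ⊗[K] V →ₗ[K] V} {f : W →ₗ[K] V} (hf : IsCoalgMap Y Z f)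
    (hs : Function.Surjective f) (hb : ∀ h x, f (a (h ⊗ₜ x)) = b (h ⊗ₜ f x)) :
    IsModuleCoalgebra Z b where
  coalgebra := hf.isCoalgebra hs hW.coalgebra
  one_act x := by
    obtain ⟨x, rfl⟩ := hs x
    rw [← hb, hW.one_act]
  mul_act g h x := by
    obtain ⟨x, rfl⟩ := hs x
    rw [← hb, ← hb, ← hb, hW.mul_act]
  comul_act h x := by
    obtain ⟨x, rfl⟩ := hs x
    rw [← hb, hf.map_comul, hW.comul_act, tensorAct_naturality hb hb, hf.map_comul]
  counit_act h x := by
    obtain ⟨x, rfl⟩ := hs x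
    rw [← hb, hf.map_counit, hW.counit_act, hf.map_counit]

theorem isModuleCoalgebra_self : IsModuleCoalgebra (ofCoalgebra K H) (LinearMap.mul' K H) where
  coalgebra := isCoalgebra_ofCoalgebra
  one_act x := by simp
  mul_act g h x := by simp [mul_assoc]
  comul_act h x := by
    have e : ∀ s t : H ⊗[K] H, s * t = TensorProduct.map (LinearMap.mul' K H) (LinearMap.mul' K H)
        (TensorProduct.tensorTensorTensorComm K H H H H (s ⊗ₜ t)) := by
      intro s t
      induction s using TensorProduct.induction_on with
      | zero => simp
      | add a b ha hb => simp only [map_add, TensorProduct.add_tmul, add_mul, ha, hb]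
      | tmul g g' =>
        induction t using TensorProduct.induction_on with
        | zero => simp
        | add a b ha hb =>
          simp only [map_add, TensorProduct.tmul_add, mul_add, ha, hb]
        | tmul h h' => simp
    change Coalgebra.comul (LinearMap.mul' K H (h ⊗ₜ x)) = _
    rw [LinearMap.mul'_apply, Bialgebra.comul_mul, e]
    rfl
  counit_act h x := by
    change Coalgebra.counit (LinearMap.mul' K H (h ⊗ₜ x)) = _
    rw [LinearMap.mul'_apply, Bialgebra.counit_mul]
    rfl

/-- The action on the first factor of a tensor product. -/
def actFirst (a : H ⊗[K] W →ₗ[K] W) : H ⊗[K] (W ⊗[K] V) →ₗ[K] W ⊗[K] V :=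
  a.rTensor V ∘ₗ (TensorProduct.assoc K H W V).symm.toLinearMap

@[simp] theorem actFirst_tmul (a : H ⊗[K] W →ₗ[K] W) (h : H) (x : W) (y : V) :
    actFirst a (h ⊗ₜ (x ⊗ₜ[K] y)) = a (h ⊗ₜ x) ⊗ₜ y := by simp [actFirst]

theorem IsModuleCoalgebra.tensor (hW : IsModuleCoalgebra Y a) {Z : CoalgData K V}
    (hZ : Z.IsCoalgebra) : IsModuleCoalgebra (Y.tensor Z) (actFirst a) where
  coalgebra := hW.coalgebra.tensor hZ
  one_act := eq_of_tmul (f := actFirst a ∘ₗ TensorProduct.mk K H _ 1) (g := LinearMap.id)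
    fun x y => by simp [hW.one_act]
  mul_act g h := eq_of_tmul (f := actFirst a ∘ₗ TensorProduct.mk K H _ (g * h))
    (g := actFirst a ∘ₗ TensorProduct.mk K H _ g ∘ₗ actFirst a ∘ₗ TensorProduct.mk K H _ h)
    fun x y => by simp [hW.mul_act]
  comul_act h := eq_of_tmul (f := (Y.tensor Z).comul ∘ₗ actFirst a ∘ₗ TensorProduct.mk K H _ h)
    (g := tensorAct (actFirst a) (actFirst a) ∘ₗ TensorProduct.mk K H _ h ∘ₗ (Y.tensor Z).comul)
    fun x y => by
      simp only [LinearMap.comp_apply, TensorProduct.mk_apply, actFirst_tmul, tensor_comul_tmul,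
        hW.comul_act, tensorAct, LinearMap.rTensor_tmul]
      generalize Coalgebra.comul (R := K) h = r
      generalize Y.comul x = s
      generalize Z.comul y = t
      induction r using TensorProduct.induction_on with
      | zero => simp
      | add a b ha hb => simp only [map_add, TensorProduct.add_tmul, ha, hb]
      | tmul g g' =>
        induction s using TensorProduct.induction_on with
        | zero => simp
        | add a b ha hb =>
          simp only [map_add, TensorProduct.add_tmul, TensorProduct.tmul_add, ha, hb]
        | tmul x x' =>
          induction t using TensorProduct.induction_on with
          | zero => simp
          | add a b ha hb => simp only [map_add, TensorProduct.tmul_add, ha, hb]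
          | tmul y y' => simp
  counit_act h := eq_of_tmul (f := (Y.tensor Z).counit ∘ₗ actFirst a ∘ₗ TensorProduct.mk K H _ h)
    (g := Coalgebra.counit (R := K) h • (Y.tensor Z).counit)
    fun x y => by simp [tensor_counit, hW.counit_act, mul_assoc]

/-- The compatibility `ρ(h₁ w) h₂ = h₁ w₋₁ ⊗ h₂ w₀` of an action and a coaction of a bialgebra. -/
def IsYDCompatible (a : H ⊗[K] W →ₗ[K] W) (c : W →ₗ[K] H ⊗[K] W) : Prop :=
  ∀ (w : W) (h : H), mulLeg ((ofCoalgebra K H).convT (c ∘ₗ orbit a w) LinearMap.id h) =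
    tensorAct (LinearMap.mul' K H) a (h ⊗ₜ c w)

/-- The left side is `p(h₁)h₂S(h₃)`, with the multiplication in the `H`-leg; coassociativity
collapses `h₂S(h₃)` to the counit. -/
theorem mulLeg_antipode (p : H →ₗ[K] H ⊗[K] W) (h : H) :
    mulLeg ((HopfAlgebraStruct.antipode K).lTensor _
      ((ofCoalgebra K H).convT (mulLeg ∘ₗ (ofCoalgebra K H).convT p LinearMap.id)
        LinearMap.id h)) = p h := by
  have h1 := isCoalgebra_ofCoalgebra (K := K) (C := H) |>.convT_rebracket (p := p)
    (q := LinearMap.id) (r := LinearMap.id)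
    (F := mulLeg ∘ₗ (HopfAlgebraStruct.antipode K).lTensor _ ∘ₗ mulLeg.rTensor H)
    (G := mulLeg ∘ₗ (LinearMap.mul' K H ∘ₗ (HopfAlgebraStruct.antipode K).lTensor H).lTensor
      (H ⊗[K] W)) (fun x y z => by
        induction x using TensorProduct.induction_on with
        | zero => simp
        | add a b ha hb => simp only [map_add, TensorProduct.add_tmul, ha, hb]
        | tmul x w => simp [mul_assoc]) h
  have e := rTensor_convT (X := ofCoalgebra K H) (mulLeg (K := K) (H := H) (V := W))
    ((ofCoalgebra K H).convT p LinearMap.id) LinearMap.id h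
  rw [← e]
  refine h1.trans ?_
  simp only [LinearMap.comp_apply, lTensor_convT]
  have h2 : (LinearMap.mul' K H ∘ₗ (HopfAlgebraStruct.antipode K).lTensor H) ∘ₗ
      (ofCoalgebra K H).convT LinearMap.id LinearMap.id = Algebra.linearMap K H ∘ₗ
        Coalgebra.counit := by
    ext h
    simp only [LinearMap.comp_apply, convT_apply, TensorProduct.map_id, LinearMap.id_apply]
    exact HopfAlgebra.mul_antipode_lTensor_comul_apply h
  rw [h2]
  have h3 := isCoalgebra_ofCoalgebra (K := K) (C := H) |>.dropRight_convT p h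
  rw [← lTensor_convT, ← LinearMap.comp_apply]
  refine Eq.trans ?_ h3
  exact eq_of_tmul (f := mulLeg ∘ₗ (Algebra.linearMap K H).lTensor (H ⊗[K] W))
    (g := (TensorProduct.rid K (H ⊗[K] W)).toLinearMap) (fun x y => by
      induction x using TensorProduct.induction_on with
      | zero => simp
      | add a b ha hb => simp only [map_add, TensorProduct.add_tmul, ha, hb]
      | tmul x w =>
        simp [Algebra.algebraMap_eq_smul_one, TensorProduct.smul_tmul']) _

/-- The antipode-free compatibility is the form that passes to quotients and tensor products.
Multiplying it by `S` of a further coproduct leg recovers `ρ(hx) = h₁x₋₁S(h₃) ⊗ h₂x₀`. -/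
theorem IsYDCompatible.ydTwist_eq {c : W →ₗ[K] H ⊗[K] W} (hc : IsYDCompatible a c)
    (z : H ⊗[K] W) : c (a z) = ydTwist a c z := by
  refine eq_of_tmul (f := c ∘ₗ a) (g := ydTwist a c) (fun h w => ?_) z
  have e : mulLeg ∘ₗ (ofCoalgebra K H).convT (c ∘ₗ orbit a w) LinearMap.id =
      orbit (tensorAct (LinearMap.mul' K H) a) (c w) := LinearMap.ext (hc w)
  have h1 := mulLeg_antipode (c ∘ₗ orbit a w) h
  rw [e] at h1
  refine h1.symm.trans ?_
  rw [ydTwist, LinearMap.comp_apply, LinearMap.comp_apply, TensorProduct.map_tmul]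
  generalize c w = t
  induction t using TensorProduct.induction_on with
  | zero =>
    have : orbit (tensorAct (LinearMap.mul' K H) a) (0 : H ⊗[K] W) = 0 := by ext; simp
    simp [this, convT_apply]
  | add x y hx hy =>
    have : orbit (tensorAct (LinearMap.mul' K H) a) (x + y) =
      orbit (tensorAct (LinearMap.mul' K H) a) x + orbit (tensorAct (LinearMap.mul' K H) a) y := by
      ext; simp [TensorProduct.tmul_add]
    simp only [this, convT_apply, TensorProduct.map_add_left, LinearMap.add_apply, map_add,
      TensorProduct.tmul_add] at hx hy ⊢
    rw [hx, hy]
  | tmul g x =>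
    rw [orbit_tensorAct, lTensor_convT]
    simp only [convT_apply]
    simp only [LinearMap.comp_apply, LinearEquiv.coe_coe]
    change _ = (TensorProduct.map _ a ∘ₗ (TensorProduct.tensorTensorTensorComm K (H ⊗[K] H) H H W).toLinearMap ∘ₗ
      (TensorProduct.mk K _ (H ⊗[K] W)).flip (g ⊗ₜ x) ∘ₗ
      (TensorProduct.rightComm K H H H).toLinearMap)
      ((Coalgebra.comul (R := K) (A := H)).rTensor H (Coalgebra.comul (R := K) h))
    refine Eq.trans ?_ (eq_of_tmul (f := mulLeg ∘ₗ TensorProduct.map (TensorProduct.map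
      (orbit (LinearMap.mul' K H) g) (orbit a x)) (HopfAlgebraStruct.antipode K)) (fun s k => ?_) _)
    · exact eq_of_tmul (f := mulLeg ∘ₗ TensorProduct.map ((ofCoalgebra K H).convT
        (orbit (LinearMap.mul' K H) g) (orbit a x)) (HopfAlgebraStruct.antipode K ∘ₗ LinearMap.id))
        (g := mulLeg ∘ₗ TensorProduct.map (TensorProduct.map
      (orbit (LinearMap.mul' K H) g) (orbit a x)) (HopfAlgebraStruct.antipode K) ∘ₗ
        (Coalgebra.comul (R := K) (A := H)).rTensor H) (fun p q => by simp [convT_apply]; rfl) _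
    · induction s using TensorProduct.induction_on with
      | zero => simp
      | add a b ha hb => simp only [map_add, TensorProduct.add_tmul, ha, hb]
      | tmul p q => simp

theorem tensorCoact_tmul (cV : V →ₗ[K] H ⊗[K] V) (cW : W →ₗ[K] H ⊗[K] W) (x : V) (y : W) :
    tensorCoact cV cW (x ⊗ₜ y) = (LinearMap.mul' K H).rTensor (V ⊗[K] W)
      (TensorProduct.tensorTensorTensorComm K H V H W (cV x ⊗ₜ cW y)) := rfl

end ModuleCoalgebra

end

/-! ### `R` is a coalgebra in the Yetter-Drinfeld category. -/

noncomputable section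

namespace SplittingDatum

open CoalgData

variable {K : Type u} [Field K] {A : Type w} [Ring A] [Bialgebra K A]
  {H : Type v} [Ring H] [HopfAlgebra K H] (S : SplittingDatum K A H)

/-- The action of `H` on `A` by left multiplication. -/
def actA : H ⊗[K] A →ₗ[K] A := LinearMap.mul' K A ∘ₗ S.σL.rTensor A

@[simp] theorem actA_tmul (h : H) (a : A) : S.actA (h ⊗ₜ a) = S.σL h * a := by simp [actA]

theorem comul_σ_mul (h : H) (a : A) : Coalgebra.comul (R := K) (S.σL h * a) =
    TensorProduct.map S.σL S.σL (Coalgebra.comul (R := K) h) * Coalgebra.comul (R := K) a := by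
  rw [Bialgebra.comul_mul, S.map_σ_comul]

theorem isModuleCoalgebra_actA : IsModuleCoalgebra (ofCoalgebra K A) S.actA where
  coalgebra := isCoalgebra_ofCoalgebra
  one_act x := by simp [σL_one]
  mul_act g h x := by simp [σL_mul, mul_assoc]
  comul_act h a := by
    have e : ∀ (s : H ⊗[K] H) (t : A ⊗[K] A), TensorProduct.map S.σL S.σL s * t =
        TensorProduct.map S.actA S.actA
        (TensorProduct.tensorTensorTensorComm K H H A A (s ⊗ₜ t)) := by
      intro s t
      induction s using TensorProduct.induction_on with
      | zero => simp
      | add a b ha hb => simp only [map_add, TensorProduct.add_tmul, add_mul, ha, hb]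
      | tmul g g' =>
        induction t using TensorProduct.induction_on with
        | zero => simp
        | add a b ha hb => simp only [map_add, TensorProduct.tmul_add, mul_add, ha, hb]
        | tmul h h' => simp
    change Coalgebra.comul (S.actA (h ⊗ₜ a)) = _
    rw [actA_tmul, comul_σ_mul, e]
    rfl
  counit_act h a := by
    change Coalgebra.counit (S.actA (h ⊗ₜ a)) = _
    rw [actA_tmul, Bialgebra.counit_mul, S.counit_σ]
    rfl

theorem τ_actA (h : H) (a : A) : S.τ (S.actA (h ⊗ₜ a)) = S.yd.act (h ⊗ₜ S.τ a) := by
  rw [act_τ, actA_tmul]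

theorem π_actA (h : H) (a : A) : S.πL (S.actA (h ⊗ₜ a)) = LinearMap.mul' K H (h ⊗ₜ S.πL a) := by
  rw [actA_tmul, πL_σL_mul, LinearMap.mul'_apply]

/-- All module coalgebra axioms are inherited from left multiplication on `A` through the surjection
`τ`. -/
theorem isModuleCoalgebra_yd : IsModuleCoalgebra S.yd.toCoalgData S.yd.act :=
  S.isModuleCoalgebra_actA.of_surjective S.isCoalgMap_τ S.τ_surjective S.τ_actA

theorem lTensor_π_comul_σ_mul (h : H) (r : S.R) :
    S.πL.lTensor A (Coalgebra.comul (R := K) (S.σL h * (r : A))) =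
      (ofCoalgebra K H).convT (LinearMap.mulRight K (r : A) ∘ₗ S.σL) LinearMap.id h := by
  have e : ∀ (s : H ⊗[K] H) (t : A ⊗[K] A), S.πL.lTensor A (TensorProduct.map S.σL S.σL s * t) =
      S.σL.rTensor H s * S.πL.lTensor A t := by
    intro s t
    induction s using TensorProduct.induction_on with
    | zero => simp
    | add a b ha hb => simp only [map_add, add_mul, ha, hb]
    | tmul g g' =>
      induction t using TensorProduct.induction_on with
      | zero => simp
      | add a b ha hb => simp only [map_add, mul_add, ha, hb]
      | tmul h h' => simp [S.πL_σL_mul]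
  rw [comul_σ_mul, e, S.mem_R.1 r.2, convT_apply]
  exact eq_of_tmul (f := LinearMap.mulRight K ((r : A) ⊗ₜ[K] (1 : H)) ∘ₗ S.σL.rTensor H)
    (g := TensorProduct.map (LinearMap.mulRight K (r : A) ∘ₗ S.σL) LinearMap.id)
    (fun x y => by simp) _

/-- Evaluate `coact_τ` at `σ(h)r`. Since `r` is coinvariant, `σ(h)r` has image `σ(h₁)r ⊗ h₂` under
`(id ⊗ π)Δ`, so one side is `ρ(h₁r)h₂`; the other is `h₁r₋₁ ⊗ h₂r₀` because `(π ⊗ τ)Δ` is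
`H`-linear. -/
theorem isYDCompatible : IsYDCompatible S.yd.act S.yd.coact := by
  intro r h
  have h1 := congr($(S.coact_τ) (S.σL h * (r : A)))
  have h2 := S.isModuleCoalgebra_actA.convT_act (f := S.πL) (g := S.τ) S.π_actA S.τ_actA h (r : A)
  rw [actA_tmul] at h2
  rw [h2] at h1
  refine Eq.trans ?_ h1
  rw [LinearMap.comp_apply]
  congr 1
  have e : (ofCoalgebra K A).convT (S.yd.coact ∘ₗ S.τ) S.πL = (S.yd.coact ∘ₗ S.τ).rTensor H ∘ₗ
      S.πL.lTensor A ∘ₗ Coalgebra.comul := by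
    rw [← LinearMap.comp_assoc, LinearMap.rTensor_comp_lTensor]; rfl
  rw [e, LinearMap.comp_apply, LinearMap.comp_apply, lTensor_π_comul_σ_mul, rTensor_convT]
  congr 2
  ext h
  simp [act_eq]

/-- The second leg of `Δ(r)` already lies in `R`, so applying `τ` to it changes nothing. -/
theorem convT_τ {M N : Type*} [AddCommGroup M] [Module K M] [AddCommGroup N] [Module K N]
    (p : A →ₗ[K] M) (q : A →ₗ[K] N) (r : S.R) :
    (ofCoalgebra K A).convT p (q ∘ₗ S.R.subtype ∘ₗ S.τ) (r : A) =
      (ofCoalgebra K A).convT p q (r : A) := by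
  have e : TensorProduct.map p q (S.τA.lTensor A (Coalgebra.comul (R := K) (r : A))) =
    TensorProduct.map p (q ∘ₗ S.R.subtype ∘ₗ S.τ) (Coalgebra.comul (R := K) (r : A)) :=
    eq_of_tmul (f := TensorProduct.map p q ∘ₗ S.τA.lTensor A)
      (g := TensorProduct.map p (q ∘ₗ S.R.subtype ∘ₗ S.τ)) (fun x y => by simp; rfl) _
  rw [S.lTensor_τA] at e
  exact e.symm

theorem yd_coact_apply (r : S.R) : S.yd.coact r = (ofCoalgebra K A).convT S.πL S.τ (r : A) := rfl

/-- The part of the codiagonal coaction that only coacts on the first factor: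
`r ⊗ (g ⊗ u) ↦ r₋₁ g ⊗ (r₀ ⊗ u)`. -/
def _root_.coactFirst {V W : Type*} [AddCommGroup V] [Module K V] [AddCommGroup W] [Module K W]
    (c : V →ₗ[K] H ⊗[K] V) : V ⊗[K] (H ⊗[K] W) →ₗ[K] H ⊗[K] (V ⊗[K] W) :=
  (TensorProduct.assoc K H V W).toLinearMap ∘ₗ mulLeg.rTensor W ∘ₗ
    (TensorProduct.assoc K (H ⊗[K] V) H W).symm.toLinearMap ∘ₗ c.rTensor (H ⊗[K] W)

theorem _root_.tensorCoact_eq {V W : Type*} [AddCommGroup V] [Module K V] [AddCommGroup W] [Module K W]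
    (cV : V →ₗ[K] H ⊗[K] V) (cW : W →ₗ[K] H ⊗[K] W) :
    tensorCoact cV cW = coactFirst cV ∘ₗ cW.lTensor V := by
  refine TensorProduct.ext' fun x y => ?_
  simp only [tensorCoact, coactFirst, LinearMap.comp_apply, TensorProduct.map_tmul,
    LinearMap.rTensor_tmul, LinearMap.lTensor_tmul]
  generalize cV x = s
  generalize cW y = t
  induction s using TensorProduct.induction_on with
  | zero => simp
  | add a b ha hb => simp only [map_add, TensorProduct.add_tmul, ha, hb]
  | tmul a b =>
    induction t using TensorProduct.induction_on with
    | zero => simp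
    | add a b ha hb => simp only [map_add, TensorProduct.tmul_add, ha, hb]
    | tmul a b => simp

section Abstract

variable {V W : Type*} [AddCommGroup V] [Module K V] [AddCommGroup W] [Module K W]

theorem coactFirst_convT {c : V →ₗ[K] H ⊗[K] V} {τ : A →ₗ[K] V} {S : SplittingDatum K A H}
    (hc : mulLeg ∘ₗ (ofCoalgebra K A).convT (c ∘ₗ τ) S.πL = (ofCoalgebra K A).convT S.πL τ)
    (q : A →ₗ[K] W) (a : A) :
    coactFirst c ((ofCoalgebra K A).convT τ ((ofCoalgebra K A).convT S.πL q) a) =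
      (ofCoalgebra K A).convT S.πL ((ofCoalgebra K A).convT τ q) a := by
  simp only [coactFirst, LinearMap.comp_apply, LinearEquiv.coe_coe, rTensor_convT]
  rw [isCoalgebra_ofCoalgebra.assoc_symm_convT]
  rw [← isCoalgebra_ofCoalgebra.assoc_convT, ← hc]
  have e := rTensor_convT (X := ofCoalgebra K A) (mulLeg (K := K) (H := H) (V := V))
    ((ofCoalgebra K A).convT (c ∘ₗ τ) S.πL) q a
  rw [← e]

/-- Both sides equal `π(a₁) ⊗ τ(a₂) ⊗ τ(a₃)`: after expanding the coaction of the second factor,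
`hc` moves `π` past the first. -/
theorem tensorCoact_comul {Y : YDData K H V} {τ : A →ₗ[K] V} {S : SplittingDatum K A H}
    (hτ : IsCoalgMap (ofCoalgebra K A) Y.toCoalgData τ)
    (hc : mulLeg ∘ₗ (ofCoalgebra K A).convT (Y.coact ∘ₗ τ) S.πL = (ofCoalgebra K A).convT S.πL τ)
    {a : A} {r : V} (h1 : (ofCoalgebra K A).convT τ (Y.coact ∘ₗ τ) a =
      (ofCoalgebra K A).convT τ ((ofCoalgebra K A).convT S.πL τ) a)
    (h2 : Y.coact r = (ofCoalgebra K A).convT S.πL τ a)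
    (h3 : Y.comul r = (ofCoalgebra K A).convT τ τ a) :
    tensorCoact Y.coact Y.coact (Y.comul r) = Y.comul.lTensor H (Y.coact r) := by
  rw [tensorCoact_eq, LinearMap.comp_apply, h3, lTensor_convT, h2, lTensor_convT,
    ← hτ.convT_self, ← coactFirst_convT hc, h1]

end Abstract

theorem isYDCoalgebra : S.yd.IsYDCoalgebra where
  coalgebra := S.isModuleCoalgebra_yd.coalgebra
  one_act := S.isModuleCoalgebra_yd.one_act
  mul_act := S.isModuleCoalgebra_yd.mul_act
  coact_coassoc r := by
    rw [yd_coact_apply, rTensor_convT, lTensor_convT]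
    have e : Coalgebra.comul ∘ₗ S.πL = (ofCoalgebra K A).convT S.πL S.πL :=
      S.isCoalgMap_π.convT_self.symm
    rw [e, isCoalgebra_ofCoalgebra.assoc_convT]
    exact (S.convT_τ S.πL ((ofCoalgebra K A).convT S.πL S.τ) r).symm
  coact_counit r := by
    rw [yd_coact_apply, rTensor_convT]
    have e : Coalgebra.counit ∘ₗ S.πL = (ofCoalgebra K A).counit := S.isCoalgMap_π.counit_comp
    have h := isCoalgebra_ofCoalgebra.dropLeft_convT S.τ (r : A)
    rw [e]
    apply (TensorProduct.lid K S.R).injective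
    rw [h, S.τ_coe, TensorProduct.lid_tmul, one_smul]
  yetterDrinfeld := S.isYDCompatible.ydTwist_eq
  comul_act := S.isModuleCoalgebra_yd.comul_act
  comul_coact r := tensorCoact_comul S.isCoalgMap_τ S.coact_τ
    (S.convT_τ S.τ ((ofCoalgebra K A).convT S.πL S.τ) r) rfl rfl
  counit_act := S.isModuleCoalgebra_yd.counit_act
  counit_coact r := by
    rw [yd_coact_apply, lTensor_convT, S.isCoalgMap_τ.counit_comp]
    apply (TensorProduct.rid K H).injective
    rw [isCoalgebra_ofCoalgebra.dropRight_convT, π_coe, TensorProduct.rid_tmul]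
    rfl

end SplittingDatum

end

/-! ### Braided tensor products as quotients of `A ⊗ W`. -/

noncomputable section

namespace CoalgData

variable {K : Type*} [Field K] {C D M N M' N' : Type*} [AddCommGroup C] [Module K C]
  [AddCommGroup D] [Module K D] [AddCommGroup M] [Module K M] [AddCommGroup N] [Module K N]
  [AddCommGroup M'] [Module K M'] [AddCommGroup N'] [Module K N']
  {X : CoalgData K C} {Y : CoalgData K D}

theorem lTensor_comp_convT (g : N →ₗ[K] N') (p : C →ₗ[K] M) (q : C →ₗ[K] N) :
    g.lTensor M ∘ₗ X.convT p q = X.convT p (g ∘ₗ q) :=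
  LinearMap.ext fun c => lTensor_convT g p q c

theorem rTensor_comp_convT (f : M →ₗ[K] M') (p : C →ₗ[K] M) (q : C →ₗ[K] N) :
    f.rTensor N ∘ₗ X.convT p q = X.convT (f ∘ₗ p) q :=
  LinearMap.ext fun c => rTensor_convT f p q c

theorem IsCoalgebra.convT_four (hX : X.IsCoalgebra) (p : C →ₗ[K] M) (f : C →ₗ[K] N)
    (g : C →ₗ[K] M') (q : C →ₗ[K] N') (c : C) : X.convT (X.convT p f) (X.convT g q) c =
      (TensorProduct.assoc K M N (M' ⊗[K] N')).symm
        ((TensorProduct.assoc K N M' N').toLinearMap.lTensor M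
          (X.convT p (X.convT (X.convT f g) q) c)) := by
  rw [lTensor_convT, hX.convT_assoc, hX.assoc_symm_convT]

theorem tensor_convT_tmul (p : C ⊗[K] D →ₗ[K] M) (q : C ⊗[K] D →ₗ[K] N) (c : C) (d : D) :
    (X.tensor Y).convT p q (c ⊗ₜ d) = TensorProduct.map p q
      (TensorProduct.tensorTensorTensorComm K C C D D (X.comul c ⊗ₜ Y.comul d)) := rfl

end CoalgData

section SmashCoalgebra

open CoalgData

variable {K : Type u} [Field K] {H : Type v} [Ring H] [HopfAlgebra K H] {V : Type w} {W : Type*}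
  [AddCommGroup V] [Module K V] [AddCommGroup W] [Module K W]

/-- The braided tensor product of a coalgebra `V` in the Yetter-Drinfeld category and an
`H`-module coalgebra `W`. -/
def smashCoalg (Y : YDData K H V) (Z : CoalgData K W) (a : H ⊗[K] W →ₗ[K] W) :
    CoalgData K (V ⊗[K] W) where
  comul := braidedComul Y.comul Y.coact Z.comul a
  counit := epsTensor K Y.counit Z.counit

theorem pushAct_convT {C U : Type*} [AddCommGroup C] [Module K C] [AddCommGroup U] [Module K U]
    {X : CoalgData K C} (a : H ⊗[K] W →ₗ[K] W) (p : C →ₗ[K] U) (q : C →ₗ[K] H) (c : C) (x : W) :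
    pushAct a (X.convT p q c ⊗ₜ x) = X.convT p (orbit a x ∘ₗ q) c :=
  eq_of_tmul (f := pushAct a ∘ₗ (TensorProduct.mk K (U ⊗[K] H) W).flip x ∘ₗ
    TensorProduct.map p q) (g := TensorProduct.map p (orbit a x ∘ₗ q)) (fun y z => by simp) _

end SmashCoalgebra

namespace SplittingDatum

open CoalgData

variable {K : Type u} [Field K] {A : Type w} [Ring A] [Bialgebra K A]
  {H : Type v} [Ring H] [HopfAlgebra K H]

/-- The properties of the coalgebra `R` of coinvariants, with its projection `τ : A → R` and its
inclusion `j : R → A`. -/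
structure IsCoinvariants (S : SplittingDatum K A H) {V : Type w} [AddCommGroup V] [Module K V]
    (Y : YDData K H V) (τ : A →ₗ[K] V) (j : V →ₗ[K] A) : Prop where
  isYDCoalgebra : Y.IsYDCoalgebra
  compatible : IsYDCompatible Y.act Y.coact
  coalg : IsCoalgMap (ofCoalgebra K A) Y.toCoalgData τ
  τ_j : ∀ r, τ (j r) = r
  τ_mul_σ : ∀ x h, τ (x * S.σL h) = Coalgebra.counit (R := K) h • τ x
  τ_σ_mul : ∀ h a, τ (S.σL h * a) = Y.act (h ⊗ₜ τ a)
  coact_τ : mulLeg ∘ₗ (ofCoalgebra K A).convT (Y.coact ∘ₗ τ) S.πL =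
    (ofCoalgebra K A).convT S.πL τ
  convT_j : ∀ r, (ofCoalgebra K A).convT τ S.πL (j r) = r ⊗ₜ 1
  mul_convT : ∀ a, LinearMap.mul' K A ((ofCoalgebra K A).convT (j ∘ₗ τ) (S.σL ∘ₗ S.πL) a) = a
  j_τ_one : j (τ 1) = 1

/-- Until the final theorem, `R` enters the sequel only through these properties, and not as a
submodule of `A`. -/
theorem isCoinvariants (S : SplittingDatum K A H) :
    S.IsCoinvariants S.yd S.τ S.R.subtype where
  isYDCoalgebra := S.isYDCoalgebra
  compatible := S.isYDCompatible
  coalg := S.isCoalgMap_τ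
  τ_j := S.τ_coe
  τ_mul_σ := S.τ_mul_σ
  τ_σ_mul h a := (S.act_τ h a).symm
  coact_τ := S.coact_τ
  convT_j r := by
    have e : (ofCoalgebra K A).convT S.τ S.πL = S.τ.rTensor H ∘ₗ
      S.πL.lTensor A ∘ₗ Coalgebra.comul := by
      rw [← LinearMap.comp_assoc, LinearMap.rTensor_comp_lTensor]; rfl
    rw [e, LinearMap.comp_apply, LinearMap.comp_apply]
    have h : S.πL.lTensor A (Coalgebra.comul (R := K) (r : A)) = (r : A) ⊗ₜ 1 := S.mem_R.1 r.2
    rw [Submodule.subtype_apply, h, LinearMap.rTensor_tmul, S.τ_coe]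
  mul_convT := S.sum_τA
  j_τ_one := congrArg Subtype.val (S.τ_coe ⟨1, S.one_mem⟩)

variable (S : SplittingDatum K A H) {V : Type w} [AddCommGroup V] [Module K V]
  {W W' : Type*} [AddCommGroup W] [Module K W] [AddCommGroup W'] [Module K W']

/-- The map `A ⊗ W → R ⊗ W`, `a ⊗ x ↦ τ(a₁) ⊗ π(a₂) x`, for an `H`-module `W`. -/
def psi (τ : A →ₗ[K] V) (a : H ⊗[K] W →ₗ[K] W) : A ⊗[K] W →ₗ[K] V ⊗[K] W :=
  pushAct a ∘ₗ ((ofCoalgebra K A).convT τ S.πL).rTensor W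

variable {Y : YDData K H V} {τ : A →ₗ[K] V} {j : V →ₗ[K] A} {Z : CoalgData K W}
  {a : H ⊗[K] W →ₗ[K] W}

theorem psi_tmul (x : A) (y : W) : S.psi τ a (x ⊗ₜ y) =
    (ofCoalgebra K A).convT τ (orbit a y ∘ₗ S.πL) x := by
  rw [psi, LinearMap.comp_apply, LinearMap.rTensor_tmul, pushAct_convT]

/-- Only the `H`-linearity of `f` is needed; this is why the maps to be moved across `Ψ` are first
shown to be `H`-linear. -/
theorem psi_naturality {a' : H ⊗[K] W' →ₗ[K] W'} {f : W →ₗ[K] W'}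
    (hf : ∀ h x, f (a (h ⊗ₜ x)) = a' (h ⊗ₜ f x)) :
    f.lTensor V ∘ₗ S.psi τ a = S.psi τ a' ∘ₗ f.lTensor A := by
  refine TensorProduct.ext' fun x y => ?_
  rw [LinearMap.comp_apply, LinearMap.comp_apply, psi_tmul, LinearMap.lTensor_tmul, psi_tmul,
    lTensor_convT]
  congr 2
  ext y
  simp [hf]

variable {S}

namespace IsCoinvariants

variable (hS : S.IsCoinvariants Y τ j) (hW : IsModuleCoalgebra Z a)

include hS

theorem τ_surjective : Function.Surjective τ := fun r => ⟨j r, hS.τ_j r⟩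

/-- By coinvariance `τ(j(r)₁) ⊗ π(j(r)₂) = r ⊗ 1`, so `j` gives a section of `Ψ`. -/
theorem psi_j (hW : ∀ x, a (1 ⊗ₜ x) = x) (r : V) (y : W) :
    S.psi τ a (j r ⊗ₜ y) = r ⊗ₜ y := by
  rw [psi, LinearMap.comp_apply, LinearMap.rTensor_tmul, hS.convT_j, pushAct_tmul, hW]

theorem psi_surjective (hW : ∀ x, a (1 ⊗ₜ x) = x) : Function.Surjective (S.psi τ a) := by
  intro z
  refine ⟨j.rTensor W z, ?_⟩
  exact eq_of_tmul (f := S.psi τ a ∘ₗ j.rTensor W) (g := LinearMap.id)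
    (fun x y => by simpa using hS.psi_j hW x y) z

theorem psi_act (hW : ∀ g h x, a ((g * h) ⊗ₜ x) = a (g ⊗ₜ a (h ⊗ₜ x))) (h : H) (z : A ⊗[K] W) :
    S.psi τ a (actFirst S.actA (h ⊗ₜ z)) = tensorAct Y.act a (h ⊗ₜ S.psi τ a z) := by
  refine eq_of_tmul (f := S.psi τ a ∘ₗ actFirst S.actA ∘ₗ TensorProduct.mk K H _ h)
    (g := tensorAct Y.act a ∘ₗ TensorProduct.mk K H _ h ∘ₗ S.psi τ a) (fun x y => ?_) z
  simp only [LinearMap.comp_apply, TensorProduct.mk_apply, actFirst_tmul, psi_tmul]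
  refine S.isModuleCoalgebra_actA.convT_act (fun h a => ?_) (fun h x => ?_) h x
  · rw [actA_tmul, hS.τ_σ_mul]
  · rw [actA_tmul, LinearMap.comp_apply, πL_σL_mul, orbit_apply, hW]
    rfl

/-- `Ψ` is balanced over `H`: in `Δ(xσ(h))`, `τ` reduces `σ(h₁)` to `ε(h₁)`, while `π` releases
`h₂`, which then acts on `W`. -/
theorem psi_mul_σ (hW : ∀ g h x, a ((g * h) ⊗ₜ x) = a (g ⊗ₜ a (h ⊗ₜ x))) (x : A) (h : H) (y : W) :
    S.psi τ a ((x * S.σL h) ⊗ₜ y) = S.psi τ a (x ⊗ₜ a (h ⊗ₜ y)) := by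
  have e : ∀ (s : A ⊗[K] A) (t : H ⊗[K] H), pushAct a (TensorProduct.map τ S.πL
      (s * TensorProduct.map S.σL S.σL t) ⊗ₜ y) = pushAct a (TensorProduct.map τ S.πL s ⊗ₜ
        a (dropLeft Coalgebra.counit t ⊗ₜ y)) := by
    intro s t
    induction s using TensorProduct.induction_on with
    | zero => simp
    | add a b ha hb => simp only [map_add, TensorProduct.add_tmul, add_mul, ha, hb]
    | tmul p q =>
      induction t using TensorProduct.induction_on with
      | zero => simp
      | add a b ha hb =>
        simp only [map_add, TensorProduct.add_tmul, TensorProduct.tmul_add, mul_add, ha, hb]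
      | tmul g k =>
        simp only [Algebra.TensorProduct.tmul_mul_tmul, TensorProduct.map_tmul, hS.τ_mul_σ,
          πL_mul_σL, pushAct_tmul, hW, dropLeft_tmul, ← TensorProduct.smul_tmul', map_smul,
          TensorProduct.tmul_smul]
  have e2 : dropLeft Coalgebra.counit (Coalgebra.comul (R := K) h) = h := by
    rw [dropLeft, LinearMap.comp_apply, Coalgebra.rTensor_counit_comul]
    simp
  rw [psi, LinearMap.comp_apply, LinearMap.comp_apply, LinearMap.rTensor_tmul,
    LinearMap.rTensor_tmul, convT_apply]
  change pushAct a (TensorProduct.map τ S.πL (Coalgebra.comul (R := K) (x * S.σL h)) ⊗ₜ y) = _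
  rw [Bialgebra.comul_mul, ← S.map_σ_comul, e, e2]
  rfl

/-- The braiding sends `τ(x₁) ⊗ π(x₂)y` to `τ(x₁)₋₁π(x₂)y ⊗ τ(x₁)₀`, and `coact_τ` rewrites this as
`π(x₁)y ⊗ τ(x₂)`. On images of `Ψ` the braiding merely exchanges the roles of two coproduct legs of
`A`. -/
theorem braid_convT (hW : ∀ g h x, a ((g * h) ⊗ₜ x) = a (g ⊗ₜ a (h ⊗ₜ x))) (y : W) :
    braid Y.coact a ∘ₗ (ofCoalgebra K A).convT τ (orbit a y ∘ₗ S.πL) =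
      (ofCoalgebra K A).convT (orbit a y ∘ₗ S.πL) τ := by
  have e : braid Y.coact a ∘ₗ (orbit a y).lTensor V =
      (orbit a y).rTensor V ∘ₗ mulLeg ∘ₗ Y.coact.rTensor H := by
    refine TensorProduct.ext' fun x h => ?_
    simp only [braid, LinearMap.comp_apply, LinearMap.rTensor_tmul, LinearMap.lTensor_tmul]
    generalize Y.coact x = s
    induction s using TensorProduct.induction_on with
    | zero => simp
    | add a b ha hb => simp only [map_add, TensorProduct.add_tmul, ha, hb]
    | tmul g k => simp [hW]
  rw [← lTensor_comp_convT, ← LinearMap.comp_assoc, e, ← rTensor_comp_convT, ← hS.coact_τ,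
    ← rTensor_comp_convT]
  rfl

include hW

/-- The braided coproduct of `Ψ(x ⊗ y)` is obtained from `τ(x₁) ⊗ τ(x₂) ⊗ π(x₃)y₁ ⊗ π(x₄)y₂` by
braiding the two middle factors. By `braid_convT` the result is `τ(x₁) ⊗ π(x₂)y₁ ⊗ τ(x₃) ⊗ π(x₄)y₂`,
which is `Ψ ⊗ Ψ` applied to the unbraided coproduct. -/
theorem isCoalgMap_psi : IsCoalgMap ((ofCoalgebra K A).tensor Z) (smashCoalg Y Z a)
    (S.psi τ a) where
  map_comul z := by
    refine eq_of_tmul (f := (smashCoalg Y Z a).comul ∘ₗ S.psi τ a)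
      (g := TensorProduct.map (S.psi τ a) (S.psi τ a) ∘ₗ ((ofCoalgebra K A).tensor Z).comul)
      (fun x y => ?_) z
    set Φ := (TensorProduct.tensorTensorTensorAssoc K V W V W).symm.toLinearMap ∘ₗ
      ((braid Y.coact a).lTensor V).rTensor W ∘ₗ
      (TensorProduct.tensorTensorTensorAssoc K V V W W).toLinearMap with hΦ
    have e1 : (smashCoalg Y Z a).comul = Φ ∘ₗ TensorProduct.map Y.comul Z.comul := rfl
    have e2 : Z.comul ∘ₗ orbit a y = orbit (tensorAct a a) (Z.comul y) :=
      LinearMap.ext fun h => hW.comul_act h y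
    simp only [LinearMap.comp_apply]
    rw [psi_tmul, e1, LinearMap.comp_apply, map_convT, ← hS.coalg.convT_self,
      ← LinearMap.comp_assoc, e2, ← pushAct_convT, tensor_comul_tmul]
    refine eq_of_tmul (f := Φ ∘ₗ pushAct (tensorAct a a) ∘ₗ TensorProduct.mk K _ _
      ((ofCoalgebra K A).convT ((ofCoalgebra K A).convT τ τ) S.πL x))
      (g := TensorProduct.map (S.psi τ a) (S.psi τ a) ∘ₗ
        (TensorProduct.tensorTensorTensorComm K A A W W).toLinearMap ∘ₗ TensorProduct.mk K _ _
        ((ofCoalgebra K A).comul x)) (fun p q => ?_) (Z.comul y)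
    have e3 : ∀ t : A ⊗[K] A, TensorProduct.map (S.psi τ a) (S.psi τ a)
        (TensorProduct.tensorTensorTensorComm K A A W W (t ⊗ₜ (p ⊗ₜ q))) =
        TensorProduct.map ((ofCoalgebra K A).convT τ (orbit a p ∘ₗ S.πL))
          ((ofCoalgebra K A).convT τ (orbit a q ∘ₗ S.πL)) t :=
      eq_of_tmul (f := TensorProduct.map (S.psi τ a) (S.psi τ a) ∘ₗ
        (TensorProduct.tensorTensorTensorComm K A A W W).toLinearMap ∘ₗ
          (TensorProduct.mk K (A ⊗[K] A) _).flip (p ⊗ₜ q)) (fun b c => by simp [psi_tmul])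
    simp only [LinearMap.comp_apply, TensorProduct.mk_apply, LinearEquiv.coe_coe]
    rw [e3, ← convT_apply, pushAct_convT, orbit_tensorAct, S.isCoalgMap_π.convT_comp]
    set U := orbit a p ∘ₗ S.πL with hU
    set T := orbit a q ∘ₗ S.πL with hT
    have hA : (ofCoalgebra K A).IsCoalgebra := isCoalgebra_ofCoalgebra
    -- Both sides are written through the bracketing `x₁ ⊗ ((x₂ ⊗ x₃) ⊗ x₄)`, which isolates the
    -- middle pair to be braided.
    rw [hA.convT_four, hA.convT_four, ← hS.braid_convT hW.mul_act]
    rw [← rTensor_comp_convT, ← lTensor_convT]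
    generalize (ofCoalgebra K A).convT τ ((ofCoalgebra K A).convT
      ((ofCoalgebra K A).convT τ U) T) x = r
    have b3 : Φ ∘ₗ (TensorProduct.assoc K V V (W ⊗[K] W)).symm.toLinearMap ∘ₗ
        (TensorProduct.assoc K V W W).toLinearMap.lTensor V =
        (TensorProduct.assoc K V W (V ⊗[K] W)).symm.toLinearMap ∘ₗ
        (TensorProduct.assoc K W V W).toLinearMap.lTensor V ∘ₗ
          ((braid Y.coact a).rTensor W).lTensor V := by
      ext x y p q
      simp only [hΦ, TensorProduct.AlgebraTensorModule.curry_apply, TensorProduct.curry_apply,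
        LinearMap.restrictScalars_apply, LinearMap.comp_apply, LinearEquiv.coe_coe,
        TensorProduct.assoc_tmul, TensorProduct.assoc_symm_tmul, LinearMap.lTensor_tmul,
        LinearMap.rTensor_tmul, TensorProduct.tensorTensorTensorAssoc_tmul]
      generalize braid Y.coact a (y ⊗ₜ p) = s
      induction s using TensorProduct.induction_on with
      | zero => simp
      | add a b ha hb =>
        simp only [map_add, TensorProduct.add_tmul, TensorProduct.tmul_add, ha, hb]
      | tmul g k => simp
    exact congr($b3 r)
  map_counit z := by
    refine eq_of_tmul (f := (smashCoalg Y Z a).counit ∘ₗ S.psi τ a)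
      (g := ((ofCoalgebra K A).tensor Z).counit) (fun x y => ?_) z
    have e : Z.counit ∘ₗ orbit a y ∘ₗ S.πL = Z.counit y • (ofCoalgebra K A).counit := by
      ext x
      simp only [LinearMap.comp_apply, orbit_apply, hW.counit_act, S.counit_π]
      rw [mul_comm]
      rfl
    have e1 : (smashCoalg Y Z a).counit = (TensorProduct.lid K K).toLinearMap ∘ₗ
      TensorProduct.map Y.counit Z.counit := rfl
    rw [LinearMap.comp_apply, psi_tmul, e1, LinearMap.comp_apply, map_convT, e,
      hS.coalg.counit_comp]
    have e2 := isCoalgebra_ofCoalgebra (K := K) (C := A) |>.dropLeft_convT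
      (Z.counit y • (ofCoalgebra K A).counit) x
    exact e2.trans (by simp [tensor_counit, mul_comm])

/-- Being the image of `A ⊗ W` under `Ψ`, the braided tensor product inherits coassociativity and
`H`-linearity with no computation involving the braiding. The result is again an `H`-module
coalgebra, so the construction iterates. -/
theorem isModuleCoalgebra_smash : IsModuleCoalgebra (smashCoalg Y Z a) (tensorAct Y.act a) :=
  (S.isModuleCoalgebra_actA.tensor hW.coalgebra).of_surjective (hS.isCoalgMap_psi hW)
    (hS.psi_surjective hW.one_act) (hS.psi_act hW.mul_act)

end IsCoinvariants

end SplittingDatum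

end

/-! ### Codiagonal coactions and their compatibility with `Ψ`. -/

noncomputable section

section Coactions

open CoalgData

variable {K : Type u} [Field K] {H : Type v} [Ring H] [HopfAlgebra K H] {V W : Type*}
  [AddCommGroup V] [Module K V] [AddCommGroup W] [Module K W] {C D : Type*} [AddCommGroup C]
  [Module K C] [AddCommGroup D] [Module K D] {X : CoalgData K C} {Z : CoalgData K D}

/-- `((x ⊗ v) ⊗ h) ⊗ (g ⊗ y) ↦ x g ⊗ (v ⊗ h y)`. -/
def mulPush (a : H ⊗[K] W →ₗ[K] W) :
    ((H ⊗[K] V) ⊗[K] H) ⊗[K] (H ⊗[K] W) →ₗ[K] H ⊗[K] (V ⊗[K] W) :=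
  (TensorProduct.assoc K H V W).toLinearMap ∘ₗ TensorProduct.map mulLeg a ∘ₗ
    (TensorProduct.tensorTensorTensorComm K (H ⊗[K] V) H H W).toLinearMap

@[simp] theorem mulPush_tmul (a : H ⊗[K] W →ₗ[K] W) (x h g : H) (v : V) (y : W) :
    mulPush a (((x ⊗ₜ v) ⊗ₜ h) ⊗ₜ (g ⊗ₜ y)) = (x * g) ⊗ₜ (v ⊗ₜ a (h ⊗ₜ y)) := by
  simp [mulPush]

variable {aV : H ⊗[K] V →ₗ[K] V} {cV : V →ₗ[K] H ⊗[K] V} {aW : H ⊗[K] W →ₗ[K] W}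
  {cW : W →ₗ[K] H ⊗[K] W}

theorem mulLeg_coactFirst : mulLeg ∘ₗ (coactFirst (W := W) cV).rTensor H =
    coactFirst cV ∘ₗ mulLeg.lTensor V ∘ₗ (TensorProduct.assoc K V (H ⊗[K] W) H).toLinearMap := by
  ext x g y h
  simp only [coactFirst, TensorProduct.AlgebraTensorModule.curry_apply, TensorProduct.curry_apply,
    LinearMap.restrictScalars_apply, LinearMap.comp_apply, LinearEquiv.coe_coe,
    TensorProduct.assoc_tmul, LinearMap.lTensor_tmul, LinearMap.rTensor_tmul, mulLeg_tmul,
    TensorProduct.assoc_symm_tmul]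
  generalize cV x = s
  induction s using TensorProduct.induction_on with
  | zero => simp
  | add a b ha hb => simp only [map_add, TensorProduct.add_tmul, ha, hb]
  | tmul g k => simp [mul_assoc]

/-- The codiagonal coaction on `t(c₁) ⊗ P(c₂) y`. -/
theorem mulLeg_convT_tensorCoact (hX : X.IsCoalgebra) {t : C →ₗ[K] V} {P : C →ₗ[K] H}
    (hP : IsCoalgMap X (ofCoalgebra K H) P) (hW : IsYDCompatible aW cW) (y : W) (c : C) :
    mulLeg (X.convT (tensorCoact cV cW ∘ₗ X.convT t (orbit aW y ∘ₗ P)) P c) =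
      mulPush aW (X.convT (mulLeg ∘ₗ X.convT (cV ∘ₗ t) P) P c ⊗ₜ cW y) := by
  have e1 : mulLeg ∘ₗ X.convT (cW ∘ₗ orbit aW y ∘ₗ P) P =
      orbit (tensorAct (LinearMap.mul' K H) aW) (cW y) ∘ₗ P := by
    have h : X.convT (cW ∘ₗ orbit aW y ∘ₗ P) P =
        (ofCoalgebra K H).convT (cW ∘ₗ orbit aW y) LinearMap.id ∘ₗ P := by
      rw [hP.convT_comp]; rfl
    rw [h]
    exact LinearMap.ext fun c => hW y (P c)
  have e2 : mulLeg (X.convT (tensorCoact cV cW ∘ₗ X.convT t (orbit aW y ∘ₗ P)) P c) =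
      coactFirst cV (pushAct (tensorAct (LinearMap.mul' K H) aW) (X.convT t P c ⊗ₜ cW y)) := by
    have e := lTensor_convT (X := X) (mulLeg (K := K) (H := H) (V := W)) t
      (X.convT (cW ∘ₗ orbit aW y ∘ₗ P) P) c
    rw [pushAct_convT, ← e1, ← e, ← hX.assoc_convT, tensorCoact_eq,
      LinearMap.comp_assoc, lTensor_comp_convT, ← rTensor_convT]
    exact congr($mulLeg_coactFirst _)
  rw [e2]
  refine eq_of_tmul (f := coactFirst cV ∘ₗ pushAct (tensorAct (LinearMap.mul' K H) aW) ∘ₗ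
    TensorProduct.mk K _ _ (X.convT t P c)) (g := mulPush aW ∘ₗ TensorProduct.mk K _ _
      (X.convT (mulLeg ∘ₗ X.convT (cV ∘ₗ t) P) P c)) (fun g z => ?_) (cW y)
  simp only [LinearMap.comp_apply, TensorProduct.mk_apply]
  rw [pushAct_convT, orbit_tensorAct, hP.convT_comp]
  simp only [coactFirst, LinearMap.comp_apply, LinearEquiv.coe_coe]
  rw [rTensor_convT, hX.assoc_symm_convT]
  have e2' := rTensor_convT (X := X) (mulLeg (K := K) (H := H) (V := V))
    (X.convT (cV ∘ₗ t) (orbit (LinearMap.mul' K H) g ∘ₗ P)) (orbit aW z ∘ₗ P) c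
  rw [e2', ← lTensor_convT (orbit aW z),
    ← lTensor_comp_convT (orbit (LinearMap.mul' K H) g) (cV ∘ₗ t) P]
  have e3 : mulLeg ∘ₗ (orbit (LinearMap.mul' K H) g).lTensor (H ⊗[K] V) =
      (LinearMap.mulRight K g).rTensor V ∘ₗ mulLeg := by
    ext x v h
    simp [mul_assoc]
  rw [← LinearMap.comp_assoc, e3, LinearMap.comp_assoc, ← rTensor_convT]
  generalize X.convT (mulLeg ∘ₗ X.convT (cV ∘ₗ t) P) P c = s
  refine eq_of_tmul (f := (TensorProduct.assoc K H V W).toLinearMap ∘ₗ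
    (orbit aW z).lTensor (H ⊗[K] V) ∘ₗ ((LinearMap.mulRight K g).rTensor V).rTensor H)
    (g := mulPush aW ∘ₗ (TensorProduct.mk K _ _).flip (g ⊗ₜ z)) (fun x h => ?_) s
  induction x using TensorProduct.induction_on with
  | zero => simp
  | add a b ha hb => simp only [map_add, TensorProduct.add_tmul, ha, hb]
  | tmul x v => simp

/-- This is `mulLeg_convT_tensorCoact` for the coalgebra `H` itself, with `P` the identity and `t`
the orbit map of `x`. After inserting the compatibility on `V`, both sides are linear in `ρ(x)` and
`ρ(y)`. -/
theorem IsYDCompatible.tensor (hV : IsYDCompatible aV cV) (hW : IsYDCompatible aW cW) :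
    IsYDCompatible (tensorAct aV aW) (tensorCoact cV cW) := by
  intro z h
  induction z using TensorProduct.induction_on with
  | zero =>
    have : orbit (tensorAct aV aW) (0 : V ⊗[K] W) = 0 := by ext; simp
    simp [this, convT_apply]
  | add p q hp hq =>
    have : orbit (tensorAct aV aW) (p + q) =
      orbit (tensorAct aV aW) p + orbit (tensorAct aV aW) q := by
      ext; simp [TensorProduct.tmul_add]
    simp only [this, convT_apply, LinearMap.comp_add, TensorProduct.map_add_left,
      LinearMap.add_apply, map_add, TensorProduct.tmul_add] at hp hq ⊢
    rw [hp, hq]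
  | tmul x y =>
    have hH : (ofCoalgebra K H).IsCoalgebra := isCoalgebra_ofCoalgebra
    have h1 := mulLeg_convT_tensorCoact (cV := cV) hH (t := orbit aV x)
      (P := LinearMap.id) IsCoalgMap.id hW y h
    have e : mulLeg ∘ₗ (ofCoalgebra K H).convT (cV ∘ₗ orbit aV x) LinearMap.id =
        orbit (tensorAct (LinearMap.mul' K H) aV) (cV x) := LinearMap.ext fun h => hV x h
    rw [e, LinearMap.comp_id, ← orbit_tensorAct] at h1
    rw [h1, tensorCoact_tmul]
    generalize cV x = s
    generalize cW y = t
    induction s using TensorProduct.induction_on with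
    | zero =>
      have : orbit (tensorAct (LinearMap.mul' K H) aV) 0 = 0 := by ext; simp
      simp [this, convT_apply]
    | add p q hp hq =>
      have : orbit (tensorAct (LinearMap.mul' K H) aV) (p + q) =
        orbit (tensorAct (LinearMap.mul' K H) aV) p +
          orbit (tensorAct (LinearMap.mul' K H) aV) q := by
        ext; simp [TensorProduct.tmul_add]
      simp only [this, convT_apply, TensorProduct.map_add_left,
        LinearMap.add_apply, map_add, TensorProduct.tmul_add, TensorProduct.add_tmul] at hp hq ⊢
      rw [hp, hq]
    | tmul g x =>
      induction t using TensorProduct.induction_on with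
      | zero => simp
      | add p q hp hq => simp only [map_add, TensorProduct.tmul_add, hp, hq]
      | tmul g' y =>
        simp only [TensorProduct.tensorTensorTensorComm_tmul, LinearMap.rTensor_tmul,
          LinearMap.mul'_apply]
        rw [orbit_tensorAct, tensorAct_tmul, orbit_tensorAct, ← hH.assoc_convT]
        simp only [convT_apply]
        generalize (ofCoalgebra K H).comul h = r
        refine eq_of_tmul (f := mulPush aW ∘ₗ (TensorProduct.mk K _ _).flip (g' ⊗ₜ y) ∘ₗ
          TensorProduct.map ((ofCoalgebra K H).convT (orbit (LinearMap.mul' K H) g) (orbit aV x))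
            LinearMap.id) (g := (TensorProduct.assoc K H V W).toLinearMap ∘ₗ TensorProduct.map
            ((ofCoalgebra K H).convT (orbit (LinearMap.mul' K H) (g * g')) (orbit aV x))
            (orbit aW y)) (fun p q => ?_) r
        simp only [LinearMap.comp_apply, TensorProduct.map_tmul, convT_apply]
        generalize (ofCoalgebra K H).comul p = r
        refine eq_of_tmul (f := mulPush aW ∘ₗ (TensorProduct.mk K _ _).flip (g' ⊗ₜ y) ∘ₗ
          (TensorProduct.mk K _ _).flip q ∘ₗ
          TensorProduct.map (orbit (LinearMap.mul' K H) g) (orbit aV x))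
          (g := (TensorProduct.assoc K H V W).toLinearMap ∘ₗ
          (TensorProduct.mk K _ _).flip (aW (q ⊗ₜ y)) ∘ₗ TensorProduct.map
            (orbit (LinearMap.mul' K H) (g * g')) (orbit aV x)) (fun p q => ?_) r
        simp [mul_assoc]

end Coactions

namespace SplittingDatum

open CoalgData

variable {K : Type u} [Field K] {A : Type w} [Ring A] [Bialgebra K A]
  {H : Type v} [Ring H] [HopfAlgebra K H] {S : SplittingDatum K A H}
  {V : Type w} [AddCommGroup V] [Module K V] {W D : Type*} [AddCommGroup W] [Module K W]
  [AddCommGroup D] [Module K D] {Y : YDData K H V} {τ : A →ₗ[K] V} {j : V →ₗ[K] A}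
  {Z : CoalgData K D} {aW : H ⊗[K] W →ₗ[K] W} {cW : W →ₗ[K] H ⊗[K] W}

/-- `a ⊗ d ↦ π(a) P(d)`. -/
def piMul (S : SplittingDatum K A H) (P : D →ₗ[K] H) : A ⊗[K] D →ₗ[K] H :=
  LinearMap.mul' K H ∘ₗ TensorProduct.map S.πL P

@[simp] theorem piMul_tmul (S : SplittingDatum K A H) (P : D →ₗ[K] H) (x : A) (d : D) :
    S.piMul P (x ⊗ₜ d) = S.πL x * P d := by simp [piMul]

/-- The inductive step extending `coact_τ` to tensor powers: a formula of the same shape for `q` on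
`D` yields one for `Ψ(A ⊗ q)` on `A ⊗ D`. The compatibility on `W` carries the coaction past `π(a)`;
then `coact_τ` is used on the `A`-factor and `h` on the `D`-factor. -/
theorem IsCoinvariants.coact_psi (hS : S.IsCoinvariants Y τ j) (hW : IsYDCompatible aW cW)
    {P : D →ₗ[K] H} {q : D →ₗ[K] W} (h : mulLeg ∘ₗ Z.convT (cW ∘ₗ q) P = Z.convT P q) :
    mulLeg ∘ₗ ((ofCoalgebra K A).tensor Z).convT
      (tensorCoact Y.coact cW ∘ₗ S.psi τ aW ∘ₗ q.lTensor A) (S.piMul P) =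
    ((ofCoalgebra K A).tensor Z).convT (S.piMul P) (S.psi τ aW ∘ₗ q.lTensor A) := by
  have hA : (ofCoalgebra K A).IsCoalgebra := isCoalgebra_ofCoalgebra
  refine TensorProduct.ext' fun x d => ?_
  have e1 := eq_of_tmul (f := mulLeg ∘ₗ TensorProduct.map
      (tensorCoact Y.coact cW ∘ₗ S.psi τ aW ∘ₗ q.lTensor A) (S.piMul P) ∘ₗ
      (TensorProduct.tensorTensorTensorComm K A A D D).toLinearMap ∘ₗ
      TensorProduct.mk K _ _ ((ofCoalgebra K A).comul x))
    (g := mulPush aW ∘ₗ TensorProduct.mk K _ _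
      ((ofCoalgebra K A).convT ((ofCoalgebra K A).convT S.πL τ) S.πL x) ∘ₗ
      mulLeg ∘ₗ TensorProduct.map (cW ∘ₗ q) P) (fun d e => by
        have h1 := mulLeg_convT_tensorCoact (cV := Y.coact) hA (t := τ) S.isCoalgMap_π hW (q d) x
        rw [hS.coact_τ] at h1
        simp only [LinearMap.comp_apply, TensorProduct.mk_apply, TensorProduct.map_tmul]
        have h2 : ∀ (s : (H ⊗[K] V) ⊗[K] H) (t : H ⊗[K] W), mulPush aW (s ⊗ₜ mulLeg (t ⊗ₜ P e)) =
            (LinearMap.mulRight K (P e)).rTensor (V ⊗[K] W) (mulPush aW (s ⊗ₜ t)) := by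
          intro s t
          induction t using TensorProduct.induction_on with
          | zero => simp
          | add a b ha hb => simp only [map_add, TensorProduct.add_tmul, TensorProduct.tmul_add,
              ha, hb]
          | tmul g y =>
            induction s using TensorProduct.induction_on with
            | zero => simp
            | add a b ha hb => simp only [map_add, TensorProduct.add_tmul, ha, hb]
            | tmul s g' =>
              induction s using TensorProduct.induction_on with
              | zero => simp
              | add a b ha hb => simp only [map_add, TensorProduct.add_tmul, ha, hb]
              | tmul p v => simp [mul_assoc]
        rw [h2, ← h1, convT_apply]
        generalize (ofCoalgebra K A).comul x = r
        refine eq_of_tmul (f := mulLeg ∘ₗ TensorProduct.map (tensorCoact Y.coact cW ∘ₗ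
          S.psi τ aW ∘ₗ q.lTensor A) (S.piMul P) ∘ₗ
          (TensorProduct.tensorTensorTensorComm K A A D D).toLinearMap ∘ₗ
          (TensorProduct.mk K _ _).flip (d ⊗ₜ e))
          (g := (LinearMap.mulRight K (P e)).rTensor (V ⊗[K] W) ∘ₗ mulLeg ∘ₗ
            TensorProduct.map (tensorCoact Y.coact cW ∘ₗ (ofCoalgebra K A).convT τ
              (orbit aW (q d) ∘ₗ S.πL)) S.πL) (fun y z => ?_) r
        simp only [LinearMap.comp_apply, LinearMap.flip_apply, TensorProduct.mk_apply,
          LinearEquiv.coe_coe, TensorProduct.tensorTensorTensorComm_tmul, TensorProduct.map_tmul,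
          LinearMap.lTensor_tmul, psi_tmul, piMul_tmul]
        generalize tensorCoact Y.coact cW _ = s
        induction s using TensorProduct.induction_on with
        | zero => simp
        | add a b ha hb => simp only [map_add, TensorProduct.add_tmul, ha, hb]
        | tmul p v => simp [mul_assoc]) (Z.comul d)
  have h' := congr($h d)
  simp only [LinearMap.comp_apply, TensorProduct.mk_apply, LinearEquiv.coe_coe] at e1 h' ⊢
  rw [tensor_convT_tmul, e1, ← convT_apply, h', tensor_convT_tmul]
  have e2 := eq_of_tmul (g := TensorProduct.map (S.piMul P) (S.psi τ aW ∘ₗ q.lTensor A) ∘ₗ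
      (TensorProduct.tensorTensorTensorComm K A A D D).toLinearMap ∘ₗ
      TensorProduct.mk K _ _ ((ofCoalgebra K A).comul x))
    (f := mulPush aW ∘ₗ TensorProduct.mk K _ _
      ((ofCoalgebra K A).convT ((ofCoalgebra K A).convT S.πL τ) S.πL x) ∘ₗ
        TensorProduct.map P q) (fun d e => by
      simp only [LinearMap.comp_apply, TensorProduct.mk_apply, TensorProduct.map_tmul,
        LinearEquiv.coe_coe]
      have h1 := hA.convT_rebracket (p := S.πL) (q := τ) (r := S.πL)
        (F := mulPush aW ∘ₗ (TensorProduct.mk K _ _).flip (P d ⊗ₜ q e))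
        (G := TensorProduct.map (LinearMap.mulRight K (P d)) ((orbit aW (q e)).lTensor V))
        (fun x y z => by simp) x
      simp only [LinearMap.comp_apply, map_convT, lTensor_comp_convT] at h1
      refine h1.trans ?_
      rw [convT_apply]
      generalize (ofCoalgebra K A).comul x = r
      refine eq_of_tmul (f := TensorProduct.map (LinearMap.mulRight K (P d) ∘ₗ S.πL)
        ((ofCoalgebra K A).convT τ (orbit aW (q e) ∘ₗ S.πL))) (g := TensorProduct.map (S.piMul P)
          (S.psi τ aW ∘ₗ q.lTensor A) ∘ₗ
          (TensorProduct.tensorTensorTensorComm K A A D D).toLinearMap ∘ₗ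
          (TensorProduct.mk K _ _).flip (d ⊗ₜ e)) (fun y z => ?_) r
      simp [psi_tmul]) (Z.comul d)
  exact e2

end SplittingDatum

end

/-! ### Cancelling a factor from `H`; invariant functionals. -/

noncomputable section

section Cancellation

open CoalgData

variable {K : Type u} [Field K] {H : Type v} [Ring H] [HopfAlgebra K H] {M N : Type*}
  [AddCommGroup M] [Module K M] [AddCommGroup N] [Module K N] {C : Type*} [AddCommGroup C]
  [Module K C] {X : CoalgData K C} {P : C →ₗ[K] H} {r : M ⊗[K] H →ₗ[K] M}

/-- `f(c₁) P(c₂) S(P(c₃)) = f(c)`. -/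
theorem CoalgData.IsCoalgebra.act_antipode (hX : X.IsCoalgebra)
    (hP : IsCoalgMap X (ofCoalgebra K H) P)
    (hr1 : ∀ m, r (m ⊗ₜ 1) = m) (hr : ∀ m g h, r (r (m ⊗ₜ g) ⊗ₜ h) = r (m ⊗ₜ (g * h)))
    (f : C →ₗ[K] M) (c : C) :
    r (X.convT (r ∘ₗ X.convT f P) (HopfAlgebraStruct.antipode K ∘ₗ P) c) = f c := by
  have h1 := hX.convT_rebracket (p := f) (q := P) (r := HopfAlgebraStruct.antipode K ∘ₗ P)
    (F := r ∘ₗ r.rTensor H) (G := r ∘ₗ (LinearMap.mul' K H).lTensor M)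
    (fun x y z => by simp [hr]) c
  have e1 := rTensor_convT (X := X) r (X.convT f P) (HopfAlgebraStruct.antipode K ∘ₗ P) c
  have e2 := lTensor_convT (X := X) (LinearMap.mul' K H) f
    (X.convT P (HopfAlgebraStruct.antipode K ∘ₗ P)) c
  have e3 : LinearMap.mul' K H ∘ₗ X.convT P (HopfAlgebraStruct.antipode K ∘ₗ P) =
      Algebra.linearMap K H ∘ₗ X.counit := by
    ext c
    rw [← lTensor_comp_convT, hP.convT_self, ← hP.counit_comp]
    exact HopfAlgebra.mul_antipode_lTensor_comul_apply (P c)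
  simp only [LinearMap.comp_apply] at h1
  rw [← e1, h1, e2, e3, ← lTensor_convT]
  refine Eq.trans ?_ (hX.dropRight_convT f c)
  exact eq_of_tmul (f := r ∘ₗ (Algebra.linearMap K H).lTensor M)
    (g := (TensorProduct.rid K M).toLinearMap) (fun x y => by
      simp [Algebra.algebraMap_eq_smul_one, hr1]) _

/-- Convolution with `P` can be undone by convolution with `S ∘ P`. -/
theorem CoalgData.IsCoalgebra.act_cancel (hX : X.IsCoalgebra)
    (hP : IsCoalgMap X (ofCoalgebra K H) P)
    (hr1 : ∀ m, r (m ⊗ₜ 1) = m) (hr : ∀ m g h, r (r (m ⊗ₜ g) ⊗ₜ h) = r (m ⊗ₜ (g * h)))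
    {f g : C →ₗ[K] M} (h : r ∘ₗ X.convT f P = r ∘ₗ X.convT g P) : f = g := by
  ext c
  rw [← hX.act_antipode hP hr1 hr f, h, hX.act_antipode hP hr1 hr g]

theorem mulLeg_one (z : H ⊗[K] N) : mulLeg (z ⊗ₜ (1 : H)) = z := by
  induction z using TensorProduct.induction_on with
  | zero => simp
  | add a b ha hb => rw [TensorProduct.add_tmul, map_add, ha, hb]
  | tmul x y => simp

theorem mulLeg_mulLeg (z : H ⊗[K] N) (g h : H) :
    mulLeg (mulLeg (z ⊗ₜ[K] g) ⊗ₜ[K] h) = mulLeg (z ⊗ₜ (g * h)) := by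
  induction z using TensorProduct.induction_on with
  | zero => simp
  | add a b ha hb => simp only [map_add, TensorProduct.add_tmul, ha, hb]
  | tmul x y => simp [mul_assoc]

theorem CoalgData.IsCoalgebra.mulLeg_cancel (hX : X.IsCoalgebra)
    (hP : IsCoalgMap X (ofCoalgebra K H) P) {f g : C →ₗ[K] H ⊗[K] N}
    (h : mulLeg ∘ₗ X.convT f P = mulLeg ∘ₗ X.convT g P) : f = g :=
  hX.act_cancel hP mulLeg_one mulLeg_mulLeg h

/-- If `E(c₁) P(c₂) = P'(c)` for coalgebra maps `P` and `P'` to `H`, then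
`E(c₁)₁ P(c₂) ⊗ E(c₁)₂ = P'(c₁) ⊗ E(c₂)`. -/
theorem CoalgData.IsCoalgebra.mulLeg_comul (hX : X.IsCoalgebra) {E P' : C →ₗ[K] H}
    (hP : IsCoalgMap X (ofCoalgebra K H) P) (hP' : IsCoalgMap X (ofCoalgebra K H) P')
    (h : LinearMap.mul' K H ∘ₗ X.convT E P = P') :
    mulLeg ∘ₗ X.convT (Coalgebra.comul ∘ₗ E) P = X.convT P' E := by
  -- `r` multiplies the second leg. After convolving with one more `P` through `r`, the left side
  -- becomes `Δ(E(c₁))Δ(P(c₂)) = Δ(P'(c))` and the right side `P'(c₁) ⊗ E(c₂)P(c₃) = P'(c₁) ⊗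
  -- P'(c₂)`; the extra `P` is then cancelled.
  let r : (H ⊗[K] H) ⊗[K] H →ₗ[K] H ⊗[K] H :=
    (LinearMap.mul' K H).lTensor H ∘ₗ (TensorProduct.assoc K H H H).toLinearMap
  have hr (x y g : H) : r ((x ⊗ₜ y) ⊗ₜ g) = x ⊗ₜ (y * g) := by simp [r]
  refine hX.act_cancel (r := r) hP (fun m => ?_) (fun m g h => ?_) ?_
  · induction m using TensorProduct.induction_on with
    | zero => simp
    | add a b ha hb => rw [TensorProduct.add_tmul, map_add, ha, hb]
    | tmul x y => simp [hr]
  · induction m using TensorProduct.induction_on with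
    | zero => simp
    | add a b ha hb => simp only [map_add, TensorProduct.add_tmul, ha, hb]
    | tmul x y => simp [hr, mul_assoc]
  ext c
  have h1 := hX.convT_rebracket (p := Coalgebra.comul ∘ₗ E) (q := P) (r := P)
    (F := r ∘ₗ mulLeg.rTensor H) (G := LinearMap.mul' K (H ⊗[K] H)) (fun x y z => by
      induction x using TensorProduct.induction_on with
      | zero => simp
      | add a b ha hb => simp only [map_add, TensorProduct.add_tmul, ha, hb]
      | tmul p q => simp [hr]) c
  have e1 := rTensor_convT (X := X) (mulLeg (K := K) (H := H) (V := H))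
    (X.convT (Coalgebra.comul ∘ₗ E) P) P c
  have e2 : X.convT (Coalgebra.comul ∘ₗ E) (Coalgebra.comul ∘ₗ P) c =
    TensorProduct.map Coalgebra.comul Coalgebra.comul (X.convT E P c) :=
      (map_convT _ _ _ _ _).symm
  have e3 : ∀ z : H ⊗[K] H, LinearMap.mul' K (H ⊗[K] H)
      (TensorProduct.map Coalgebra.comul Coalgebra.comul z) =
      Coalgebra.comul (R := K) (LinearMap.mul' K H z) :=
    eq_of_tmul (f := LinearMap.mul' K (H ⊗[K] H) ∘ₗ
      TensorProduct.map Coalgebra.comul Coalgebra.comul)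
      (g := Coalgebra.comul ∘ₗ LinearMap.mul' K H) (fun x y => by simp [Bialgebra.comul_mul])
  have e4 : Coalgebra.comul (R := K) (P' c) = X.convT P' P' c := hP'.map_comul c
  simp only [LinearMap.comp_apply] at h1 ⊢
  have e5 : X.convT P P = Coalgebra.comul ∘ₗ P := hP.convT_self
  have h' : LinearMap.mul' K H (X.convT E P c) = P' c := congr($h c)
  rw [← e1, h1, e5, e2, e3, h', e4]
  have e6 : r (X.convT (X.convT P' E) P c) = (LinearMap.mul' K H).lTensor H
    (TensorProduct.assoc K H H H (X.convT (X.convT P' E) P c)) := rfl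
  have e7 := lTensor_convT (X := X) (LinearMap.mul' K H) P' (X.convT E P) c
  rw [e6, hX.assoc_convT, e7, h]

end Cancellation

section Invariance

open CoalgData

variable {K : Type u} [Field K] {H : Type v} [Ring H] [HopfAlgebra K H] {W V M : Type*}
  [AddCommGroup W] [Module K W] [AddCommGroup V] [Module K V] [AddCommGroup M] [Module K M]
  {Y : CoalgData K W} {a : H ⊗[K] W →ₗ[K] W} {b : H ⊗[K] V →ₗ[K] V}

/-- `f(h x) = ε(h) f(x)`. -/
def IsActInvariant (a : H ⊗[K] W →ₗ[K] W) (f : W →ₗ[K] K) : Prop :=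
  ∀ h x, f (a (h ⊗ₜ x)) = Coalgebra.counit (R := K) h * f x

theorem IsActInvariant.comp {f : W →ₗ[K] K} (hf : IsActInvariant a f) {q : V →ₗ[K] W}
    (hq : ∀ h x, q (b (h ⊗ₜ x)) = a (h ⊗ₜ q x)) : IsActInvariant b (f ∘ₗ q) := fun h x => by
  rw [LinearMap.comp_apply, hq, hf, LinearMap.comp_apply]

theorem isActInvariant_iff {f : W →ₗ[K] K} :
    IsActInvariant a f ↔ f ∘ₗ a = epsTensor K (ofCoalgebra K H).counit f :=
  ⟨fun h => TensorProduct.ext' fun x y => (h x y).trans (epsTensor_tmul _ _ _ _).symm,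
    fun h x y => congr($h (x ⊗ₜ y)).trans (epsTensor_tmul _ _ _ _)⟩

namespace IsModuleCoalgebra

variable (hW : IsModuleCoalgebra Y a)

include hW

theorem isCoalgMap : IsCoalgMap ((ofCoalgebra K H).tensor Y) Y a where
  map_comul := eq_of_tmul (f := Y.comul ∘ₗ a)
    (g := TensorProduct.map a a ∘ₗ ((ofCoalgebra K H).tensor Y).comul) hW.comul_act
  map_counit := eq_of_tmul (f := Y.counit ∘ₗ a) (g := ((ofCoalgebra K H).tensor Y).counit)
    (fun h x => (hW.counit_act h x).trans (epsTensor_tmul _ _ _ _).symm)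

theorem isActInvariant_convL {f g : W →ₗ[K] K} (hf : IsActInvariant a f) (hg : IsActInvariant a g) :
    IsActInvariant a (Y.convL f g) := by
  rw [isActInvariant_iff] at *
  rw [hW.isCoalgMap.convL_comp, hf, hg, tensor_convL_epsTensor,
    isCoalgebra_ofCoalgebra.counit_convL]

/-- The action is a coalgebra map, so `g ∘ a` is inverse to `f ∘ a = ε ⊗ f`, whose inverse is `ε ⊗
g`. Uniqueness of inverses concludes. -/
theorem isActInvariant_inv {f g : W →ₗ[K] K} (hf : IsActInvariant a f) (h : Y.IsConvInv f g) :
    IsActInvariant a g := by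
  rw [isActInvariant_iff] at *
  have hH : (ofCoalgebra K H).IsCoalgebra := isCoalgebra_ofCoalgebra
  have h1 : ((ofCoalgebra K H).tensor Y).IsConvInv (f ∘ₗ a) (g ∘ₗ a) :=
    hW.isCoalgMap.isConvInv_comp h
  have h2 := hH.isConvInv_counit.tensor h
  rw [hf] at h1
  exact h2.unique (hH.tensor hW.coalgebra) h1.2

/-- Convolution with invariant functionals preserves linear maps. -/
theorem convL_linear {c : H ⊗[K] M →ₗ[K] M} {f : W →ₗ[K] K} (hf : IsActInvariant a f)
    {p : W →ₗ[K] M} (hp : ∀ h x, p (a (h ⊗ₜ x)) = c (h ⊗ₜ p x)) (h : H) (x : W) :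
    Y.convL f p (a (h ⊗ₜ x)) = c (h ⊗ₜ Y.convL f p x) := by
  rw [isActInvariant_iff] at hf
  have hp' : p ∘ₗ a = c ∘ₗ TensorProduct.map LinearMap.id p :=
    TensorProduct.ext' fun h x => hp h x
  have := hW.isCoalgMap.convL_comp f p
  rw [hf, hp', ← comp_convL, tensor_convL_map, isCoalgebra_ofCoalgebra.counit_convL] at this
  exact congr($this (h ⊗ₜ x))

theorem convR_linear {c : H ⊗[K] M →ₗ[K] M} {f : W →ₗ[K] K} (hf : IsActInvariant a f)
    {p : W →ₗ[K] M} (hp : ∀ h x, p (a (h ⊗ₜ x)) = c (h ⊗ₜ p x)) (h : H) (x : W) :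
    Y.convR p f (a (h ⊗ₜ x)) = c (h ⊗ₜ Y.convR p f x) := by
  rw [isActInvariant_iff] at hf
  have hp' : p ∘ₗ a = c ∘ₗ TensorProduct.map LinearMap.id p :=
    TensorProduct.ext' fun h x => hp h x
  have := hW.isCoalgMap.convR_comp p f
  rw [hf, hp', ← comp_convR, tensor_convR_map, isCoalgebra_ofCoalgebra.convR_counit] at this
  exact congr($this (h ⊗ₜ x))

end IsModuleCoalgebra

end Invariance

/-! ### Functionals on `A ⊗ A` that are trivial on the coradical -/

section Nilpotent

open CoalgData

variable {K : Type u} [Field K] {A : Type w} [AddCommGroup A] [Module K A] [Coalgebra K A]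
  {D : Type*} [AddCommGroup D] [Module K D] {Z : CoalgData K D}

/-- For each fixed `q`, `x ↦ F(x ⊗ q)` vanishes on `B`. One application of the operator therefore
lowers the filtration index of the first factor by one, whatever happens in the second. -/
theorem pow_convR_tmul_eq_zero {F : A ⊗[K] D →ₗ[K] K} {B : Submodule K A}
    (hF : ∀ x ∈ B, ∀ d, F (x ⊗ₜ d) = 0) (n : ℕ) :
    ∀ x ∈ (ofCoalgebra K A).wedgeFil B n, ∀ d,
      ((((ofCoalgebra K A).tensor Z).convR LinearMap.id F : Module.End K (A ⊗[K] D)) ^ n)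
        (x ⊗ₜ d) = 0 := by
  induction n with
  | zero =>
    intro x hx d
    have : x = 0 := hx
    simp [this]
  | succ n ih =>
    intro x hx d
    rw [pow_succ, Module.End.mul_apply, convR_apply, tensor_comul_tmul]
    generalize (((ofCoalgebra K A).tensor Z).convR LinearMap.id F : Module.End K (A ⊗[K] D)) ^ n
      = L at ih
    refine eq_of_tmul (f := L ∘ₗ (TensorProduct.rid K _).toLinearMap ∘ₗ
      TensorProduct.map LinearMap.id F ∘ₗ
      (TensorProduct.tensorTensorTensorComm K A A D D).toLinearMap ∘ₗ
      TensorProduct.mk K _ _ ((ofCoalgebra K A).comul x)) (g := 0) (fun p q => ?_) (Z.comul d)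
    have e : ∀ s : A ⊗[K] A, TensorProduct.rid K (A ⊗[K] D) (TensorProduct.map LinearMap.id F
        (TensorProduct.tensorTensorTensorComm K A A D D (s ⊗ₜ (p ⊗ₜ q)))) =
        TensorProduct.rid K A (TensorProduct.map LinearMap.id
          (F ∘ₗ (TensorProduct.mk K A D).flip q) s) ⊗ₜ p :=
      eq_of_tmul (f := (TensorProduct.rid K _).toLinearMap ∘ₗ TensorProduct.map LinearMap.id F ∘ₗ
        (TensorProduct.tensorTensorTensorComm K A A D D).toLinearMap ∘ₗ
        (TensorProduct.mk K _ _).flip (p ⊗ₜ q)) (g := (TensorProduct.mk K A D).flip p ∘ₗ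
          (TensorProduct.rid K A).toLinearMap ∘ₗ TensorProduct.map LinearMap.id
          (F ∘ₗ (TensorProduct.mk K A D).flip q)) (fun y z => by simp [TensorProduct.smul_tmul'])
    simp only [LinearMap.comp_apply, TensorProduct.mk_apply, LinearEquiv.coe_coe]
    rw [e, ← convR_apply]
    exact ih _ (hx (F ∘ₗ (TensorProduct.mk K A D).flip q) fun y hy => hF y hy q) p

theorem exists_pow_convR_eq_zero {F : A ⊗[K] D →ₗ[K] K}
    (hF : ∀ x ∈ (ofCoalgebra K A).coradical, ∀ d, F (x ⊗ₜ d) = 0) (z : A ⊗[K] D) :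
    ∃ n, ((((ofCoalgebra K A).tensor Z).convR LinearMap.id F : Module.End K (A ⊗[K] D)) ^ n)
        z = 0 := by
  induction z using TensorProduct.induction_on with
  | zero => exact ⟨0, by simp⟩
  | tmul x d =>
    obtain ⟨n, hn⟩ := exists_mem_wedgeFil_coradical (K := K) x
    exact ⟨n, pow_convR_tmul_eq_zero hF n x hn d⟩
  | add x y hx hy =>
    obtain ⟨n, hn⟩ := hx
    obtain ⟨m, hm⟩ := hy
    refine ⟨n + m, ?_⟩
    rw [map_add, pow_add, Module.End.mul_apply, Module.End.mul_apply, hm, map_zero, add_zero,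
      ← Module.End.mul_apply, ← pow_add, add_comm, pow_add, Module.End.mul_apply, hn, map_zero]

end Nilpotent

end

/-! ### The maps `Ψ` on tensor powers and the cocycle `ξ`. -/

noncomputable section

namespace SplittingDatum

open CoalgData

variable {K : Type u} [Field K] {A : Type w} [Ring A] [Bialgebra K A]
  {H : Type v} [Ring H] [HopfAlgebra K H]

section Defs

variable (S : SplittingDatum K A H) {V : Type w} [AddCommGroup V] [Module K V]

/-- The map `A ⊗ A → R ⊗ R`, `a ⊗ b ↦ τ(a₁) ⊗ π(a₂) τ(b)`. -/
def psi₂ (Y : YDData K H V) (τ : A →ₗ[K] V) : A ⊗[K] A →ₗ[K] V ⊗[K] V :=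
  S.psi τ Y.act ∘ₗ τ.lTensor A

/-- The map `A ⊗ A ⊗ A → R ⊗ R ⊗ R` obtained by iterating `psi`. -/
def psi₃ (Y : YDData K H V) (τ : A →ₗ[K] V) : A ⊗[K] (A ⊗[K] A) →ₗ[K] V ⊗[K] (V ⊗[K] V) :=
  S.psi τ (tensorAct Y.act Y.act) ∘ₗ (S.psi₂ Y τ).lTensor A

/-- The map `A ⊗ A ⊗ A ⊗ A → R ⊗ R ⊗ R ⊗ R` obtained by iterating `psi`. -/
def psi₄ (Y : YDData K H V) (τ : A →ₗ[K] V) :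
    A ⊗[K] (A ⊗[K] (A ⊗[K] A)) →ₗ[K] V ⊗[K] (V ⊗[K] (V ⊗[K] V)) :=
  S.psi τ (tensorAct Y.act (tensorAct Y.act Y.act)) ∘ₗ (S.psi₃ Y τ).lTensor A

/-- The cocycle `ξ(r ⊗ s) = π(r s)`. -/
def cocycle (j : V →ₗ[K] A) : V ⊗[K] V →ₗ[K] H :=
  S.πL ∘ₗ LinearMap.mul' K A ∘ₗ TensorProduct.map j j

end Defs

theorem π_one (S : SplittingDatum K A H) : S.πL 1 = 1 := by rw [← S.σL_one, S.πL_σL]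

theorem isCoalgMap_piMul (S : SplittingDatum K A H) {D : Type*} [AddCommGroup D] [Module K D]
    {Z : CoalgData K D} {P : D →ₗ[K] H} (hP : IsCoalgMap Z (ofCoalgebra K H) P) :
    IsCoalgMap ((ofCoalgebra K A).tensor Z) (ofCoalgebra K H) (S.piMul P) :=
  IsCoalgMap.comp DQBData.isCoalgMap_mul' (S.isCoalgMap_π.tensor hP)

namespace IsCoinvariants

variable {S : SplittingDatum K A H} {V : Type w} [AddCommGroup V] [Module K V]
  {Y : YDData K H V} {τ : A →ₗ[K] V} {j : V →ₗ[K] A} (hS : S.IsCoinvariants Y τ j)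

include hS

theorem isModuleCoalgebra : IsModuleCoalgebra Y.toCoalgData Y.act where
  coalgebra := hS.isYDCoalgebra.coalgebra
  one_act := hS.isYDCoalgebra.one_act
  mul_act := hS.isYDCoalgebra.mul_act
  comul_act := hS.isYDCoalgebra.comul_act
  counit_act := hS.isYDCoalgebra.counit_act

theorem isModuleCoalgebra₂ : IsModuleCoalgebra (smashCoalg Y Y.toCoalgData Y.act)
    (tensorAct Y.act Y.act) := hS.isModuleCoalgebra_smash hS.isModuleCoalgebra

theorem isModuleCoalgebra₃ : IsModuleCoalgebra
    (smashCoalg Y (smashCoalg Y Y.toCoalgData Y.act) (tensorAct Y.act Y.act))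
    (tensorAct Y.act (tensorAct Y.act Y.act)) :=
  hS.isModuleCoalgebra_smash hS.isModuleCoalgebra₂

theorem isCoalgMap_psi₂ : IsCoalgMap (DQBData.ofBialgebra K A).sq
    (smashCoalg Y Y.toCoalgData Y.act) (S.psi₂ Y τ) :=
  (hS.isCoalgMap_psi hS.isModuleCoalgebra).comp hS.coalg.lTensor

theorem isCoalgMap_psi₃ : IsCoalgMap (DQBData.ofBialgebra K A).cube
    (smashCoalg Y (smashCoalg Y Y.toCoalgData Y.act) (tensorAct Y.act Y.act)) (S.psi₃ Y τ) :=
  (hS.isCoalgMap_psi hS.isModuleCoalgebra₂).comp hS.isCoalgMap_psi₂.lTensor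

theorem isCoalgMap_psi₄ : IsCoalgMap
    ((DQBData.ofBialgebra K A).toCoalgData.tensor (DQBData.ofBialgebra K A).cube)
    (smashCoalg Y (smashCoalg Y (smashCoalg Y Y.toCoalgData Y.act) (tensorAct Y.act Y.act))
      (tensorAct Y.act (tensorAct Y.act Y.act))) (S.psi₄ Y τ) :=
  (hS.isCoalgMap_psi hS.isModuleCoalgebra₃).comp hS.isCoalgMap_psi₃.lTensor

theorem psi₂_j (x y : V) : S.psi₂ Y τ (j x ⊗ₜ j y) = x ⊗ₜ y := by
  rw [psi₂, LinearMap.comp_apply, LinearMap.lTensor_tmul, hS.τ_j,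
    hS.psi_j hS.isYDCoalgebra.one_act]

theorem psi₃_j (x y z : V) : S.psi₃ Y τ (j x ⊗ₜ (j y ⊗ₜ j z)) = x ⊗ₜ (y ⊗ₜ z) := by
  rw [psi₃, LinearMap.comp_apply, LinearMap.lTensor_tmul, hS.psi₂_j,
    hS.psi_j hS.isModuleCoalgebra₂.one_act]

theorem psi₂_surjective : Function.Surjective (S.psi₂ Y τ) := by
  rw [psi₂, LinearMap.coe_comp]
  exact (hS.psi_surjective hS.isYDCoalgebra.one_act).comp
    (LinearMap.lTensor_surjective _ hS.τ_surjective)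

theorem psi₃_surjective : Function.Surjective (S.psi₃ Y τ) := by
  rw [psi₃, LinearMap.coe_comp]
  exact (hS.psi_surjective hS.isModuleCoalgebra₂.one_act).comp
    (LinearMap.lTensor_surjective _ hS.psi₂_surjective)

theorem psi₄_surjective : Function.Surjective (S.psi₄ Y τ) := by
  rw [psi₄, LinearMap.coe_comp]
  exact (hS.psi_surjective hS.isModuleCoalgebra₃.one_act).comp
    (LinearMap.lTensor_surjective _ hS.psi₃_surjective)

/-- `actFirst` commutes with maps on the second factor. -/
theorem psi_lTensor_act {W D : Type*} [AddCommGroup W] [Module K W] [AddCommGroup D] [Module K D]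
    {a : H ⊗[K] W →ₗ[K] W} (hW : ∀ g h x, a ((g * h) ⊗ₜ x) = a (g ⊗ₜ a (h ⊗ₜ x)))
    (q : D →ₗ[K] W) (h : H) (z : A ⊗[K] D) :
    (S.psi τ a ∘ₗ q.lTensor A) (actFirst S.actA (h ⊗ₜ z)) =
      tensorAct Y.act a (h ⊗ₜ (S.psi τ a ∘ₗ q.lTensor A) z) := by
  rw [LinearMap.comp_apply, LinearMap.comp_apply, ← hS.psi_act hW]
  congr 1
  exact eq_of_tmul (f := q.lTensor A ∘ₗ actFirst S.actA ∘ₗ TensorProduct.mk K H _ h)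
    (g := actFirst S.actA ∘ₗ TensorProduct.mk K H _ h ∘ₗ q.lTensor A) (fun x y => by simp) z

theorem psi₂_act (h : H) (z : A ⊗[K] A) : S.psi₂ Y τ (actFirst S.actA (h ⊗ₜ z)) =
    tensorAct Y.act Y.act (h ⊗ₜ S.psi₂ Y τ z) :=
  hS.psi_lTensor_act hS.isYDCoalgebra.mul_act τ h z

theorem π_j (r : V) : S.πL (j r) = Y.counit r • 1 := by
  have h := congrArg (TensorProduct.lid K H) (congrArg (Y.counit.rTensor H) (hS.convT_j r))
  rw [rTensor_convT, hS.coalg.counit_comp] at h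
  rw [← isCoalgebra_ofCoalgebra.dropLeft_convT S.πL (j r), h]
  simp

theorem act_τ_one (h : H) : Y.act (h ⊗ₜ τ 1) = Coalgebra.counit (R := K) h • τ 1 := by
  rw [← hS.τ_σ_mul, mul_one, ← hS.τ_mul_σ, one_mul]

theorem counit_τ (a : A) : Y.counit (τ a) = Coalgebra.counit (R := K) a := hS.coalg.map_counit a

theorem counit_j (r : V) : Coalgebra.counit (R := K) (j r) = Y.counit r := by
  rw [← hS.counit_τ, hS.τ_j]

theorem psi₂_tmul_one (a : A) : S.psi₂ Y τ (a ⊗ₜ 1) = τ a ⊗ₜ τ 1 := by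
  have e : orbit Y.act (τ 1) ∘ₗ S.πL =
      LinearMap.toSpanSingleton K V (τ 1) ∘ₗ (ofCoalgebra K A).counit := by
    ext x
    rw [LinearMap.comp_apply, orbit_apply, hS.act_τ_one, S.counit_π]
    rfl
  rw [psi₂, LinearMap.comp_apply, LinearMap.lTensor_tmul, psi_tmul, e, ← lTensor_convT]
  have h := isCoalgebra_ofCoalgebra.dropRight_convT τ a
  have h' : (ofCoalgebra K A).convT τ (ofCoalgebra K A).counit a = τ a ⊗ₜ 1 := by
    rw [← h]
    exact ((TensorProduct.rid K V).symm_apply_apply _).symm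
  rw [h']
  simp

/-- Balancedness moves `h` from `1 · σ(h)` to the second factor. Through this formula `λξΨ` is seen
to be the counit on `σ(H) ⊗ A`. -/
theorem psi₂_σ_tmul (h : H) (b : A) :
    S.psi₂ Y τ (S.σL h ⊗ₜ b) = τ 1 ⊗ₜ Y.act (h ⊗ₜ τ b) := by
  have := hS.psi_mul_σ (a := Y.act) hS.isYDCoalgebra.mul_act 1 h (τ b)
  rw [one_mul] at this
  rw [psi₂, LinearMap.comp_apply, LinearMap.lTensor_tmul, this]
  conv_lhs => rw [← hS.j_τ_one]
  exact hS.psi_j hS.isYDCoalgebra.one_act _ _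

/-- `j(h₁ r) σ(h₂) = σ(h) j(r)`. -/
theorem mul_convT_act (h : H) (r : V) : LinearMap.mul' K A ((ofCoalgebra K H).convT
    (j ∘ₗ orbit Y.act r) S.σL h) = S.σL h * j r := by
  have h1 := hS.mul_convT (S.σL h * j r)
  have h2 := S.isModuleCoalgebra_actA.convT_act (f := τ) (g := S.πL)
    (fun h a => by rw [actA_tmul]; exact hS.τ_σ_mul h a) S.π_actA h (j r)
  rw [actA_tmul, hS.convT_j, tensorAct_tmul] at h2
  rw [← map_convT, h2, map_convT] at h1
  rw [← h1]
  congr 3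
  ext h
  simp

end IsCoinvariants

end SplittingDatum

end

/-! ### The cocycle identity and the functional `λξ`. -/

noncomputable section

namespace SplittingDatum

open CoalgData

variable {K : Type u} [Field K] {A : Type w} [Ring A] [Bialgebra K A]
  {H : Type v} [Ring H] [HopfAlgebra K H]

namespace IsCoinvariants

variable {S : SplittingDatum K A H} {V : Type w} [AddCommGroup V] [Module K V]
  {Y : YDData K H V} {τ : A →ₗ[K] V} {j : V →ₗ[K] A} (hS : S.IsCoinvariants Y τ j)

include hS

/-- `π(a b) = ξ(Ψ(a₁ ⊗ b₁)) π(a₂) π(b₂)`. -/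
theorem mul_convT_cocycle : LinearMap.mul' K H ∘ₗ (DQBData.ofBialgebra K A).sq.convT
    (S.cocycle j ∘ₗ S.psi₂ Y τ) (S.piMul S.πL) = S.πL ∘ₗ LinearMap.mul' K A := by
  have hA : (ofCoalgebra K A).IsCoalgebra := isCoalgebra_ofCoalgebra
  refine TensorProduct.ext' fun a b => ?_
  -- `N` sends `h ⊗ p ⊗ q` to `jτ(σ(h₁)p) σπ(σ(h₂)q)`, so `N(h ⊗ Δ(b)) = σ(h)b` by the decomposition
  -- `a = jτ(a₁)σπ(a₂)`. Then `L` evaluated on `jτ(a₁) ⊗ π(a₂) ⊗ Δ(b)` is `π(jτ(a₁)σπ(a₂)b) =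
  -- π(ab)`, while expanding `N` on pure tensors produces `ξΨ` times `π(a)π(b)`.
  let N : H ⊗[K] (A ⊗[K] A) →ₗ[K] A := LinearMap.mul' K A ∘ₗ
    TensorProduct.map (j ∘ₗ τ) (S.σL ∘ₗ S.πL) ∘ₗ tensorAct S.actA S.actA
  let L : (A ⊗[K] H) ⊗[K] (A ⊗[K] A) →ₗ[K] H := S.πL ∘ₗ LinearMap.mul' K A ∘ₗ N.lTensor A ∘ₗ
    (TensorProduct.assoc K A H (A ⊗[K] A)).toLinearMap
  have hL (t : A ⊗[K] A) : L ((ofCoalgebra K A).convT (j ∘ₗ τ) S.πL a ⊗ₜ t) =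
      S.πL (LinearMap.mul' K A ((ofCoalgebra K A).convT (j ∘ₗ τ)
        (N ∘ₗ (TensorProduct.mk K H _).flip t ∘ₗ S.πL) a)) :=
    eq_of_tmul (f := L ∘ₗ (TensorProduct.mk K _ _).flip t ∘ₗ TensorProduct.map (j ∘ₗ τ) S.πL)
      (g := S.πL ∘ₗ LinearMap.mul' K A ∘ₗ TensorProduct.map (j ∘ₗ τ)
        (N ∘ₗ (TensorProduct.mk K H _).flip t ∘ₗ S.πL)) (fun x y => by simp [L]) _
  have hN : N ∘ₗ (TensorProduct.mk K H _).flip (Coalgebra.comul (R := K) b) =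
      LinearMap.mulRight K b ∘ₗ S.σL := by
    ext h
    have h1 := hS.mul_convT (S.actA (h ⊗ₜ b))
    have h2 : (ofCoalgebra K A).convT (j ∘ₗ τ) (S.σL ∘ₗ S.πL) (S.actA (h ⊗ₜ b)) =
        TensorProduct.map (j ∘ₗ τ) (S.σL ∘ₗ S.πL) (tensorAct S.actA S.actA
          (h ⊗ₜ Coalgebra.comul (R := K) b)) :=
      congrArg _ (S.isModuleCoalgebra_actA.comul_act h b)
    rw [h2, actA_tmul] at h1
    exact h1
  have e := eq_of_tmul (f := LinearMap.mul' K H ∘ₗ TensorProduct.map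
      (S.cocycle j ∘ₗ S.psi₂ Y τ) (S.piMul S.πL) ∘ₗ
      (TensorProduct.tensorTensorTensorComm K A A A A).toLinearMap ∘ₗ
      TensorProduct.mk K _ _ (Coalgebra.comul (R := K) a)) (g := L ∘ₗ TensorProduct.mk K _ _
        ((ofCoalgebra K A).convT (j ∘ₗ τ) S.πL a)) (fun p q => by
      simp only [LinearMap.comp_apply, TensorProduct.mk_apply, LinearEquiv.coe_coe]
      rw [hL]
      have h1 : N ∘ₗ (TensorProduct.mk K H _).flip (p ⊗ₜ q) ∘ₗ S.πL = LinearMap.mul' K A ∘ₗ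
          S.σL.lTensor A ∘ₗ (ofCoalgebra K A).convT (j ∘ₗ orbit Y.act (τ p) ∘ₗ S.πL)
            (LinearMap.mulRight K (S.πL q) ∘ₗ S.πL) := by
        rw [lTensor_comp_convT]
        have h2 : N ∘ₗ (TensorProduct.mk K H _).flip (p ⊗ₜ q) = LinearMap.mul' K A ∘ₗ
          (ofCoalgebra K H).convT (j ∘ₗ orbit Y.act (τ p))
            (S.σL ∘ₗ LinearMap.mulRight K (S.πL q)) := by
          ext h
          change LinearMap.mul' K A (TensorProduct.map (j ∘ₗ τ) (S.σL ∘ₗ S.πL)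
            (tensorAct S.actA S.actA (h ⊗ₜ (p ⊗ₜ q)))) = _
          rw [tensorAct_tmul, map_convT, LinearMap.comp_apply]
          congr 3
          · ext h
            simp [hS.τ_σ_mul]
          · ext h
            simp [S.πL_σL_mul]
        rw [← LinearMap.comp_assoc, h2, LinearMap.comp_assoc, S.isCoalgMap_π.convT_comp]
        rfl
      have h3 := hA.convT_rebracket (p := j ∘ₗ τ) (q := j ∘ₗ orbit Y.act (τ p) ∘ₗ S.πL)
        (r := LinearMap.mulRight K (S.πL q) ∘ₗ S.πL)
        (F := LinearMap.mul' K H ∘ₗ (S.πL ∘ₗ LinearMap.mul' K A).rTensor H)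
        (G := S.πL ∘ₗ LinearMap.mul' K A ∘ₗ (LinearMap.mul' K A ∘ₗ S.σL.lTensor A).lTensor A)
        (fun x y z => by simp [← mul_assoc, πL_mul_σL]) a
      simp only [LinearMap.comp_apply, lTensor_convT, rTensor_convT] at h3
      rw [h1]
      refine Eq.trans ?_ h3
      rw [convT_apply]
      refine eq_of_tmul (f := LinearMap.mul' K H ∘ₗ TensorProduct.map
        (S.cocycle j ∘ₗ S.psi₂ Y τ) (S.piMul S.πL) ∘ₗ
        (TensorProduct.tensorTensorTensorComm K A A A A).toLinearMap ∘ₗ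
        (TensorProduct.mk K _ _).flip (p ⊗ₜ q)) (g := LinearMap.mul' K H ∘ₗ TensorProduct.map
          ((S.πL ∘ₗ LinearMap.mul' K A) ∘ₗ (ofCoalgebra K A).convT (j ∘ₗ τ)
            (j ∘ₗ orbit Y.act (τ p) ∘ₗ S.πL)) (LinearMap.mulRight K (S.πL q) ∘ₗ S.πL))
        (fun y z => ?_) (Coalgebra.comul (R := K) a)
      simp [psi₂, psi_tmul, cocycle, map_convT]) (Coalgebra.comul (R := K) b)
  refine e.trans ?_
  simp only [LinearMap.comp_apply, TensorProduct.mk_apply]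
  rw [hL, ← LinearMap.comp_assoc, hN, LinearMap.comp_assoc, ← lTensor_convT]
  have h4 : ∀ t : A ⊗[K] A, LinearMap.mul' K A ((LinearMap.mulRight K b).lTensor A t) =
      LinearMap.mul' K A t * b :=
    eq_of_tmul (f := LinearMap.mul' K A ∘ₗ (LinearMap.mulRight K b).lTensor A)
      (g := LinearMap.mulRight K b ∘ₗ LinearMap.mul' K A) (fun x y => by simp [mul_assoc])
  rw [h4, hS.mul_convT, LinearMap.mul'_apply]

variable {lam : H →ₗ[K] K} (hlam : IsAdInvariantIntegral lam)

include hlam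

/-- The functional `γ = λ ξ Ψ` on `A ⊗ A` satisfies `π(a₁ b₁) γ(a₂, b₂) = γ(a₁, b₁) π(a₂) π(b₂)`. -/
theorem π_mul_convR : (DQBData.ofBialgebra K A).sq.convR (S.πL ∘ₗ LinearMap.mul' K A)
    (lam ∘ₗ S.cocycle j ∘ₗ S.psi₂ Y τ) = (DQBData.ofBialgebra K A).sq.convL
      (lam ∘ₗ S.cocycle j ∘ₗ S.psi₂ Y τ) (S.piMul S.πL) := by
  set E := S.cocycle j ∘ₗ S.psi₂ Y τ with hE
  -- With `E = ξΨ` and `P(a ⊗ b) = π(a)π(b)`, the cocycle identity gives `E(c₁)₁P(c₂) ⊗ E(c₁)₂ =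
  -- π(m(c₁)) ⊗ E(c₂)`. Applying `λ` to the second leg, the left integral property replaces `E₁
  -- λ(E₂)` by `λ(E)1`.
  have h := (DQBData.isCoalgebra_sq (K := K) (A := A)).mulLeg_comul (S.isCoalgMap_piMul S.isCoalgMap_π)
    (S.isCoalgMap_π.comp DQBData.isCoalgMap_mul') hS.mul_convT_cocycle
  ext a b
  have h1 := congrArg (TensorProduct.rid K H) (congrArg (lam.lTensor H) congr($h (a ⊗ₜ b)))
  rw [lTensor_convT] at h1
  refine h1.symm.trans ?_
  have h2 : ∀ t : H ⊗[K] H, TensorProduct.rid K H (lam.lTensor H (mulLeg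
      ((Coalgebra.comul (R := K) (A := H)).rTensor H t))) =
      TensorProduct.lid K H (lam.rTensor H t) :=
    eq_of_tmul (f := (TensorProduct.rid K H).toLinearMap ∘ₗ lam.lTensor H ∘ₗ mulLeg ∘ₗ
      (Coalgebra.comul (R := K) (A := H)).rTensor H)
      (g := (TensorProduct.lid K H).toLinearMap ∘ₗ lam.rTensor H) (fun x y => by
        have h3 := hlam.left_integral x
        have h4 : ∀ t : H ⊗[K] H, lam.lTensor H (mulLeg (t ⊗ₜ[K] y)) =
          (LinearMap.mulRight K y).rTensor K (lam.lTensor H t) :=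
          eq_of_tmul (f := lam.lTensor H ∘ₗ mulLeg ∘ₗ (TensorProduct.mk K _ H).flip y)
            (g := (LinearMap.mulRight K y).rTensor K ∘ₗ lam.lTensor H) (fun p q => by simp)
        simp [h4, h3])
  rw [LinearMap.comp_apply, ← rTensor_comp_convT, LinearMap.comp_apply, h2, rTensor_convT]
  rfl

theorem lam_cocycle_one_left (r : V) : lam (S.cocycle j (τ 1 ⊗ₜ r)) = Y.counit r := by
  simp [cocycle, hS.j_τ_one, hS.π_j, hlam.map_one]

theorem lam_cocycle_one_right (r : V) : lam (S.cocycle j (r ⊗ₜ τ 1)) = Y.counit r := by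
  simp [cocycle, hS.j_τ_one, hS.π_j, hlam.map_one]

/-- `λ ξ` is `H`-invariant. -/
theorem isActInvariant_cocycle :
    IsActInvariant (tensorAct Y.act Y.act) (lam ∘ₗ S.cocycle j) := by
  intro h z
  refine eq_of_tmul (f := lam ∘ₗ S.cocycle j ∘ₗ tensorAct Y.act Y.act ∘ₗ TensorProduct.mk K H _ h)
    (g := Coalgebra.counit (R := K) h • lam ∘ₗ S.cocycle j) (fun x y => ?_) z
  have hH : (ofCoalgebra K H).IsCoalgebra := isCoalgebra_ofCoalgebra
  -- It is enough to know `ξ(h₁x ⊗ h₂y)h₃ = hξ(x ⊗ y)` (this is `h2`): applying `S` gives `ξ(h(x ⊗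
  -- y)) = h₁ξ(x ⊗ y)S(h₂)`, and `λ` is ad-invariant.
  have h1 := hH.act_antipode (P := LinearMap.id) (r := LinearMap.mul' K H) IsCoalgMap.id
    (fun m => by simp) (fun m g h => by simp [mul_assoc])
    (S.cocycle j ∘ₗ orbit (tensorAct Y.act Y.act) (x ⊗ₜ y)) h
  have h2 : LinearMap.mul' K H ∘ₗ (ofCoalgebra K H).convT
      (S.cocycle j ∘ₗ orbit (tensorAct Y.act Y.act) (x ⊗ₜ y)) LinearMap.id =
      LinearMap.mulRight K (S.cocycle j (x ⊗ₜ y)) := by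
    ext h
    have e1 : (ofCoalgebra K H).convT (S.cocycle j ∘ₗ orbit (tensorAct Y.act Y.act) (x ⊗ₜ y))
        LinearMap.id h = (S.cocycle j).rTensor H ((ofCoalgebra K H).convT ((ofCoalgebra K H).convT
          (orbit Y.act x) (orbit Y.act y)) LinearMap.id h) := by
      rw [rTensor_convT, orbit_tensorAct]
    have e2 := hH.convT_rebracket (p := orbit Y.act x) (q := orbit Y.act y) (r := LinearMap.id)
      (F := LinearMap.mul' K H ∘ₗ (S.cocycle j).rTensor H)
      (G := S.πL ∘ₗ LinearMap.mul' K A ∘ₗ TensorProduct.map j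
        (LinearMap.mul' K A ∘ₗ TensorProduct.map j S.σL))
        (fun x y z => by simp [cocycle, ← mul_assoc, πL_mul_σL]) h
    have e3 : (LinearMap.mul' K A ∘ₗ TensorProduct.map j S.σL) ∘ₗ
        (ofCoalgebra K H).convT (orbit Y.act y) LinearMap.id =
          LinearMap.mulRight K (j y) ∘ₗ S.σL := by
      rw [LinearMap.comp_assoc, map_comp_convT]
      exact LinearMap.ext fun h => hS.mul_convT_act h y
    have e4 : ∀ t : A ⊗[K] A, LinearMap.mul' K A ((LinearMap.mulRight K (j y)).lTensor A t) =
        LinearMap.mul' K A t * j y :=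
      eq_of_tmul (f := LinearMap.mul' K A ∘ₗ (LinearMap.mulRight K (j y)).lTensor A)
        (g := LinearMap.mulRight K (j y) ∘ₗ LinearMap.mul' K A) (fun x y => by simp [mul_assoc])
    rw [LinearMap.comp_apply, e1]
    refine e2.trans ?_
    rw [LinearMap.comp_apply, LinearMap.comp_apply, map_convT, e3, ← lTensor_convT, e4,
      hS.mul_convT_act, mul_assoc, S.πL_σL_mul]
    rfl
  rw [h2] at h1
  simp only [LinearMap.comp_apply, orbit_apply, TensorProduct.mk_apply, LinearMap.smul_apply,
    smul_eq_mul] at h1 ⊢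
  rw [← h1]
  exact hlam.ad_left h _

end IsCoinvariants

end SplittingDatum

end

/-! ### Invertibility of `λξ` and the trivializing twist. -/

noncomputable section

namespace SplittingDatum

open CoalgData DQBData

variable {K : Type u} [Field K] {A : Type w} [Ring A] [Bialgebra K A]
  {H : Type v} [Ring H] [HopfAlgebra K H]

section CoalgMaps

variable (S : SplittingDatum K A H)

/-- `x ⊗ h ↦ x σ(h)`. -/
def mulσ : A ⊗[K] H →ₗ[K] A := LinearMap.mul' K A ∘ₗ S.σL.lTensor A

@[simp] theorem mulσ_tmul (x : A) (h : H) : S.mulσ (x ⊗ₜ h) = x * S.σL h := by simp [mulσ]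

theorem isCoalgMap_mulσ : IsCoalgMap ((ofCoalgebra K A).tensor (ofCoalgebra K H))
    (ofCoalgebra K A) S.mulσ := IsCoalgMap.comp isCoalgMap_mul' S.isCoalgMap_σ.lTensor

theorem isCoalgMap_actA : IsCoalgMap ((ofCoalgebra K H).tensor (ofCoalgebra K A))
    (ofCoalgebra K A) S.actA := S.isModuleCoalgebra_actA.isCoalgMap

/-- `x ⊗ (h ⊗ y) ↦ x σ(h) ⊗ y`. -/
def mulσFirst : A ⊗[K] (H ⊗[K] A) →ₗ[K] A ⊗[K] A :=
  S.mulσ.rTensor A ∘ₗ (TensorProduct.assoc K A H A).symm.toLinearMap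

@[simp] theorem mulσFirst_tmul (x y : A) (h : H) :
    S.mulσFirst (x ⊗ₜ (h ⊗ₜ y)) = (x * S.σL h) ⊗ₜ y := by simp [mulσFirst]

theorem isCoalgMap_mulσFirst : IsCoalgMap ((ofCoalgebra K A).tensor ((ofCoalgebra K H).tensor
    (ofCoalgebra K A))) (ofBialgebra K A).sq S.mulσFirst :=
  S.isCoalgMap_mulσ.rTensor.comp isCoalgMap_assoc_symm

theorem isCoalgMap_actA_lTensor : IsCoalgMap ((ofCoalgebra K A).tensor ((ofCoalgebra K H).tensor
    (ofCoalgebra K A))) (ofBialgebra K A).sq (S.actA.lTensor A) := S.isCoalgMap_actA.lTensor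

theorem isCoalgMap_mulσ_lTensor : IsCoalgMap ((ofCoalgebra K A).tensor ((ofCoalgebra K A).tensor
    (ofCoalgebra K H))) (ofBialgebra K A).sq (S.mulσ.lTensor A) := S.isCoalgMap_mulσ.lTensor

theorem isCoalgMap_dropRight_lTensor : IsCoalgMap ((ofCoalgebra K A).tensor
    ((ofCoalgebra K A).tensor (ofCoalgebra K H))) (ofBialgebra K A).sq
    ((dropRight K (ofCoalgebra K H).counit).lTensor A) :=
  isCoalgebra_ofCoalgebra.isCoalgMap_dropRight.lTensor

end CoalgMaps

namespace IsCoinvariants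

variable {S : SplittingDatum K A H} {V : Type w} [AddCommGroup V] [Module K V]
  {Y : YDData K H V} {τ : A →ₗ[K] V} {j : V →ₗ[K] A} (hS : S.IsCoinvariants Y τ j)

include hS

/-- Balancedness of `Ψ`, stated on the coalgebra `A ⊗ H ⊗ A`, where both ways of multiplying are
coalgebra maps and can be composed with convolutions. -/
theorem psi₂_mulσFirst : S.psi₂ Y τ ∘ₗ S.mulσFirst = S.psi₂ Y τ ∘ₗ S.actA.lTensor A := by
  ext x h y
  have := hS.psi_mul_σ (a := Y.act) hS.isYDCoalgebra.mul_act x h (τ y)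
  simp [psi₂, this, hS.τ_σ_mul]

theorem psi₂_mulσ_lTensor : S.psi₂ Y τ ∘ₗ S.mulσ.lTensor A =
    S.psi₂ Y τ ∘ₗ (dropRight K (ofCoalgebra K H).counit).lTensor A := by
  ext x y h
  simp [psi₂, hS.τ_mul_σ]
  rfl

/-- Maps that are balanced and trivial on the right factor through `psi₂`. -/
theorem comp_psi₂ {M : Type*} [AddCommGroup M] [Module K M] {F : A ⊗[K] A →ₗ[K] M}
    (h1 : F ∘ₗ S.mulσFirst = F ∘ₗ S.actA.lTensor A)
    (h2 : F ∘ₗ S.mulσ.lTensor A = F ∘ₗ (dropRight K (ofCoalgebra K H).counit).lTensor A) :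
    F ∘ₗ TensorProduct.map j j ∘ₗ S.psi₂ Y τ = F := by
  have e1 (x h y) : F ((x * S.σL h) ⊗ₜ y) = F (x ⊗ₜ (S.σL h * y)) := by
    simpa using congr($h1 (x ⊗ₜ (h ⊗ₜ y)))
  have e2 (x y h) : F (x ⊗ₜ (y * S.σL h)) = (ofCoalgebra K H).counit h • F (x ⊗ₜ y) := by
    simpa using congr($h2 (x ⊗ₜ (y ⊗ₜ h)))
  -- Triviality on the right reduces the second factor to `R`; balancedness then reduces the first.
  have e3 (x y : A) : F (x ⊗ₜ j (τ y)) = F (x ⊗ₜ y) := by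
    conv_rhs => rw [← hS.mul_convT y]
    have := isCoalgebra_ofCoalgebra.dropRight_convT (F ∘ₗ TensorProduct.mk K A A x ∘ₗ j ∘ₗ τ) y
    refine this.symm.trans ?_
    rw [← S.isCoalgMap_π.counit_comp]
    exact eq_of_tmul (f := (TensorProduct.rid K M).toLinearMap ∘ₗ TensorProduct.map
      (F ∘ₗ TensorProduct.mk K A A x ∘ₗ j ∘ₗ τ) ((ofCoalgebra K H).counit ∘ₗ S.πL))
      (g := F ∘ₗ TensorProduct.mk K A A x ∘ₗ LinearMap.mul' K A ∘ₗ
        TensorProduct.map (j ∘ₗ τ) (S.σL ∘ₗ S.πL)) (fun y z => by simp [e2]) _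
  refine TensorProduct.ext' fun x y => ?_
  conv_rhs => rw [← hS.mul_convT x]
  simp only [LinearMap.comp_apply, psi₂, LinearMap.lTensor_tmul, psi_tmul]
  exact eq_of_tmul (f := F ∘ₗ TensorProduct.map j j ∘ₗ
    TensorProduct.map τ (orbit Y.act (τ y) ∘ₗ S.πL)) (g := F ∘ₗ (TensorProduct.mk K A A).flip y ∘ₗ
      LinearMap.mul' K A ∘ₗ TensorProduct.map (j ∘ₗ τ) (S.σL ∘ₗ S.πL)) (fun p q => by
        simp [e1, ← hS.τ_σ_mul, e3]) _

/-- `λ ξ` is convolution invertible if the coradical of `A` is `σ(H)`. -/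
theorem exists_isConvInv_cocycle {lam : H →ₗ[K] K} (hlam : IsAdInvariantIntegral lam)
    (hcorad : LinearMap.range S.σL = (ofCoalgebra K A).coradical) :
    ∃ v, (smashCoalg Y Y.toCoalgData Y.act).IsConvInv (lam ∘ₗ S.cocycle j) v := by
  set X := smashCoalg Y Y.toCoalgData Y.act with hX
  refine hS.isModuleCoalgebra₂.coalgebra.exists_isConvInv _ fun c => ?_
  obtain ⟨z, rfl⟩ := hS.psi₂_surjective c
  -- On `A ⊗ A` the pulled back difference vanishes on `σ(H) ⊗ A`, which is the coradical tensored
  -- with `A`, so its convolution operator is locally nilpotent. `Ψ` intertwines this operator with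
  -- the one on `R ⊗ R` (`h1`).
  set F := (lam ∘ₗ S.cocycle j - X.counit) ∘ₗ S.psi₂ Y τ with hF
  obtain ⟨n, hn⟩ := exists_pow_convR_eq_zero (F := F) (Z := ofCoalgebra K A) (fun x hx d => by
    rw [← hcorad] at hx
    obtain ⟨h, rfl⟩ := hx
    rw [hF, LinearMap.comp_apply, hS.psi₂_σ_tmul, LinearMap.sub_apply, LinearMap.comp_apply,
      hS.lam_cocycle_one_left hlam]
    simp [hX, smashCoalg, hS.counit_τ]) z
  refine ⟨n, ?_⟩
  have h1 : X.convR LinearMap.id (lam ∘ₗ S.cocycle j - X.counit) ∘ₗ S.psi₂ Y τ =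
      S.psi₂ Y τ ∘ₗ (ofBialgebra K A).sq.convR LinearMap.id F := by
    rw [hS.isCoalgMap_psi₂.convR_comp, comp_convR]
    rfl
  have h2 : ∀ n z, ((X.convR LinearMap.id (lam ∘ₗ S.cocycle j - X.counit) :
      Module.End K (V ⊗[K] V)) ^ n) (S.psi₂ Y τ z) = S.psi₂ Y τ
        ((((ofBialgebra K A).sq.convR LinearMap.id F : Module.End K (A ⊗[K] A)) ^ n) z) := by
    intro n
    induction n with
    | zero => intro z; simp
    | succ n ih =>
      intro z
      rw [pow_succ, pow_succ, Module.End.mul_apply, Module.End.mul_apply, ← ih]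
      exact congrArg _ congr($h1 z)
  rw [h2]
  exact (congrArg _ hn).trans (map_zero _)

/-- The gauge transformation of `A` given by the inverse `v` of a functional `γ`. -/
def gaugeOfInv {γ v : V ⊗[K] V →ₗ[K] K} (hv : (smashCoalg Y Y.toCoalgData Y.act).IsConvInv γ v)
    (h1 : ∀ r, γ (τ 1 ⊗ₜ r) = Y.counit r) (h2 : ∀ r, γ (r ⊗ₜ τ 1) = Y.counit r) :
    (ofBialgebra K A).Gauge :=
  -- Unitality is computed directly for `γ`; for its inverse `v` it follows from the general fact
  -- about inverses of gauge transformations.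
  let g : (ofBialgebra K A).Gauge :=
    { toFun := γ ∘ₗ S.psi₂ Y τ
      inv := v ∘ₗ S.psi₂ Y τ
      isConvInv := hS.isCoalgMap_psi₂.isConvInv_comp hv
      one_left := fun x => by
        have e := hS.psi₂_σ_tmul 1 x
        rw [S.σL_one, hS.isYDCoalgebra.one_act] at e
        change γ (S.psi₂ Y τ (1 ⊗ₜ x)) = _
        rw [e, h1, hS.counit_τ]
        rfl
      one_right := fun x => by
        change γ (S.psi₂ Y τ (x ⊗ₜ 1)) = _
        rw [hS.psi₂_tmul_one, h2, hS.counit_τ]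
        rfl }
  { toFun := v ∘ₗ S.psi₂ Y τ
    inv := γ ∘ₗ S.psi₂ Y τ
    isConvInv := g.isConvInv.symm
    one_left := g.inv_one_left
    one_right := g.inv_one_right }

end IsCoinvariants

/-- The properties of the gauge transformation `g` of `A` used to twist `A` to a bosonization:
it corresponds to an invariant functional `v` on `R ⊗ R`, with inverse `γ`, and
`π(a₁ b₁) g⁻¹(a₂, b₂) = g⁻¹(a₁, b₁) π(a₂) π(b₂)`. -/
structure IsTrivializing (S : SplittingDatum K A H) {V : Type w} [AddCommGroup V] [Module K V]
    (Y : YDData K H V) (τ : A →ₗ[K] V) (γ v : V ⊗[K] V →ₗ[K] K) (g : (ofBialgebra K A).Gauge) :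
    Prop where
  isConvInv : (smashCoalg Y Y.toCoalgData Y.act).IsConvInv γ v
  inv_invariant : IsActInvariant (tensorAct Y.act Y.act) γ
  invariant : IsActInvariant (tensorAct Y.act Y.act) v
  toFun_eq : g.toFun = v ∘ₗ S.psi₂ Y τ
  inv_eq : g.inv = γ ∘ₗ S.psi₂ Y τ
  π_convR : (ofBialgebra K A).sq.convR (S.πL ∘ₗ LinearMap.mul' K A) g.inv =
    (ofBialgebra K A).sq.convL g.inv (S.piMul S.πL)

theorem IsCoinvariants.isTrivializing {S : SplittingDatum K A H} {V : Type w} [AddCommGroup V]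
    [Module K V] {Y : YDData K H V} {τ : A →ₗ[K] V} {j : V →ₗ[K] A}
    (hS : S.IsCoinvariants Y τ j) {lam : H →ₗ[K] K} (hlam : IsAdInvariantIntegral lam)
    {v : V ⊗[K] V →ₗ[K] K}
    (hv : (smashCoalg Y Y.toCoalgData Y.act).IsConvInv (lam ∘ₗ S.cocycle j) v) :
    S.IsTrivializing Y τ (lam ∘ₗ S.cocycle j) v (hS.gaugeOfInv hv
      (hS.lam_cocycle_one_left hlam) (hS.lam_cocycle_one_right hlam)) where
  isConvInv := hv
  inv_invariant := hS.isActInvariant_cocycle hlam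
  invariant := hS.isModuleCoalgebra₂.isActInvariant_inv (hS.isActInvariant_cocycle hlam) hv
  toFun_eq := rfl
  inv_eq := rfl
  π_convR := hS.π_mul_convR hlam

namespace IsTrivializing

variable {S : SplittingDatum K A H} {V : Type w} [AddCommGroup V] [Module K V]
  {Y : YDData K H V} {τ : A →ₗ[K] V} {j : V →ₗ[K] A} {γ v : V ⊗[K] V →ₗ[K] K}
  {g : (ofBialgebra K A).Gauge} (hS : S.IsCoinvariants Y τ j) (hg : S.IsTrivializing Y τ γ v g)

include hg

/-- The purpose of the twist: `v * (πm) * γ = v * γ * (π·π) = π·π`, by the commutation relation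
between `πm` and `γ`. -/
theorem π_twist_mul : S.πL ∘ₗ ((ofBialgebra K A).twist g).mul = S.piMul S.πL := by
  have hX := isCoalgebra_sq (K := K) (A := A)
  rw [twist_mul, comp_convR, comp_convL, hX.convR_convL, hg.π_convR, g.isConvInv.cancel hX]

include hS

/-- The original multiplication commutes with left multiplication by `σ(h)`, and convolving with
invariant functionals preserves this. -/
theorem twist_mul_actFirst (h : H) (z : A ⊗[K] A) :
    ((ofBialgebra K A).twist g).mul (actFirst S.actA (h ⊗ₜ z)) =
      S.actA (h ⊗ₜ ((ofBialgebra K A).twist g).mul z) := by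
  have hM := S.isModuleCoalgebra_actA.tensor
    (isCoalgebra_ofCoalgebra : (ofCoalgebra K A).IsCoalgebra)
  have i1 : IsActInvariant (actFirst S.actA) g.toFun := by
    rw [hg.toFun_eq]; exact hg.invariant.comp hS.psi₂_act
  have i2 : IsActInvariant (actFirst S.actA) g.inv := by
    rw [hg.inv_eq]; exact hg.inv_invariant.comp hS.psi₂_act
  refine hM.convR_linear i2 (fun h x => hM.convL_linear i1 (fun h x => ?_) h x) h z
  exact eq_of_tmul (f := LinearMap.mul' K A ∘ₗ actFirst S.actA ∘ₗ TensorProduct.mk K H _ h)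
    (g := S.actA ∘ₗ TensorProduct.mk K H _ h ∘ₗ LinearMap.mul' K A)
    (fun x y => by simp [mul_assoc]) x

/-- In `v * (τm) * γ` each of the three factors is balanced over `H` and sees a right factor `σ(h)`
only through `ε(h)`. Both properties are equalities of composites with coalgebra maps, so they pass
to the convolution product, and `comp_psi₂` applies. -/
theorem τ_twist_mul : τ ∘ₗ ((ofBialgebra K A).twist g).mul ∘ₗ TensorProduct.map j j ∘ₗ
    S.psi₂ Y τ = τ ∘ₗ ((ofBialgebra K A).twist g).mul := by
  have e : τ ∘ₗ ((ofBialgebra K A).twist g).mul = (ofBialgebra K A).sq.convR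
      ((ofBialgebra K A).sq.convL g.toFun (τ ∘ₗ LinearMap.mul' K A)) g.inv := by
    rw [twist_mul, comp_convR, comp_convL]
  rw [← LinearMap.comp_assoc]
  refine hS.comp_psi₂ ?_ ?_
  · rw [e, S.isCoalgMap_mulσFirst.convR_comp, S.isCoalgMap_mulσFirst.convL_comp,
      S.isCoalgMap_actA_lTensor.convR_comp, S.isCoalgMap_actA_lTensor.convL_comp, hg.toFun_eq,
      hg.inv_eq]
    simp only [LinearMap.comp_assoc, hS.psi₂_mulσFirst]
    congr 2
    ext x h y
    simp [mul_assoc]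
  · rw [e, S.isCoalgMap_mulσ_lTensor.convR_comp, S.isCoalgMap_mulσ_lTensor.convL_comp,
      isCoalgMap_dropRight_lTensor.convR_comp, isCoalgMap_dropRight_lTensor.convL_comp,
      hg.toFun_eq, hg.inv_eq]
    simp only [LinearMap.comp_assoc, hS.psi₂_mulσ_lTensor]
    congr 2
    ext x y h
    simp [← mul_assoc, hS.τ_mul_σ]
    rfl

end IsTrivializing

end SplittingDatum

end

/-! ### Descent of the twisted multiplication to `R`. -/

noncomputable section

section Linear

open CoalgData

variable {K : Type u} [Field K] {H : Type v} [Ring H] [HopfAlgebra K H] {V W W' : Type*}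
  [AddCommGroup V] [Module K V] [AddCommGroup W] [Module K W] [AddCommGroup W'] [Module K W']
  {aV : H ⊗[K] V →ₗ[K] V} {aW : H ⊗[K] W →ₗ[K] W} {aW' : H ⊗[K] W' →ₗ[K] W'}

theorem lTensor_act {f : W →ₗ[K] W'} (hf : ∀ h x, f (aW (h ⊗ₜ x)) = aW' (h ⊗ₜ f x)) (h : H)
    (z : V ⊗[K] W) : f.lTensor V (tensorAct aV aW (h ⊗ₜ z)) =
      tensorAct aV aW' (h ⊗ₜ f.lTensor V z) :=
  tensorAct_naturality (f := LinearMap.id) (fun _ _ => rfl) hf h z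

theorem dropRight_act {ε : W →ₗ[K] K} (hε : IsActInvariant aW ε) (h : H) (z : V ⊗[K] W) :
    dropRight K ε (tensorAct aV aW (h ⊗ₜ z)) = aV (h ⊗ₜ dropRight K ε z) := by
  refine eq_of_tmul (f := dropRight K ε ∘ₗ tensorAct aV aW ∘ₗ TensorProduct.mk K H _ h)
    (g := aV ∘ₗ TensorProduct.mk K H _ h ∘ₗ dropRight K ε) (fun x y => ?_) z
  have e : ε ∘ₗ orbit aW y = ε y • (ofCoalgebra K H).counit := by
    ext h
    rw [LinearMap.comp_apply, orbit_apply, hε, mul_comm]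
    rfl
  have h1 := isCoalgebra_ofCoalgebra.dropRight_convT (ε y • orbit aV x) h
  simp only [LinearMap.comp_apply, TensorProduct.mk_apply, dropRight_tmul, tensorAct_tmul]
  rw [dropRight, LinearMap.comp_apply, lTensor_convT, e, TensorProduct.tmul_smul, map_smul]
  refine Eq.trans ?_ h1
  simp only [convT_apply, TensorProduct.map_smul_left, TensorProduct.map_smul_right]
  rfl

theorem dropLeft_act {ε : V →ₗ[K] K} (hε : IsActInvariant aV ε) (h : H) (z : V ⊗[K] W) :
    dropLeft ε (tensorAct aV aW (h ⊗ₜ z)) = aW (h ⊗ₜ dropLeft ε z) := by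
  refine eq_of_tmul (f := dropLeft ε ∘ₗ tensorAct aV aW ∘ₗ TensorProduct.mk K H _ h)
    (g := aW ∘ₗ TensorProduct.mk K H _ h ∘ₗ dropLeft ε) (fun x y => ?_) z
  have e : ε ∘ₗ orbit aV x = ε x • (ofCoalgebra K H).counit := by
    ext h
    rw [LinearMap.comp_apply, orbit_apply, hε, mul_comm]
    rfl
  have h1 := isCoalgebra_ofCoalgebra.dropLeft_convT (ε x • orbit aW y) h
  simp only [LinearMap.comp_apply, TensorProduct.mk_apply, dropLeft_tmul, tensorAct_tmul]
  rw [dropLeft, LinearMap.comp_apply, rTensor_convT, e, TensorProduct.tmul_smul, map_smul]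
  refine Eq.trans ?_ h1
  simp only [convT_apply, TensorProduct.map_smul_left, TensorProduct.map_smul_right]
  rfl

end Linear

namespace SplittingDatum

open CoalgData DQBData

variable {K : Type u} [Field K] {A : Type w} [Ring A] [Bialgebra K A]
  {H : Type v} [Ring H] [HopfAlgebra K H]
  {S : SplittingDatum K A H} {V : Type w} [AddCommGroup V] [Module K V]
  {Y : YDData K H V} {τ : A →ₗ[K] V} {j : V →ₗ[K] A}

section

variable (S) {W : Type*} [AddCommGroup W] [Module K W] {Z : CoalgData K W}
  {aW : H ⊗[K] W →ₗ[K] W}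

theorem psi_dropRight (hε : IsActInvariant aW Z.counit) :
    dropRight K Z.counit ∘ₗ S.psi τ aW = τ ∘ₗ dropRight K Z.counit := by
  refine TensorProduct.ext' fun x y => ?_
  have e : Z.counit ∘ₗ orbit aW y ∘ₗ S.πL = Z.counit y • (ofCoalgebra K A).counit := by
    ext x
    rw [LinearMap.comp_apply, LinearMap.comp_apply, orbit_apply, hε, S.counit_π, mul_comm]
    rfl
  have h1 := isCoalgebra_ofCoalgebra.dropRight_convT (Z.counit y • τ) x
  rw [LinearMap.comp_apply, psi_tmul, dropRight, LinearMap.comp_apply, lTensor_convT, e]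
  refine Eq.trans ?_ (h1.trans (by simp))
  simp only [convT_apply, TensorProduct.map_smul_left, TensorProduct.map_smul_right]
  rfl

/-- `Ψ(a ⊗ Ψ(b ⊗ w)) = Ψ(a₁ ⊗ b₁) ⊗ π(a₂) π(b₂) w`. -/
theorem assoc_symm_psi (hW : ∀ g h x, aW ((g * h) ⊗ₜ x) = aW (g ⊗ₜ aW (h ⊗ₜ x))) (a b : A)
    (w : W) : (TensorProduct.assoc K V V W).symm
      (S.psi τ (tensorAct Y.act aW) (a ⊗ₜ S.psi τ aW (b ⊗ₜ w))) =
      (ofBialgebra K A).sq.convT (S.psi₂ Y τ) (orbit aW w ∘ₗ S.piMul S.πL) (a ⊗ₜ b) := by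
  rw [psi_tmul (y := w)]
  refine eq_of_tmul (f := (TensorProduct.assoc K V V W).symm.toLinearMap ∘ₗ
    S.psi τ (tensorAct Y.act aW) ∘ₗ TensorProduct.mk K A _ a ∘ₗ
      TensorProduct.map τ (orbit aW w ∘ₗ S.πL))
    (g := TensorProduct.map (S.psi₂ Y τ) (orbit aW w ∘ₗ S.piMul S.πL) ∘ₗ
      (TensorProduct.tensorTensorTensorComm K A A A A).toLinearMap ∘ₗ
      TensorProduct.mk K _ _ (Coalgebra.comul (R := K) a)) (fun p q => ?_)
      (Coalgebra.comul (R := K) b)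
  simp only [LinearMap.comp_apply, TensorProduct.mk_apply, LinearEquiv.coe_coe,
    TensorProduct.map_tmul]
  rw [psi_tmul, orbit_tensorAct, S.isCoalgMap_π.convT_comp,
    isCoalgebra_ofCoalgebra.assoc_symm_convT, convT_apply]
  exact eq_of_tmul (f := TensorProduct.map ((ofCoalgebra K A).convT τ (orbit Y.act (τ p) ∘ₗ S.πL))
      (orbit aW (orbit aW w (S.πL q)) ∘ₗ S.πL))
    (g := TensorProduct.map (S.psi₂ Y τ) (orbit aW w ∘ₗ S.piMul S.πL) ∘ₗ
      (TensorProduct.tensorTensorTensorComm K A A A A).toLinearMap ∘ₗ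
      (TensorProduct.mk K _ _).flip (p ⊗ₜ q)) (fun y z => by simp [psi₂, psi_tmul, hW]) _

end

namespace IsCoinvariants

variable (hS : S.IsCoinvariants Y τ j) {W D : Type*} [AddCommGroup W] [Module K W]
  [AddCommGroup D] [Module K D] {aW : H ⊗[K] W →ₗ[K] W}

include hS

/-- An invariant `f` does not see the action of `π(a₂)`, so only `ε(a)` survives of the first
factor. -/
theorem psi_dropLeft {f : W →ₗ[K] K} (hf : IsActInvariant aW f) (q : D →ₗ[K] W) :
    (f ∘ₗ dropLeft Y.counit) ∘ₗ S.psi τ aW ∘ₗ q.lTensor A =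
      (f ∘ₗ q) ∘ₗ dropLeft (ofCoalgebra K A).counit := by
  refine TensorProduct.ext' fun x d => ?_
  have e : f ∘ₗ orbit aW (q d) ∘ₗ S.πL = f (q d) • (ofCoalgebra K A).counit := by
    ext x
    rw [LinearMap.comp_apply, LinearMap.comp_apply, orbit_apply, hf, S.counit_π, mul_comm]
    rfl
  have h1 := isCoalgebra_ofCoalgebra.dropLeft_convT (f ∘ₗ orbit aW (q d) ∘ₗ S.πL) x
  rw [← hS.coalg.counit_comp] at h1
  rw [LinearMap.comp_apply, LinearMap.comp_apply (S.psi τ aW), LinearMap.lTensor_tmul, psi_tmul]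
  refine Eq.trans ?_ (h1.trans ?_)
  · rw [convT_apply, convT_apply]
    exact eq_of_tmul (f := (f ∘ₗ dropLeft Y.counit) ∘ₗ TensorProduct.map τ
      (orbit aW (q d) ∘ₗ S.πL)) (g := (TensorProduct.lid K K).toLinearMap ∘ₗ
        TensorProduct.map (Y.counit ∘ₗ τ) (f ∘ₗ orbit aW (q d) ∘ₗ S.πL)) (fun x y => by simp) _
  · rw [e]
    simp [mul_comm]

theorem counit_invariant : IsActInvariant Y.act Y.counit := hS.isYDCoalgebra.counit_act

theorem psi₂_dropRight : dropRight K Y.counit ∘ₗ S.psi₂ Y τ =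
    τ ∘ₗ dropRight K (ofCoalgebra K A).counit := by
  rw [psi₂, ← LinearMap.comp_assoc, S.psi_dropRight (Z := Y.toCoalgData) hS.counit_invariant,
    LinearMap.comp_assoc, ← hS.coalg.counit_comp]
  congr 1
  ext x y
  simp

theorem psi₃_dropRight : (dropRight K Y.counit).lTensor V ∘ₗ S.psi₃ Y τ =
    S.psi₂ Y τ ∘ₗ (dropRight K (ofCoalgebra K A).counit).lTensor A := by
  rw [psi₃, ← LinearMap.comp_assoc, S.psi_naturality (dropRight_act hS.counit_invariant),
    LinearMap.comp_assoc, ← LinearMap.lTensor_comp, hS.psi₂_dropRight, LinearMap.lTensor_comp,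
    ← LinearMap.comp_assoc]
  rfl

theorem coact_psi₂ : mulLeg ∘ₗ (ofBialgebra K A).sq.convT
      (tensorCoact Y.coact Y.coact ∘ₗ S.psi₂ Y τ) (S.piMul S.πL) =
    (ofBialgebra K A).sq.convT (S.piMul S.πL) (S.psi₂ Y τ) :=
  hS.coact_psi hS.compatible hS.coact_τ

theorem coact_psi₃ : mulLeg ∘ₗ (ofBialgebra K A).cube.convT
      (tensorCoact Y.coact (tensorCoact Y.coact Y.coact) ∘ₗ S.psi₃ Y τ)
        (S.piMul (S.piMul S.πL)) =
    (ofBialgebra K A).cube.convT (S.piMul (S.piMul S.πL)) (S.psi₃ Y τ) :=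
  hS.coact_psi (hS.compatible.tensor hS.compatible) hS.coact_psi₂

end IsCoinvariants

/-- The multiplication on `R` induced by the twisted multiplication of `A`. -/
def descMul (τ : A →ₗ[K] V) (j : V →ₗ[K] A) (g : (ofBialgebra K A).Gauge) :
    V ⊗[K] V →ₗ[K] V :=
  τ ∘ₗ ((ofBialgebra K A).twist g).mul ∘ₗ TensorProduct.map j j

/-- The reassociator on `R` corresponding to that of the twist of `A`. -/
def descReassoc (Y : YDData K H V) (γ v : V ⊗[K] V →ₗ[K] K) (m : V ⊗[K] V →ₗ[K] V) :
    V ⊗[K] (V ⊗[K] V) →ₗ[K] K :=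
  (Y.tensor (Y.tensor Y)).convL (v ∘ₗ m.lTensor V) <|
  (Y.tensor (Y.tensor Y)).convL (v ∘ₗ dropLeft Y.counit) <|
  (Y.tensor (Y.tensor Y)).convL (γ ∘ₗ (dropRight K Y.counit).lTensor V) (γ ∘ₗ mulFirst K m)

namespace IsTrivializing

variable {γ v : V ⊗[K] V →ₗ[K] K}
  {g : (ofBialgebra K A).Gauge} (hS : S.IsCoinvariants Y τ j) (hg : S.IsTrivializing Y τ γ v g)
  {W : Type*} [AddCommGroup W] [Module K W] {aW : H ⊗[K] W →ₗ[K] W}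

include hS hg

theorem descMul_psi₂ : descMul τ j g ∘ₗ S.psi₂ Y τ = τ ∘ₗ ((ofBialgebra K A).twist g).mul :=
  hg.τ_twist_mul hS

theorem descMul_act (h : H) (z : V ⊗[K] V) : descMul τ j g (tensorAct Y.act Y.act (h ⊗ₜ z)) =
    Y.act (h ⊗ₜ descMul τ j g z) := by
  obtain ⟨z, rfl⟩ := hS.psi₂_surjective z
  have e (z) : descMul τ j g (S.psi₂ Y τ z) = τ (((ofBialgebra K A).twist g).mul z) :=
    congr($(hg.descMul_psi₂ hS) z)
  rw [← hS.psi₂_act, e, e, hg.twist_mul_actFirst hS, actA_tmul, hS.τ_σ_mul]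

/-- Multiplicativity of `π` for the twist is used here: the factor `π(a₂)π(b₂)` acting on `w` equals
`π` of the twisted product of `a₂` and `b₂`, and the twisted multiplication is a coalgebra map. It
makes multiplication in the leading factors commute with `Ψ`. -/
theorem psi_twist_mul (hW : ∀ g h x, aW ((g * h) ⊗ₜ x) = aW (g ⊗ₜ aW (h ⊗ₜ x))) (a b : A)
    (w : W) : mulFirst K (descMul τ j g)
      (S.psi τ (tensorAct Y.act aW) (a ⊗ₜ S.psi τ aW (b ⊗ₜ w))) =
      S.psi τ aW (((ofBialgebra K A).twist g).mul (a ⊗ₜ b) ⊗ₜ w) := by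
  rw [mulFirst, LinearMap.comp_apply, LinearEquiv.coe_coe, S.assoc_symm_psi hW, rTensor_convT,
    hg.descMul_psi₂ hS, psi_tmul, ← hg.π_twist_mul]
  have := (isCoalgMap_twist_mul g).convT_comp τ (orbit aW w ∘ₗ S.πL)
  exact congr($this (a ⊗ₜ b)).symm

theorem mulFirst_act (hW1 : ∀ x, aW (1 ⊗ₜ x) = x)
    (hW : ∀ g h x, aW ((g * h) ⊗ₜ x) = aW (g ⊗ₜ aW (h ⊗ₜ x))) (h : H)
    (z : V ⊗[K] (V ⊗[K] W)) : mulFirst K (descMul τ j g)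
      (tensorAct Y.act (tensorAct Y.act aW) (h ⊗ₜ z)) =
      tensorAct Y.act aW (h ⊗ₜ mulFirst K (descMul τ j g) z) := by
  refine eq_of_tmul₃ (f := mulFirst K (descMul τ j g) ∘ₗ tensorAct Y.act (tensorAct Y.act aW) ∘ₗ
    TensorProduct.mk K H _ h) (g := tensorAct Y.act aW ∘ₗ TensorProduct.mk K H _ h ∘ₗ
      mulFirst K (descMul τ j g)) (fun x y w => ?_) z
  have hVW := tensorAct_mul (aV := Y.act) (aW := aW) hS.isYDCoalgebra.mul_act hW
  have hVW1 := tensorAct_one (aV := Y.act) (aW := aW) hS.isYDCoalgebra.one_act hW1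
  have e : x ⊗ₜ[K] (y ⊗ₜ[K] w) = S.psi τ (tensorAct Y.act aW) (j x ⊗ₜ S.psi τ aW (j y ⊗ₜ w)) := by
    rw [hS.psi_j hW1, hS.psi_j hVW1]
  simp only [LinearMap.comp_apply, TensorProduct.mk_apply]
  rw [e, ← hS.psi_act hVW, hg.psi_twist_mul hS hW, ← hS.psi_act hW, actFirst_tmul, actFirst_tmul,
    hg.psi_twist_mul hS hW, ← hg.twist_mul_actFirst hS, actFirst_tmul]

/-- The two sides are compared after multiplying the `H`-leg by `π(a₂)π(b₂)`, which is cancellable.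
Both then give `π(m'(c₁)) ⊗ τ(m'(c₂))`, where `m'` is the twisted multiplication: one by `coact_τ`
composed with `m'`, the other by `coact_psi₂`. -/
theorem descMul_coact (z : V ⊗[K] V) : Y.coact (descMul τ j g z) =
    (descMul τ j g).lTensor H (tensorCoact Y.coact Y.coact z) := by
  have hX := isCoalgebra_sq (K := K) (A := A)
  have key : Y.coact ∘ₗ descMul τ j g ∘ₗ S.psi₂ Y τ = (descMul τ j g).lTensor H ∘ₗ
      tensorCoact Y.coact Y.coact ∘ₗ S.psi₂ Y τ := by
    refine hX.mulLeg_cancel (S.isCoalgMap_piMul S.isCoalgMap_π) ?_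
    have h1 := (isCoalgMap_twist_mul g).convT_comp (Y.coact ∘ₗ τ) S.πL
    have h2 := (isCoalgMap_twist_mul g).convT_comp S.πL τ
    have h3 : mulLeg ∘ₗ ((descMul τ j g).lTensor H).rTensor H =
        (descMul τ j g).lTensor H ∘ₗ mulLeg (K := K) (H := H) := by
      refine TensorProduct.ext' fun x h => ?_
      induction x using TensorProduct.induction_on with
      | zero => simp
      | add a b ha hb => simp only [map_add, TensorProduct.add_tmul, ha, hb]
      | tmul x y => simp
    have h4 : (ofBialgebra K A).sq.convT ((descMul τ j g).lTensor H ∘ₗ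
        tensorCoact Y.coact Y.coact ∘ₗ S.psi₂ Y τ) (S.piMul S.πL) =
        ((descMul τ j g).lTensor H).rTensor H ∘ₗ (ofBialgebra K A).sq.convT
          (tensorCoact Y.coact Y.coact ∘ₗ S.psi₂ Y τ) (S.piMul S.πL) :=
      (rTensor_comp_convT _ _ _).symm
    have h5 := congr($h3 ∘ₗ (ofBialgebra K A).sq.convT
      (tensorCoact Y.coact Y.coact ∘ₗ S.psi₂ Y τ) (S.piMul S.πL))
    rw [LinearMap.comp_assoc, LinearMap.comp_assoc, hS.coact_psi₂, lTensor_comp_convT,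
      hg.descMul_psi₂ hS] at h5
    refine Eq.trans ?_ (congr(mulLeg ∘ₗ $h4).trans h5).symm
    rw [← hg.π_twist_mul, hg.descMul_psi₂ hS]
    refine Eq.trans ?_ h2
    refine Eq.trans ?_ congr($(hS.coact_τ) ∘ₗ ((ofBialgebra K A).twist g).mul)
    rw [LinearMap.comp_assoc]
    exact congr(mulLeg ∘ₗ $h1).symm
  obtain ⟨z, rfl⟩ := hS.psi₂_surjective z
  exact congr($key z)

theorem descMul_lTensor_psi₃ : (descMul τ j g).lTensor V ∘ₗ S.psi₃ Y τ =
    S.psi₂ Y τ ∘ₗ ((ofBialgebra K A).twist g).mul.lTensor A := by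
  rw [psi₃, ← LinearMap.comp_assoc, S.psi_naturality (hg.descMul_act hS),
    LinearMap.comp_assoc, ← LinearMap.lTensor_comp, hg.descMul_psi₂ hS, LinearMap.lTensor_comp,
    ← LinearMap.comp_assoc]
  rfl

theorem mulFirst_psi₃ : mulFirst K (descMul τ j g) ∘ₗ S.psi₃ Y τ =
    S.psi₂ Y τ ∘ₗ mulFirst K ((ofBialgebra K A).twist g).mul := by
  ext x y z
  have := hg.psi_twist_mul hS hS.isYDCoalgebra.mul_act x y (τ z)
  simpa [psi₃, psi₂] using this

theorem mulFirst_psi₄ : mulFirst K (descMul τ j g) ∘ₗ S.psi₄ Y τ =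
    S.psi₃ Y τ ∘ₗ mulFirst K ((ofBialgebra K A).twist g).mul := by
  ext x y z t
  have := hg.psi_twist_mul hS hS.isModuleCoalgebra₂.mul_act x y (S.psi₂ Y τ (z ⊗ₜ t))
  simpa [psi₄, psi₃] using this

theorem descMul_lTensor_psi₄ : ((descMul τ j g).lTensor V).lTensor V ∘ₗ S.psi₄ Y τ =
    S.psi₃ Y τ ∘ₗ (((ofBialgebra K A).twist g).mul.lTensor A).lTensor A := by
  rw [psi₄, ← LinearMap.comp_assoc, S.psi_naturality (lTensor_act (hg.descMul_act hS)),
    LinearMap.comp_assoc, ← LinearMap.lTensor_comp, hg.descMul_lTensor_psi₃ hS,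
    LinearMap.lTensor_comp, ← LinearMap.comp_assoc]
  rfl

theorem mulFirst_lTensor_psi₄ : (mulFirst K (descMul τ j g)).lTensor V ∘ₗ S.psi₄ Y τ =
    S.psi₃ Y τ ∘ₗ (mulFirst K ((ofBialgebra K A).twist g).mul).lTensor A := by
  rw [psi₄, ← LinearMap.comp_assoc, S.psi_naturality (hg.mulFirst_act hS
    hS.isYDCoalgebra.one_act hS.isYDCoalgebra.mul_act),
    LinearMap.comp_assoc, ← LinearMap.lTensor_comp, hg.mulFirst_psi₃ hS,
    LinearMap.lTensor_comp, ← LinearMap.comp_assoc]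
  rfl

end IsTrivializing

end SplittingDatum

end

/-! ### Descent of the reassociator; the dual quasi-bialgebra on `R`. -/

noncomputable section

namespace DQBData

open CoalgData

variable {K : Type*} [Field K] {A : Type*} [Ring A] [Bialgebra K A] (g : (ofBialgebra K A).Gauge)

/-- The reassociator of a twist, in terms of the twisted multiplication. -/
theorem twist_reassoc_eq : ((ofBialgebra K A).twist g).reassoc =
    (ofBialgebra K A).cube.convL (g.toFun ∘ₗ ((ofBialgebra K A).twist g).mul.lTensor A)
      ((ofBialgebra K A).cube.convL (g.toFun ∘ₗ dropLeft Coalgebra.counit)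
        ((ofBialgebra K A).cube.convL (g.inv ∘ₗ (dropRight K Coalgebra.counit).lTensor A)
          (g.inv ∘ₗ mulFirst K ((ofBialgebra K A).twist g).mul))) := by
  have hC := isCoalgebra_cube (K := K) (A := A)
  have i1 := g.pull isCoalgMap_dropLeft_cube
  have i4 := g.pull isCoalgMap_dropRight_cube
  have e1 : mulFirst K ((ofBialgebra K A).twist g).mul =
    (ofBialgebra K A).cube.convR ((ofBialgebra K A).cube.convL
      (g.toFun ∘ₗ (dropRight K Coalgebra.counit).lTensor A) (mulFirst K (LinearMap.mul' K A)))
      (g.inv ∘ₗ (dropRight K Coalgebra.counit).lTensor A) :=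
    twist_mulFirst g isCoalgebra_ofCoalgebra
  -- Replacing the original multiplication by the twisted one conjugates `v₁,₂₃` by `v₂₃` and
  -- `w₁₂,₃` by `v₁₂`, which reverses the order of the factors on each side. The new form involves
  -- only the twisted multiplication, the one that descends along `Ψ`.
  rw [twist_mul_lTensor, e1, twist_reassoc, comp_convR, comp_convL, comp_convR, comp_convL]
  simp only [hC.convL_assoc, convR_eq_convL]
  rw [i1.symm.cancel hC, i4.symm.cancel hC]

end DQBData

namespace SplittingDatum

open CoalgData DQBData

variable {K : Type u} [Field K] {A : Type w} [Ring A] [Bialgebra K A]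
  {H : Type v} [Ring H] [HopfAlgebra K H]
  {S : SplittingDatum K A H} {V : Type w} [AddCommGroup V] [Module K V]
  {Y : YDData K H V} {τ : A →ₗ[K] V} {j : V →ₗ[K] A}

theorem IsCoinvariants.coact_τ_one (hS : S.IsCoinvariants Y τ j) :
    Y.coact (τ 1) = 1 ⊗ₜ τ 1 := by
  have h := congr($(hS.coact_τ) 1)
  simpa [convT_apply, ofCoalgebra, Algebra.TensorProduct.one_def, S.π_one, mulLeg_one] using h

namespace IsTrivializing

variable {γ v : V ⊗[K] V →ₗ[K] K}
  {g : (ofBialgebra K A).Gauge} (hS : S.IsCoinvariants Y τ j) (hg : S.IsTrivializing Y τ γ v g)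

include hS hg

theorem descMul_isCoalgMap : IsCoalgMap (Y.tensor Y).toCoalgData Y.toCoalgData
    (descMul τ j g) := by
  refine hS.isCoalgMap_psi₂.of_comp hS.psi₂_surjective ?_
  rw [hg.descMul_psi₂ hS]
  exact hS.coalg.comp (isCoalgMap_twist_mul g)

/-- `Ψ₃` is a coalgebra map, so the four convolution factors are pulled back separately; the one
with `ε` in the first slot needs the invariance of `v`. -/
theorem descReassoc_psi₃ : descReassoc Y γ v (descMul τ j g) ∘ₗ S.psi₃ Y τ =
    ((ofBialgebra K A).twist g).reassoc := by
  have hc := hS.isCoalgMap_psi₃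
  have e1 : (v ∘ₗ (descMul τ j g).lTensor V) ∘ₗ S.psi₃ Y τ =
      g.toFun ∘ₗ ((ofBialgebra K A).twist g).mul.lTensor A := by
    rw [LinearMap.comp_assoc, hg.descMul_lTensor_psi₃ hS, ← LinearMap.comp_assoc, ← hg.toFun_eq]
  have e2 : (v ∘ₗ dropLeft Y.counit) ∘ₗ S.psi₃ Y τ = g.toFun ∘ₗ dropLeft Coalgebra.counit := by
    rw [psi₃, hS.psi_dropLeft hg.invariant, ← hg.toFun_eq]
    rfl
  have e3 : (γ ∘ₗ (dropRight K Y.counit).lTensor V) ∘ₗ S.psi₃ Y τ =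
      g.inv ∘ₗ (dropRight K Coalgebra.counit).lTensor A := by
    rw [LinearMap.comp_assoc, hS.psi₃_dropRight, ← LinearMap.comp_assoc, ← hg.inv_eq]
    rfl
  have e4 : (γ ∘ₗ mulFirst K (descMul τ j g)) ∘ₗ S.psi₃ Y τ =
      g.inv ∘ₗ mulFirst K ((ofBialgebra K A).twist g).mul := by
    rw [LinearMap.comp_assoc, hg.mulFirst_psi₃ hS, ← LinearMap.comp_assoc, ← hg.inv_eq]
  rw [twist_reassoc_eq, ← e1, ← e2, ← e3, ← e4, ← hc.convL_comp, ← hc.convL_comp, ← hc.convL_comp]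
  rfl

theorem descReassoc_invertible : ∃ β, (Y.tensor (Y.tensor Y)).IsConvInv
    (descReassoc Y γ v (descMul τ j g)) β := by
  have hX := hS.isModuleCoalgebra₃.coalgebra
  have hv := hg.isConvInv.symm
  have hm : IsCoalgMap (smashCoalg Y (smashCoalg Y Y.toCoalgData Y.act)
      (tensorAct Y.act Y.act)) (smashCoalg Y Y.toCoalgData Y.act)
      ((descMul τ j g).lTensor V) := by
    refine hS.isCoalgMap_psi₃.of_comp hS.psi₃_surjective ?_
    rw [hg.descMul_lTensor_psi₃ hS]
    exact hS.isCoalgMap_psi₂.comp (IsCoalgMap.id.tensor (isCoalgMap_twist_mul g))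
  have hf : IsCoalgMap (smashCoalg Y (smashCoalg Y Y.toCoalgData Y.act)
      (tensorAct Y.act Y.act)) (smashCoalg Y Y.toCoalgData Y.act)
      (mulFirst K (descMul τ j g)) := by
    refine hS.isCoalgMap_psi₃.of_comp hS.psi₃_surjective ?_
    rw [hg.mulFirst_psi₃ hS]
    exact hS.isCoalgMap_psi₂.comp (isCoalgMap_twist_mul g).mulFirst
  have hr : IsCoalgMap (smashCoalg Y (smashCoalg Y Y.toCoalgData Y.act)
      (tensorAct Y.act Y.act)) (smashCoalg Y Y.toCoalgData Y.act)
      ((dropRight K Y.counit).lTensor V) := by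
    refine hS.isCoalgMap_psi₃.of_comp hS.psi₃_surjective ?_
    rw [hS.psi₃_dropRight]
    exact hS.isCoalgMap_psi₂.comp isCoalgMap_dropRight_cube
  -- The factor `ε ⊗ v` is tested after composition with `Ψ₃`, where invariance identifies it with
  -- `ε ⊗ g` on `A^{⊗3}`.
  have hl : (smashCoalg Y (smashCoalg Y Y.toCoalgData Y.act) (tensorAct Y.act Y.act)).IsConvInv
      (v ∘ₗ dropLeft Y.counit) (γ ∘ₗ dropLeft Y.counit) := by
    refine hS.isCoalgMap_psi₃.isConvInv_of_comp hS.psi₃_surjective ?_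
    rw [psi₃, hS.psi_dropLeft hg.invariant, hS.psi_dropLeft hg.inv_invariant, ← hg.toFun_eq,
      ← hg.inv_eq]
    exact g.pull isCoalgMap_dropLeft_cube
  exact ⟨_, IsConvInv.mul hX (hm.isConvInv_comp hv) (IsConvInv.mul hX hl (IsConvInv.mul hX
    (hr.isConvInv_comp hg.isConvInv) (hf.isConvInv_comp hg.isConvInv)))⟩

theorem descReassoc_act : IsActInvariant (tensorAct Y.act (tensorAct Y.act Y.act))
    (descReassoc Y γ v (descMul τ j g)) := by
  have hX := hS.isModuleCoalgebra₃
  refine hX.isActInvariant_convL (hg.invariant.comp (lTensor_act (hg.descMul_act hS))) <|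
    hX.isActInvariant_convL (hg.invariant.comp (dropLeft_act hS.counit_invariant)) <|
    hX.isActInvariant_convL
      (hg.inv_invariant.comp (lTensor_act (dropRight_act hS.counit_invariant)))
      (hg.inv_invariant.comp (hg.mulFirst_act hS hS.isYDCoalgebra.one_act hS.isYDCoalgebra.mul_act))

omit hS in
/-- `π(a)π(b)π(c)` commutes with the reassociator of the twist. -/
theorem piMul_reassoc : (ofBialgebra K A).cube.convR (S.piMul (S.piMul S.πL))
      ((ofBialgebra K A).twist g).reassoc =
    (ofBialgebra K A).cube.convL ((ofBialgebra K A).twist g).reassoc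
      (S.piMul (S.piMul S.πL)) := by
  -- Applying `π` to quasi-associativity of the twist turns both threefold products into
  -- `π(a)π(b)π(c)`.
  have h := congr(S.πL ∘ₗ $(twist_quasi_assoc g))
  have e (x : A ⊗[K] A) : S.πL (((ofBialgebra K A).twist g).mul x) = S.piMul S.πL x :=
    congr($(hg.π_twist_mul) x)
  have e1 : S.πL ∘ₗ ((ofBialgebra K A).twist g).mul ∘ₗ ((ofBialgebra K A).twist g).mul.lTensor A =
      S.piMul (S.piMul S.πL) := by
    ext x y z
    simp [e]
  have e2 : S.πL ∘ₗ ((ofBialgebra K A).twist g).mul ∘ₗ mulFirst K ((ofBialgebra K A).twist g).mul =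
      S.piMul (S.piMul S.πL) := by
    ext x y z
    simp [e, mulFirst, mul_assoc]
  rwa [comp_convR, comp_convL, e1, e2] at h

/-- After multiplication of the `H`-leg by `π(a)π(b)π(c)`, colinearity of the reassociator becomes
its commutation with `π(a)π(b)π(c)` in `piMul_reassoc`; the factor is then cancelled. -/
theorem descReassoc_coact (z : V ⊗[K] (V ⊗[K] V)) :
    (descReassoc Y γ v (descMul τ j g)).lTensor H
      (tensorCoact Y.coact (tensorCoact Y.coact Y.coact) z) =
      1 ⊗ₜ descReassoc Y γ v (descMul τ j g) z := by
  have hX := isCoalgebra_cube (K := K) (A := A)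
  set α := descReassoc Y γ v (descMul τ j g) with hα
  have hαψ : α ∘ₗ S.psi₃ Y τ = ((ofBialgebra K A).twist g).reassoc := hg.descReassoc_psi₃ hS
  have key : α.lTensor H ∘ₗ tensorCoact Y.coact (tensorCoact Y.coact Y.coact) ∘ₗ S.psi₃ Y τ =
      TensorProduct.mk K H K 1 ∘ₗ α ∘ₗ S.psi₃ Y τ := by
    refine hX.mulLeg_cancel (S.isCoalgMap_piMul (S.isCoalgMap_piMul S.isCoalgMap_π)) ?_
    have h3 : mulLeg ∘ₗ (α.lTensor H).rTensor H = α.lTensor H ∘ₗ mulLeg (K := K) (H := H) := by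
      refine TensorProduct.ext' fun x h => ?_
      induction x using TensorProduct.induction_on with
      | zero => simp
      | add a b ha hb => simp only [map_add, TensorProduct.add_tmul, ha, hb]
      | tmul x y => simp
    have h4 : (ofBialgebra K A).cube.convT (α.lTensor H ∘ₗ
        tensorCoact Y.coact (tensorCoact Y.coact Y.coact) ∘ₗ S.psi₃ Y τ)
          (S.piMul (S.piMul S.πL)) =
        (α.lTensor H).rTensor H ∘ₗ (ofBialgebra K A).cube.convT
          (tensorCoact Y.coact (tensorCoact Y.coact Y.coact) ∘ₗ S.psi₃ Y τ)
            (S.piMul (S.piMul S.πL)) :=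
      (rTensor_comp_convT _ _ _).symm
    have h5 := congr($h3 ∘ₗ (ofBialgebra K A).cube.convT
      (tensorCoact Y.coact (tensorCoact Y.coact Y.coact) ∘ₗ S.psi₃ Y τ)
        (S.piMul (S.piMul S.πL)))
    rw [LinearMap.comp_assoc, LinearMap.comp_assoc, hS.coact_psi₃, lTensor_comp_convT, hαψ] at h5
    refine (congr(mulLeg ∘ₗ $h4).trans h5).trans ?_
    rw [hαψ]
    have h6 : (TensorProduct.rid K H).toLinearMap ∘ₗ mulLeg ∘ₗ (ofBialgebra K A).cube.convT
        (TensorProduct.mk K H K 1 ∘ₗ ((ofBialgebra K A).twist g).reassoc)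
        (S.piMul (S.piMul S.πL)) = (ofBialgebra K A).cube.convL
          ((ofBialgebra K A).twist g).reassoc (S.piMul (S.piMul S.πL)) := by
      refine LinearMap.ext fun c => ?_
      exact eq_of_tmul (f := (TensorProduct.rid K H).toLinearMap ∘ₗ mulLeg ∘ₗ TensorProduct.map
        (TensorProduct.mk K H K 1 ∘ₗ ((ofBialgebra K A).twist g).reassoc)
        (S.piMul (S.piMul S.πL)))
        (g := (TensorProduct.lid K H).toLinearMap ∘ₗ TensorProduct.map
          ((ofBialgebra K A).twist g).reassoc (S.piMul (S.piMul S.πL))) (fun x y => by simp)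
          ((ofBialgebra K A).cube.comul c)
    refine LinearMap.cancel_left (TensorProduct.rid K H).injective |>.1 (Eq.trans ?_ h6.symm)
    exact hg.piMul_reassoc
  obtain ⟨z, rfl⟩ := hS.psi₃_surjective z
  exact congr($key z)

/-- The laws hold for the twist of `A` and are carried by the surjections `τ`, `Ψ₂`, `Ψ₃`, `Ψ₄`,
which intertwine all the structure maps involved. -/
theorem desc_laws : QuasiLaws Y.counit (Y.tensor (Y.tensor Y)).toCoalgData
    (Y.tensor (Y.tensor (Y.tensor Y))).toCoalgData (descMul τ j g) (τ 1)
      (descReassoc Y γ v (descMul τ j g)) := by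
  have hα := hg.descReassoc_psi₃ hS
  have hinv := hg.descReassoc_act hS
  refine (twist_isDualQuasiBialgebra g).laws.transfer (p₁ := τ) (p₂ := S.psi₂ Y τ)
    (p₃ := S.psi₃ Y τ) (p₄ := S.psi₄ Y τ) (j := j) hS.τ_j hS.psi₂_j hS.psi₃_j hS.j_τ_one
    hS.counit_j hS.isCoalgMap_psi₃ hS.psi₃_surjective hS.isCoalgMap_psi₄ hS.psi₄_surjective
    (hg.descReassoc_invertible hS) (hg.descMul_psi₂ hS) hα
    (hg.descMul_lTensor_psi₃ hS) (hg.mulFirst_psi₃ hS)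
    (hg.descMul_lTensor_psi₄ hS) (hg.mulFirst_psi₄ hS) (hg.mulFirst_lTensor_psi₄ hS) ?_ ?_
  · rw [epsTensor_eq_comp_dropLeft, epsTensor_eq_comp_dropLeft, psi₄, hS.psi_dropLeft hinv, hα]
    rfl
  · have e : ((dropRight K Y.counit).lTensor V).lTensor V ∘ₗ S.psi₄ Y τ =
        S.psi₃ Y τ ∘ₗ ((dropRight K (ofCoalgebra K A).counit).lTensor A).lTensor A := by
      rw [psi₄, ← LinearMap.comp_assoc,
        S.psi_naturality (lTensor_act (dropRight_act hS.counit_invariant)), LinearMap.comp_assoc,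
        ← LinearMap.lTensor_comp, hS.psi₃_dropRight, LinearMap.lTensor_comp,
        ← LinearMap.comp_assoc]
      rfl
    rw [tensorEps₃, LinearMap.comp_assoc, e, ← LinearMap.comp_assoc, hα]
    rfl

/-- The dual quasi-bialgebra in the Yetter-Drinfeld category on the coinvariants of `A`. -/
def desc : YDDualQuasiBialgebra K H V where
  toYDData := Y
  mul := descMul τ j g
  one := τ 1
  reassoc := descReassoc Y γ v (descMul τ j g)
  isYDCoalgebra := hS.isYDCoalgebra
  mul_yd := ⟨hg.descMul_act hS, fun z => hg.descMul_coact hS z⟩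
  mul_coalg := hg.descMul_isCoalgMap hS
  one_act := hS.act_τ_one
  one_coact := hS.coact_τ_one
  one_coalg := by
    have := hS.coalg.comp (isCoalgMap_one (K := K) (A := A))
    rwa [LinearMap.comp_toSpanSingleton] at this
  reassoc_act := hg.descReassoc_act hS
  reassoc_coact := hg.descReassoc_coact hS
  laws := hg.desc_laws hS

end IsTrivializing

end SplittingDatum

end

/-! ### Connectedness of `R`. -/

noncomputable section

namespace CoalgData

variable {K : Type*} [Field K] {C D : Type*} [AddCommGroup C] [Module K C] [Coalgebra K C]
  [AddCommGroup D] [Module K D] {Y : CoalgData K D} {p : C →ₗ[K] D} {e : D}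

/-- If a coalgebra map sends the coradical to `K e`, with `e` grouplike, then every nonzero
subcoalgebra of its image contains `e`. -/
theorem IsSubcoalgebra.grouplike_mem {N : Submodule K D} (hN : Y.IsSubcoalgebra N) (hne : N ≠ ⊥)
    (hY : Y.IsCoalgebra) (hp : IsCoalgMap (ofCoalgebra K C) Y p) (hs : Function.Surjective p)
    (he : Y.counit e = 1) (hc : (ofCoalgebra K C).coradical ≤ (K ∙ e).comap p) : e ∈ N := by
  have key : ∀ n, ∀ a ∈ (ofCoalgebra K C).wedgeFil (ofCoalgebra K C).coradical n,
      p a ∈ N → p a ≠ 0 → e ∈ N := by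
    intro n
    induction n with
    | zero =>
      intro a ha _ h0
      rw [wedgeFil, Set.mem_singleton_iff] at ha
      exact absurd (by rw [ha, map_zero]) h0
    | succ n ih =>
      intro a ha haN h0
      -- If some `f` killing `e` does not annihilate `p a`, then `f ∘ p` vanishes on the coradical
      -- and acting by it lowers the filtration index while staying in `N`. Otherwise `p a` is a
      -- nonzero multiple of `e`.
      by_cases h : ∃ f : D →ₗ[K] K, f e = 0 ∧ Y.convR LinearMap.id f (p a) ≠ 0
      · obtain ⟨f, hf, hfa⟩ := h
        have hpf : Y.convR LinearMap.id f (p a) =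
            p ((ofCoalgebra K C).convR LinearMap.id (f ∘ₗ p) a) := by
          have h1 := hp.convR_comp LinearMap.id f
          have h2 := comp_convR (X := ofCoalgebra K C) p LinearMap.id (f ∘ₗ p)
          exact congr($(h1.trans h2.symm) a)
        have hm := hN.convR_mem f haN
        rw [hpf] at hfa hm
        refine ih _ (ha (f ∘ₗ p) fun x hx => ?_) hm hfa
        obtain ⟨c, hc⟩ := Submodule.mem_span_singleton.1 (hc hx)
        rw [LinearMap.mem_ker, LinearMap.comp_apply, ← hc, map_smul, hf, smul_zero]
      · push Not at h
        have hx : p a = Y.counit (p a) • e := by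
          rw [← sub_eq_zero, ← Module.forall_dual_apply_eq_zero_iff K]
          intro f
          -- Any functional can be corrected by a multiple of the counit so as to vanish at `e`;
          -- applying the counit then gives `f(p a) = f(e)ε(p a)`.
          have h1 := h (f - f e • Y.counit) (by simp [he])
          have h2 := congr(Y.counit $h1)
          have h3 : Y.counit ∘ₗ Y.convR LinearMap.id (f - f e • Y.counit) =
              f - f e • Y.counit := by
            rw [comp_convR, LinearMap.comp_id, convR_eq_convL, hY.counit_convL]
          rw [← LinearMap.comp_apply, h3, map_zero, LinearMap.sub_apply, LinearMap.smul_apply,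
            smul_eq_mul] at h2
          rw [map_sub, map_smul, smul_eq_mul, mul_comm, h2]
        have h1 : Y.counit (p a) ≠ 0 := fun h' => h0 (by rw [hx, h', zero_smul])
        rw [hx] at haN
        exact (N.smul_mem_iff h1).1 haN
  obtain ⟨x, hxN, hx0⟩ := N.ne_bot_iff.1 hne
  obtain ⟨a, rfl⟩ := hs x
  obtain ⟨n, hn⟩ := exists_mem_wedgeFil_coradical (K := K) a
  exact key n a hn hxN hx0

/-- The line spanned by `e` is a subcoalgebra contained in every nonzero subcoalgebra, so it is the
only simple one. -/
theorem IsCoalgMap.coradical_eq (hY : Y.IsCoalgebra) (hp : IsCoalgMap (ofCoalgebra K C) Y p)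
    (hs : Function.Surjective p) (he : Y.counit e = 1) (he' : Y.comul e = e ⊗ₜ e)
    (hc : (ofCoalgebra K C).coradical ≤ (K ∙ e).comap p) : Y.coradical = K ∙ e := by
  have hsub : Y.IsSubcoalgebra (K ∙ e) := by
    intro x hx
    obtain ⟨c, rfl⟩ := Submodule.mem_span_singleton.1 hx
    have h : e ∈ K ∙ e := Submodule.mem_span_singleton_self e
    exact ⟨c • ((⟨e, h⟩ : K ∙ e) ⊗ₜ (⟨e, h⟩ : K ∙ e)), by simp [he']⟩
  have hne : K ∙ e ≠ ⊥ := by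
    rw [Ne, Submodule.span_singleton_eq_bot]
    rintro rfl
    simp at he
  have hle (N : Submodule K D) (hN : Y.IsSubcoalgebra N) (h : N ≠ ⊥) : K ∙ e ≤ N :=
    (Submodule.span_singleton_le_iff_mem _ _).2 (hN.grouplike_mem h hY hp hs he hc)
  refine le_antisymm (sSup_le fun N hN => ?_) (le_sSup ⟨hsub, hne, fun N' h' hN' => ?_⟩)
  · exact ((hN.2.2 _ (hle N hN.1 hN.2.1) hsub).resolve_left hne).ge
  · exact or_iff_not_imp_left.2 fun h => le_antisymm h' (hle N' hN' h)

end CoalgData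

namespace SplittingDatum

open CoalgData DQBData

variable {K : Type u} [Field K] {A : Type w} [Ring A] [Bialgebra K A]
  {H : Type v} [Ring H] [HopfAlgebra K H]
  {S : SplittingDatum K A H} {V : Type w} [AddCommGroup V] [Module K V]
  {Y : YDData K H V} {τ : A →ₗ[K] V} {j : V →ₗ[K] A}

theorem IsCoinvariants.coradical_eq (hS : S.IsCoinvariants Y τ j)
    (hcorad : LinearMap.range S.σL = (ofCoalgebra K A).coradical) :
    Y.coradical = K ∙ τ 1 := by
  refine hS.coalg.coradical_eq hS.isYDCoalgebra.coalgebra hS.τ_surjective ?_ ?_ ?_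
  · rw [hS.counit_τ, Bialgebra.counit_one]
  · rw [hS.coalg.map_comul]
    simp [ofCoalgebra, Algebra.TensorProduct.one_def]
  · rw [← hcorad]
    rintro _ ⟨h, rfl⟩
    have := hS.τ_mul_σ 1 h
    rw [one_mul] at this
    rw [Submodule.mem_comap, this]
    exact Submodule.smul_mem _ _ (Submodule.mem_span_singleton_self _)

end SplittingDatum

end

/-! ### The isomorphism with the bosonization and the main theorem. -/

noncomputable section

/-- Composition of isomorphisms of dual quasi-bialgebras. -/
def DQBData.Iso.trans {K : Type*} [Field K] {D E F : Type*} [AddCommGroup D] [Module K D]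
    [AddCommGroup E] [Module K E] [AddCommGroup F] [Module K F] {X : DQBData K D}
    {Y : DQBData K E} {Z : DQBData K F} (i : X.Iso Y) (k : Y.Iso Z) : X.Iso Z where
  equiv := i.equiv.trans k.equiv
  coalg := k.coalg.comp i.coalg
  map_one := by rw [LinearEquiv.trans_apply, i.map_one, k.map_one]
  map_mul x y := by simp only [LinearEquiv.trans_apply, i.map_mul, k.map_mul]
  map_reassoc x y z := by simp only [LinearEquiv.trans_apply, i.map_reassoc, k.map_reassoc]

namespace SplittingDatum

open CoalgData DQBData

variable {K : Type u} [Field K] {A : Type w} [Ring A] [Bialgebra K A]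
  {H : Type v} [Ring H] [HopfAlgebra K H]
  {S : SplittingDatum K A H} {V : Type w} [AddCommGroup V] [Module K V]
  {Y : YDData K H V} {τ : A →ₗ[K] V} {j : V →ₗ[K] A}

theorem dropH_convT (S : SplittingDatum K A H) (τ : A →ₗ[K] V) (a : A) : dropH K H V ((ofCoalgebra K A).convT τ S.πL a) = τ a := by
  have h := isCoalgebra_ofCoalgebra.dropRight_convT τ a
  have e : (ofCoalgebra K H).counit ∘ₗ S.πL = (ofCoalgebra K A).counit :=
    S.isCoalgMap_π.counit_comp
  refine Eq.trans ?_ h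
  rw [← e, dropH, dropRight, LinearMap.comp_apply, lTensor_convT]
  rfl

/-- The isomorphism of `A` with `R ⊗ H` is thus `Ψ` for the module `W = H`, restricted to `A ⊗ 1`,
so the general facts on `Ψ` apply to it. -/
theorem psi_tmul_one (a : A) : S.psi τ (LinearMap.mul' K H) (a ⊗ₜ 1) =
    (ofCoalgebra K A).convT τ S.πL a := by
  rw [psi_tmul]
  congr 2
  ext x
  simp [orbit]

namespace IsTrivializing

variable {γ v : V ⊗[K] V →ₗ[K] K}
  {g : (ofBialgebra K A).Gauge} (hS : S.IsCoinvariants Y τ j) (hg : S.IsTrivializing Y τ γ v g)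

/-- The twist of `A` is isomorphic to the bosonization of the coinvariants. -/
def isoBosonization (e : A ≃ₗ[K] V ⊗[K] H)
    (he : ∀ a, e a = (ofCoalgebra K A).convT τ S.πL a) :
    ((ofBialgebra K A).twist g).Iso (hg.desc hS).bosonization where
  equiv := e
  coalg := by
    have h := (hS.isCoalgMap_psi (isModuleCoalgebra_self (K := K) (H := H))).comp
      (isCoalgMap_tmul_one (K := K) (A := H) (Y := ofCoalgebra K A))
    have h1 : S.psi τ (LinearMap.mul' K H) ∘ₗ (TensorProduct.mk K A H).flip 1 =
        e.toLinearMap := by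
      ext1 a
      exact (psi_tmul_one a).trans (he a).symm
    rw [h1] at h
    exact h
  map_one := by
    have h := hS.convT_j (τ 1)
    rw [hS.j_τ_one] at h
    exact (he 1).trans h
  map_mul x y := by
    -- Compatibility with products is `psi_twist_mul` for `W = H` at the unit.
    have h := hg.psi_twist_mul hS (isModuleCoalgebra_self (K := K) (H := H)).mul_act x y 1
    rw [psi_tmul_one, psi_tmul_one, ← he, ← he] at h
    refine h.symm.trans ?_
    rw [he x]
    rfl
  map_reassoc x y z := by
    refine Eq.trans ?_ congr($(hg.descReassoc_psi₃ hS) (x ⊗ₜ (y ⊗ₜ z)))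
    rw [he x, he y, he z]
    change descReassoc Y γ v (descMul τ j g) (pushAct (tensorAct Y.act Y.act)
      (_ ⊗ₜ pushAct Y.act (_ ⊗ₜ dropH K H V _))) = _
    rw [dropH_convT]
    rfl

end IsTrivializing

end SplittingDatum

theorem mainTheorem2 {K : Type u} [Field K] [CharZero K] {H : Type v} [Ring H] [HopfAlgebra K H]
    {A : Type w} [Ring A] [Bialgebra K A] (lam : H →ₗ[K] K) (hlam : IsAdInvariantIntegral lam)
    (S : SplittingDatum K A H)
    (hcorad : LinearMap.range S.σL = (CoalgData.ofCoalgebra K A).coradical) :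
    ∃ v : S.R ⊗[K] S.R →ₗ[K] K,
      (S.yd.tensor S.yd).IsConvInv (lam ∘ₗ S.ξ) v ∧
      ∃ vA : (DQBData.ofBialgebra K A).Gauge, vA.toFun = S.gaugeOf v ∧
      ∃ (Q : Type w) (_ : AddCommGroup Q) (_ : Module K Q) (X : YDDualQuasiBialgebra K H Q),
        X.Connected ∧ X.bosonization.IsDualQuasiBialgebra ∧
        Nonempty (((DQBData.ofBialgebra K A).twist vA).Iso X.bosonization) ∧
        (DQBData.ofBialgebra K A).QuasiIsomorphic X.bosonization := by
  have hS := S.isCoinvariants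
  obtain ⟨v, hv⟩ := hS.exists_isConvInv_cocycle hlam hcorad
  have hg := hS.isTrivializing hlam hv
  set g := hS.gaugeOfInv hv (hS.lam_cocycle_one_left hlam) (hS.lam_cocycle_one_right hlam)
  have i := hg.isoBosonization hS S.toSmash fun _ => rfl
  have hQ := i.isDualQuasiBialgebra (DQBData.twist_isDualQuasiBialgebra g)
  -- For the quasi-isomorphism, `A` is recovered by twisting its twist with the inverse gauge
  -- transformation, which is then transported along `i` to the bosonization.
  refine ⟨v, hv, g, ?_, S.R, inferInstance, inferInstance, hg.desc hS,
    hS.coradical_eq hcorad, hQ, ⟨i⟩, DQBData.ofBialgebra_isDualQuasiBialgebra, hQ,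
    i.gauge g.inverse, ⟨(DQBData.twistInverseIso g).trans (i.twist g.inverse)⟩⟩
  -- The functional `vΨ₂` used throughout agrees with `℧²(v)` transported to `A`, since forgetting
  -- the `H`-part of `τ(y₁) ⊗ π(y₂)` leaves `τ(y)`.
  refine hg.toFun_eq.trans (TensorProduct.ext' fun x y => ?_)
  exact congrArg (fun z => v (pushAct S.act (S.toSmash x ⊗ₜ z))) (S.dropH_convT S.τ y).symm

end
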